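/- Let $M$ be a smooth manifold of dimension $n$. An *elliptic divisor* on $M$ is a sheaf of ideals $I_{|D|}\subset C^\infty(M;\mathbb R)$, locally generated by one function with nowhere dense zero set, such that around every point there are centred smooth coordinates $(x_1,\dots,x_n)$ and an integer $k$ (the multiplicity of the point) in which $I_{|D|}=\langle r_1^2\cdots r_k^2\rangle$, $r_i^2=x_{2i-1}^2+x_{2i}^2$. Its *elliptic tangent bundle* $\mathcal A_{|D|}$ is the Lie algebroid whose sections are the vector fields preserving $I_{|D|}$. Let $I_{|D|}$ be an elliptic divisor on $M$, let $Y\subset M$ be a closed embedded submanifold of codimension $2l$, $l\ge 1$, and let $I_Y$ be a holomorphic ideal for $Y$ adapted to $I_{|D|}$. That is, $I_Y\subset C^\infty(M;\mathbb C)$ is a sheaf of ideals which is trivial off $Y$, and around every $y\in Y$ there are coordinates $(z_1,\dots,z_k,x_{2k+1},\dots,x_n):U\to\mathbb C^k\times\mathbb R^{n-2k}$ with $k\ge l$ such that $$Y\cap U=\{z_1=\dots=z_l=0\},\qquad I_Y|_U=\langle z_1,\dots,z_l\rangle,\qquad I_{|D|}|_U=\langle |z_1|^2\cdots|z_k|^2\rangle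 .$$ (For instance, $Y$ may be an irreducible component of the locus $D(l)$ of points of multiplicity at least $l$ that carries such an ideal.) Then the blow-up of $I_Y$ in $M$ exists: there is a smooth manifold $\tilde M$ of dimension $n$ with a smooth map $p:\tilde M\to M$ such that $p^*I_Y$ is a divisor (locally generated by one function with nowhere dense zero set) and every smooth map $f:X\to M$ for which $f^*I_Y$ is a divisor factors uniquely through $p$ by a smooth map. Moreover, for every such $p:\tilde M\to M$: 1. the radical $I_{|\tilde D|}:=\sqrt{p^*I_{|D|}}$ is an elliptic divisor on $\tilde M$; 2. the blow-down map $p$ induces a Lie algebroid map $p_*:\mathcal A_{|\tilde D|}\to\mathcal A_{|D|}$ covering $p$ and compatible with the anchors, that is, $\rho\circ p_*=Tp\circ\rho$, such that $$p_*:(\mathcal A_{|\tilde D|})_x\longrightarrow(\mathcal A_{|D|})_{p(x)}$$ is an isomorphism for every $x\in\tilde M$. -/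

import Mathlib

open scoped Manifold ContDiff Topology

universe u

noncomputable section

/-- The algebra `C^∞(M; 𝕂)` of smooth functions on an `n`-dimensional manifold, where `𝕂` is
`ℝ` or `ℂ`. -/
def smoothSubalgebra (n : ℕ) (M : Type*) [TopologicalSpace M]
    [ChartedSpace (EuclideanSpace ℝ (Fin n)) M]
    (𝕂 : Type*) [NormedField 𝕂] [NormedAlgebra ℝ 𝕂] : Subalgebra ℝ (M → 𝕂) where
  carrier := {f | ContMDiff (𝓡 n) 𝓘(ℝ, 𝕂) ∞ f}
  add_mem' := fun ha hb => contDiff_add.contMDiff.comp (ha.prodMk_space hb)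
  mul_mem' := fun ha hb => contDiff_mul.contMDiff.comp (ha.prodMk_space hb)
  algebraMap_mem' := fun _ => contMDiff_const

/-- Smooth functions `M → 𝕂`. -/
def SmoothFn (n : ℕ) (M : Type*) [TopologicalSpace M]
    [ChartedSpace (EuclideanSpace ℝ (Fin n)) M]
    (𝕂 : Type*) [NormedField 𝕂] [NormedAlgebra ℝ 𝕂] : Type _ :=
  smoothSubalgebra n M 𝕂

section SmoothFn

variable {n : ℕ} {M : Type*} [TopologicalSpace M] [ChartedSpace (EuclideanSpace ℝ (Fin n)) M]
  {𝕂 : Type*} [NormedField 𝕂] [NormedAlgebra ℝ 𝕂]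

instance : CommRing (SmoothFn n M 𝕂) := inferInstanceAs (CommRing (smoothSubalgebra n M 𝕂))

instance : Algebra ℝ (SmoothFn n M 𝕂) := inferInstanceAs (Algebra ℝ (smoothSubalgebra n M 𝕂))

instance : FunLike (SmoothFn n M 𝕂) M 𝕂 where
  coe f := f.1
  coe_injective _ _ h := Subtype.ext h

end SmoothFn

/-- The composition `f ∘ p` of a smooth function with a smooth map. -/
def SmoothFn.comp {n : ℕ} {M : Type*} [TopologicalSpace M]
    [ChartedSpace (EuclideanSpace ℝ (Fin n)) M] {d : ℕ} {N : Type*} [TopologicalSpace N]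
    [ChartedSpace (EuclideanSpace ℝ (Fin d)) N] {𝕂 : Type*} [NormedField 𝕂] [NormedAlgebra ℝ 𝕂]
    (f : SmoothFn n M 𝕂) (p : C^∞⟮𝓡 d, N; 𝓡 n, M⟯) : SmoothFn d N 𝕂 :=
  ⟨f ∘ p, ContMDiff.comp (g := f) f.2 p.contMDiff⟩

/-! ### Sheaves of ideals of smooth functions

A sheaf of ideals of `C^∞` on a (Hausdorff, second countable) manifold is the same thing as an
ideal of the ring of global smooth functions which is *local*: a function that coincides near
every point with a member of the ideal is itself a member. -/

section Ideals

variable {n : ℕ} {M : Type*} [TopologicalSpace M] [ChartedSpace (EuclideanSpace ℝ (Fin n)) M]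
  {𝕂 : Type*} [NormedField 𝕂] [NormedAlgebra ℝ 𝕂]

/-- The germ of `g` at `x` belongs to the stalk of `I` at `x`. -/
def GermMem (I : Ideal (SmoothFn n M 𝕂)) (x : M) (g : M → 𝕂) : Prop :=
  ∃ f ∈ I, g =ᶠ[𝓝 x] f

/-- The ideal is (the global sections of) a sheaf of ideals. -/
def IsLocalIdeal (I : Ideal (SmoothFn n M 𝕂)) : Prop :=
  ∀ f : SmoothFn n M 𝕂, (∀ x, GermMem I x f) → f ∈ I

/-- The ideal of global sections of the sheaf generated by `I`. -/
def localize (I : Ideal (SmoothFn n M 𝕂)) : Ideal (SmoothFn n M 𝕂) where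
  carrier := {f | ∀ x, GermMem I x f}
  zero_mem' := fun _ => ⟨0, I.zero_mem, Filter.EventuallyEq.rfl⟩
  add_mem' := by
    intro a b ha hb x
    obtain ⟨f, hf, hf'⟩ := ha x
    obtain ⟨g, hg, hg'⟩ := hb x
    exact ⟨f + g, I.add_mem hf hg, hf'.add hg'⟩
  smul_mem' := by
    intro c a ha x
    obtain ⟨f, hf, hf'⟩ := ha x
    exact ⟨c * f, I.mul_mem_left c hf, (Filter.EventuallyEq.refl _ (c : M → 𝕂)).mul hf'⟩

/-- `I|_U = ⟨s₁, …, s_r⟩`: the sheaf of ideals `I` is generated over `U` by the functions `s i`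
(which only matter on `U`); equality of sheaves of ideals is tested on stalks. -/
def GeneratedOn {r : ℕ} (I : Ideal (SmoothFn n M 𝕂)) (U : Set M) (s : Fin r → M → 𝕂) : Prop :=
  ∀ x ∈ U, ∀ g : M → 𝕂, GermMem I x g ↔
    ∃ h : Fin r → SmoothFn n M 𝕂, g =ᶠ[𝓝 x] fun y => ∑ i, h i y * s i y

/-- A divisor: a sheaf of ideals locally generated by a single smooth function whose zero set is
nowhere dense. It is real or complex according to `𝕂`. -/
structure IsDivisor (I : Ideal (SmoothFn n M 𝕂)) : Prop where
  isLocal : IsLocalIdeal I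
  locally_principal : ∀ x : M, ∃ U : Set M, IsOpen U ∧ x ∈ U ∧ ∃ f : M → 𝕂,
    ContMDiffOn (𝓡 n) 𝓘(ℝ, 𝕂) ∞ f U ∧ GeneratedOn I U (fun _ : Fin 1 => f) ∧
    IsNowhereDense {y ∈ U | f y = 0}

/-- The pullback `p^* I` along a smooth map `p : N → M`: the sheaf of ideals on `N` generated by
the functions `f ∘ p`, `f ∈ I`. -/
def pullbackIdeal {d : ℕ} {N : Type*} [TopologicalSpace N]
    [ChartedSpace (EuclideanSpace ℝ (Fin d)) N]
    (p : C^∞⟮𝓡 d, N; 𝓡 n, M⟯) (I : Ideal (SmoothFn n M 𝕂)) : Ideal (SmoothFn d N 𝕂) :=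
  localize (Ideal.span {g | ∃ f ∈ I, g = SmoothFn.comp f p})

end Ideals

/-! ### Complex coordinates, elliptic divisors, holomorphic ideals -/

/-- The complex coordinate `z_{i+1} = x_{2i+1} + √-1 x_{2i+2}` of a point of `ℝⁿ` (with
`i = 0, 1, …`); it is only used when `2 (i + 1) ≤ n`. -/
def zCoord {n : ℕ} (i : ℕ) (v : EuclideanSpace ℝ (Fin n)) : ℂ :=
  if h : 2 * i + 1 < n then ⟨v ⟨2 * i, by omega⟩, v ⟨2 * i + 1, h⟩⟩ else 0

/-- The function `|z₁|² ⋯ |z_k|² = r₁² ⋯ r_k²` on `ℝⁿ`. -/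
def ellipticModel {n : ℕ} (k : ℕ) (v : EuclideanSpace ℝ (Fin n)) : ℝ :=
  ∏ i ∈ Finset.range k, Complex.normSq (zCoord i v)

section Divisors

variable {n : ℕ} {M : Type*} [TopologicalSpace M] [ChartedSpace (EuclideanSpace ℝ (Fin n)) M]

/-- `I` is an elliptic divisor: around every point there are centred smooth coordinates in which
it is generated by `r₁² ⋯ r_k²`. -/
structure IsEllipticDivisor (I : Ideal (SmoothFn n M ℝ)) : Prop where
  isDivisor : IsDivisor I
  exists_chart : ∀ x : M, ∃ φ ∈ IsManifold.maximalAtlas (𝓡 n) ∞ M, x ∈ φ.source ∧ φ x = 0 ∧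
    ∃ k : ℕ, 2 * k ≤ n ∧
      GeneratedOn I φ.source (fun _ : Fin 1 => fun y => ellipticModel k (φ y))

/-- The coordinates `φ = (z₁, …, z_l, x_{2l+1}, …, x_n)` satisfy `Y ∩ U = {z₁ = ⋯ = z_l = 0}` and
`J|_U = ⟨z₁, …, z_l⟩` on their domain `U`. -/
structure IsHolomorphicChart (l : ℕ) (Y : Set M) (J : Ideal (SmoothFn n M ℂ))
    (φ : OpenPartialHomeomorph M (EuclideanSpace ℝ (Fin n))) : Prop where
  mem_atlas : φ ∈ IsManifold.maximalAtlas (𝓡 n) ∞ M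
  two_mul_le : 2 * l ≤ n
  mem_iff : ∀ y ∈ φ.source, y ∈ Y ↔ ∀ i < l, zCoord i (φ y) = 0
  generated : GeneratedOn J φ.source (fun i : Fin l => fun y => zCoord i (φ y))

/-- `Y` is a closed embedded submanifold of codimension `2l` and `J` is a holomorphic ideal
for `Y`. -/
structure IsHolomorphicIdeal (l : ℕ) (Y : Set M) (J : Ideal (SmoothFn n M ℂ)) : Prop where
  isClosed : IsClosed Y
  isLocal : IsLocalIdeal J
  generated_compl : GeneratedOn J Yᶜ (fun _ : Fin 1 => fun _ => 1)
  exists_chart : ∀ y ∈ Y, ∃ φ, y ∈ φ.source ∧ IsHolomorphicChart l Y J φ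

/-- The holomorphic ideal `J` for `Y` is adapted to the elliptic divisor `I`. -/
def IsAdapted (I : Ideal (SmoothFn n M ℝ)) (l : ℕ) (Y : Set M)
    (J : Ideal (SmoothFn n M ℂ)) : Prop :=
  ∀ y ∈ Y, ∃ φ, y ∈ φ.source ∧ IsHolomorphicChart l Y J φ ∧
    ∃ k : ℕ, l ≤ k ∧ 2 * k ≤ n ∧
      GeneratedOn I φ.source (fun _ : Fin 1 => fun y => ellipticModel k (φ y))

end Divisors

/-! ### Blow-ups -/

/-- `p : B → M` is the blow-up of the complex sheaf of ideals `J` in `M`: the ideal `p^* J` is a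
divisor, and every smooth map `f : X → M` for which `f^* J` is a divisor factors uniquely through
`p`. Here `X` runs over all smooth manifolds of any dimension `d`. -/
structure IsBlowUp {n : ℕ} {M : Type u} [TopologicalSpace M]
    [ChartedSpace (EuclideanSpace ℝ (Fin n)) M] (J : Ideal (SmoothFn n M ℂ))
    {B : Type u} [TopologicalSpace B] [ChartedSpace (EuclideanSpace ℝ (Fin n)) B]
    (p : C^∞⟮𝓡 n, B; 𝓡 n, M⟯) : Prop where
  isManifold : IsManifold (𝓡 n) ∞ B
  t2 : T2Space B
  secondCountable : SecondCountableTopology B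
  isDivisor : IsDivisor (pullbackIdeal p J)
  existsUnique_lift : ∀ (d : ℕ) (X : Type u) [TopologicalSpace X]
    [ChartedSpace (EuclideanSpace ℝ (Fin d)) X] [IsManifold (𝓡 d) ∞ X] [T2Space X]
    [SecondCountableTopology X] (f : C^∞⟮𝓡 d, X; 𝓡 n, M⟯),
    IsDivisor (pullbackIdeal f J) → ∃! g : C^∞⟮𝓡 d, X; 𝓡 n, B⟯, p.comp g = f

/-! ### The elliptic tangent bundle -/

section Tangent

variable {n : ℕ} {M : Type*} [TopologicalSpace M] [ChartedSpace (EuclideanSpace ℝ (Fin n)) M]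

/-- Smooth vector fields on `M`, as derivations of `C^∞(M; ℝ)`. -/
abbrev VecField (n : ℕ) (M : Type*) [TopologicalSpace M]
    [ChartedSpace (EuclideanSpace ℝ (Fin n)) M] : Type _ :=
  Derivation ℝ (SmoothFn n M ℝ) (SmoothFn n M ℝ)

/-- The `C^∞(M)`-module `Γ(𝒜)` of vector fields preserving the ideal `I`; for an elliptic divisor
these are the sections of the elliptic tangent bundle. -/
def ellipticSections (I : Ideal (SmoothFn n M ℝ)) : Submodule (SmoothFn n M ℝ) (VecField n M) where
  carrier := {X | ∀ f ∈ I, X f ∈ I}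
  zero_mem' := fun _ _ => I.zero_mem
  add_mem' := fun hX hY f hf => I.add_mem (hX f hf) (hY f hf)
  smul_mem' := fun c _ hX f hf => I.mul_mem_left c (hX f hf)

/-- The Lie bracket of sections of the elliptic tangent bundle is that of vector fields. -/
def ellipticBracket (I : Ideal (SmoothFn n M ℝ)) (X Y : ellipticSections I) :
    ellipticSections I :=
  ⟨⁅(X : VecField n M), (Y : VecField n M)⁆, fun f hf => by
    rw [Derivation.commutator_apply]
    exact I.sub_mem (X.2 _ (Y.2 f hf)) (Y.2 _ (X.2 f hf))⟩

/-- The ideal `𝔪ₓ` of smooth functions vanishing at `x`. -/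
def vanishingIdealAt (n : ℕ) {M : Type*} [TopologicalSpace M]
    [ChartedSpace (EuclideanSpace ℝ (Fin n)) M] (x : M) : Ideal (SmoothFn n M ℝ) where
  carrier := {f | f x = 0}
  zero_mem' := rfl
  add_mem' := by
    intro f g hf hg
    change f x + g x = 0
    rw [show f x = 0 from hf, show g x = 0 from hg, add_zero]
  smul_mem' := by
    intro c f hf
    change c x * f x = 0
    rw [show f x = 0 from hf, mul_zero]

/-- The fibre `𝒜ₓ = Γ(𝒜) / 𝔪ₓ Γ(𝒜)` of the elliptic tangent bundle (Serre-Swan). -/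
abbrev EllipticFibre (I : Ideal (SmoothFn n M ℝ)) (x : M) : Type _ :=
  ellipticSections I ⧸
    (vanishingIdealAt n x • (⊤ : Submodule (SmoothFn n M ℝ) (ellipticSections I)))

/-- The value in the fibre `𝒜ₓ` of a section of the elliptic tangent bundle. -/
def valueAt (I : Ideal (SmoothFn n M ℝ)) (x : M) (X : ellipticSections I) : EllipticFibre I x :=
  Submodule.Quotient.mk X

/-- The tangent vector at `x` of a vector field, as the functional `f ↦ X f (x)` on functions. -/
def tangentAt (n : ℕ) {M : Type*} [TopologicalSpace M]
    [ChartedSpace (EuclideanSpace ℝ (Fin n)) M] (x : M) : VecField n M →ₗ[ℝ] (SmoothFn n M ℝ →ₗ[ℝ] ℝ) where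
  toFun X :=
    { toFun := fun f => X f x
      map_add' := fun f g => by rw [map_add]; rfl
      map_smul' := fun c f => by rw [Derivation.map_smul]; rfl }
  map_add' := fun _ _ => rfl
  map_smul' := fun _ _ => rfl

theorem tangentAt_eq_zero (I : Ideal (SmoothFn n M ℝ)) (x : M) (X : ellipticSections I)
    (hX : X ∈ vanishingIdealAt n x • (⊤ : Submodule (SmoothFn n M ℝ) (ellipticSections I))) :
    tangentAt n x (X : VecField n M) = 0 := by
  refine Submodule.smul_induction_on hX ?_ ?_
  · intro f hf Z _
    ext g
    change f x * (Z : VecField n M) g x = 0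
    rw [show f x = 0 from hf, zero_mul]
  · intro Z W hZ hW
    rw [Submodule.coe_add, map_add, hZ, hW, add_zero]

/-- The anchor `ρₓ : 𝒜ₓ → TₓM`, where tangent vectors at `x` are regarded as derivations
`C^∞(M; ℝ) → ℝ` at `x`. -/
def anchor (I : Ideal (SmoothFn n M ℝ)) (x : M) :
    EllipticFibre I x →ₗ[ℝ] (SmoothFn n M ℝ →ₗ[ℝ] ℝ) where
  toFun := Quotient.lift (fun X : ellipticSections I => tangentAt n x (X : VecField n M)) (by
    intro X Z hXZ
    have h := tangentAt_eq_zero I x (X - Z) ((Submodule.quotientRel_def _).1 hXZ)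
    rw [Submodule.coe_sub, map_sub] at h
    exact sub_eq_zero.1 h)
  map_add' := by
    rintro ⟨X⟩ ⟨Z⟩
    rfl
  map_smul' := by
    rintro c ⟨X⟩
    rfl

end Tangent

/-- The family of linear maps `Φ x : 𝒜̃ₓ → 𝒜_{p x}` is a Lie algebroid map covering
`p : B → M`, from the elliptic tangent bundle of `I'` on `B` to that of `I` on `M`.
* `smooth`: for every section `X` of `𝒜̃`, `Φ X` is a smooth section of `p^*𝒜`, that is, locally
  of the form `∑ fᵢ p^*Xᵢ`;
* `anchor_comm`: `ρ ∘ Φ = Tp ∘ ρ`, that is, `ρ(Φ a)` differentiates `g` as `ρ(a)` differentiates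
  `g ∘ p`;
* `bracket`: if `Φ X = ∑ fᵢ p^*Xᵢ` and `Φ Y = ∑ gⱼ p^*Yⱼ` near `x`, then at `x`
  `Φ [X, Y] = ∑ fᵢ gⱼ p^*[Xᵢ, Yⱼ] + ∑ X(gⱼ) p^*Yⱼ - ∑ Y(fᵢ) p^*Xᵢ`. -/
structure IsLieAlgebroidMap {n m : ℕ}
    {M : Type*} [TopologicalSpace M] [ChartedSpace (EuclideanSpace ℝ (Fin n)) M]
    {B : Type*} [TopologicalSpace B] [ChartedSpace (EuclideanSpace ℝ (Fin m)) B]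
    (I' : Ideal (SmoothFn m B ℝ)) (I : Ideal (SmoothFn n M ℝ)) (p : C^∞⟮𝓡 m, B; 𝓡 n, M⟯)
    (Φ : ∀ x : B, EllipticFibre I' x →ₗ[ℝ] EllipticFibre I (p x)) : Prop where
  smooth : ∀ (X : ellipticSections I') (x : B),
    ∃ (r : ℕ) (f : Fin r → SmoothFn m B ℝ) (Z : Fin r → ellipticSections I),
      ∀ᶠ y in 𝓝 x, Φ y (valueAt I' y X) = ∑ i, f i y • valueAt I (p y) (Z i)
  anchor_comm : ∀ (x : B) (a : EllipticFibre I' x) (g : SmoothFn n M ℝ),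
    anchor I (p x) (Φ x a) g = anchor I' x a (SmoothFn.comp g p)
  bracket : ∀ (X Y : ellipticSections I') (x : B) (r s : ℕ)
    (f : Fin r → SmoothFn m B ℝ) (Z : Fin r → ellipticSections I)
    (g : Fin s → SmoothFn m B ℝ) (W : Fin s → ellipticSections I),
    (∀ᶠ y in 𝓝 x, Φ y (valueAt I' y X) = ∑ i, f i y • valueAt I (p y) (Z i)) →
    (∀ᶠ y in 𝓝 x, Φ y (valueAt I' y Y) = ∑ j, g j y • valueAt I (p y) (W j)) →
    Φ x (valueAt I' x (ellipticBracket I' X Y)) =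
      ∑ i, ∑ j, (f i x * g j x) • valueAt I (p x) (ellipticBracket I (Z i) (W j))
      + ∑ j, ((X : VecField m B) (g j) x) • valueAt I (p x) (W j)
      - ∑ i, ((Y : VecField m B) (f i) x) • valueAt I (p x) (Z i)

end

/-! A point of the blow-up is taken to be a point y of M together with a nonzero functional λ on the
fibre of J at y, up to scaling. Off Y there is exactly one such functional. Over Y the fibre is
spanned by z_1, …, z_l, and s(y) λ(t) = t(y) λ(s) gives the equations z_i λ_α = z_α λ_i. Hence where
λ(z_α) ≠ 0 the numbers w_α = z_α and w_i = λ(z_i)/λ(z_α), with the untouched coordinates, are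
coordinates in which the blow-down map is z_i = w_α w_i (`blowMap`).

If f^*J has a local generator γ, every t ∘ f with t in J is a smooth multiple of γ, and the values
at x of the quotients form a functional, hence a lift of f (`IsDivisibleOn.lift`). Its coordinates
are ratios of smooth functions, so it is smooth. It is unique because there is one point of the
blow-up over f(z) whenever γ(z) ≠ 0, which happens densely, and the blow-up is Hausdorff. Inverse
charts are lifts of the same kind, so the same argument makes the transition maps smooth.

In these coordinates ∏|z_i|² pulls back to |w_α|^(2(m-1)) ∏|w_i|², where m = l near Y and m = 0,
with exponent read as 0, away from Y. The radical should be generated by ∏|w_i|², which requires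
that function to generate a radical ideal among smooth functions. The tool is a division theorem: a
smooth function is divisible by a complex coordinate w if and only if its formal Taylor series in
the conjugate of w vanishes at every point of {w = 0} (`exists_eq_coord_mul`, `zDvdAt_iff`). The
series is multiplicative and ℂ⟦X⟧ is a domain, so powers and suitable factors can be removed
(`ZDvdAt.of_pow`, `ZDvdAt.of_mul`). The same tool shows that vector fields preserving the elliptic
ideal are logarithmic (`zDvdAt_of_logarithmic`).

The elliptic tangent bundle therefore has local frames made of the fields z_i ∂/∂z_i (real and
imaginary parts) and of the remaining coordinate fields. As d log z_i = d log w_α + d log w_i, the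
blow-down map relates such frames by a constant invertible matrix (`fderiv_blowMap_logVec`,
`blowCoeffEquiv`). The anchor is injective on a dense set, so relations between sections can be
checked there and extended by continuity (`IsFrameAt.sum_eq_zero`). This makes the fibre maps well
defined and bijective, and yields the bracket identity. Finally, any blow-up is diffeomorphic over M
to the constructed one. -/

section Hadamard

/-! ### Integrals with smooth parameters and Hadamard's lemma. -/

variable {H : Type} [NormedAddCommGroup H] [NormedSpace ℝ H] [FiniteDimensional ℝ H]
  {G : Type} [NormedAddCommGroup G] [NormedSpace ℝ G]

theorem hasFDerivAt_parametric_integral {F : H × ℝ → G} (hF : ContDiff ℝ ∞ F) (v : H) :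
    HasFDerivAt (fun v => ∫ s in (0 : ℝ)..1, F (v, s))
      (∫ s in (0 : ℝ)..1, (fderiv ℝ F (v, s)).comp (ContinuousLinearMap.inl ℝ H ℝ)) v := by
  have hcF : Continuous F := hF.continuous
  have hF' : Continuous fun q : H × ℝ => (fderiv ℝ F q).comp (ContinuousLinearMap.inl ℝ H ℝ) :=
    (hF.continuous_fderiv (by simp)).clm_comp continuous_const
  -- Compactness of the unit ball around v times [0, 1] gives the constant that dominates the
  -- derivative.
  obtain ⟨C, hC⟩ := ((isCompact_closedBall v 1).prod
    (isCompact_Icc (a := (0 : ℝ)) (b := 1))).exists_bound_of_continuousOn hF'.continuousOn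
  refine intervalIntegral.hasFDerivAt_integral_of_dominated_of_fderiv_le
    (F' := fun v s => (fderiv ℝ F (v, s)).comp (ContinuousLinearMap.inl ℝ H ℝ))
    (bound := fun _ => C) (Metric.closedBall_mem_nhds v one_pos) ?_ ?_ ?_ ?_ ?_ ?_
  · exact Filter.Eventually.of_forall fun x =>
      (hcF.comp (Continuous.prodMk_right x)).aestronglyMeasurable
  · exact (hcF.comp (Continuous.prodMk_right v)).intervalIntegrable _ _
  · exact (hF'.comp (Continuous.prodMk_right v)).aestronglyMeasurable
  · refine Filter.Eventually.of_forall fun t ht x hx => hC (x, t) ⟨hx, ?_⟩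
    rw [Set.uIoc_of_le zero_le_one] at ht
    exact ⟨ht.1.le, ht.2⟩
  · exact intervalIntegrable_const
  · refine Filter.Eventually.of_forall fun t _ x _ => ?_
    exact ((hF.differentiable (by simp)) (x, t)).hasFDerivAt.comp x (hasFDerivAt_prodMk_left x t)

/-- The derivative is again a parametric integral, with values in a space of linear maps; hence the
induction on the order of differentiability is over all targets at once. -/
theorem contDiff_parametric_integral {F : H × ℝ → G} (hF : ContDiff ℝ ∞ F) :
    ContDiff ℝ ∞ (fun v => ∫ s in (0 : ℝ)..1, F (v, s)) := by
  rw [contDiff_infty]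
  intro m
  induction m generalizing G with
  | zero =>
    exact contDiff_zero.2 (continuous_iff_continuousAt.2 fun v =>
      (hasFDerivAt_parametric_integral hF v).continuousAt)
  | succ m ih =>
    rw [Nat.cast_add, Nat.cast_one, contDiff_succ_iff_fderiv]
    refine ⟨fun v => (hasFDerivAt_parametric_integral hF v).differentiableAt,
      fun h => by simp at h, ?_⟩
    rw [show fderiv ℝ (fun v => ∫ s in (0 : ℝ)..1, F (v, s)) = _ from
      funext fun v => (hasFDerivAt_parametric_integral hF v).fderiv]
    exact ih ((hF.fderiv_right (by simp)).clm_comp contDiff_const)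

/-- Hadamard's lemma along a linear projection. -/
theorem exists_hadamard [CompleteSpace G] {f : H → G} (hf : ContDiff ℝ ∞ f) (L : H →L[ℝ] H) :
    ∃ Φ : H → H →L[ℝ] G, ContDiff ℝ ∞ Φ ∧ (∀ v, f v = f (v - L v) + Φ v (L v)) ∧
      ∀ v, L v = 0 → Φ v = fderiv ℝ f v := by
  have hsm : ContDiff ℝ ∞ fun q : H × ℝ => q.1 - (1 - q.2) • L q.1 :=
    contDiff_fst.sub ((contDiff_const.sub contDiff_snd).smul (L.contDiff.comp contDiff_fst))
  have hD : ContDiff ℝ ∞ fun q : H × ℝ => fderiv ℝ f (q.1 - (1 - q.2) • L q.1) :=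
    (hf.fderiv_right (m := ∞) (by simp)).comp hsm
  -- Φ v is the mean of the derivative of f over the segment from v - L v to v.
  refine ⟨_, contDiff_parametric_integral hD, fun v => ?_, fun v hv => ?_⟩
  swap
  · simp only [hv, smul_zero, sub_zero]
    rw [intervalIntegral.integral_const, sub_zero, one_smul]
  have hc : Continuous fun s : ℝ => fderiv ℝ f (v - (1 - s) • L v) :=
    hD.continuous.comp (Continuous.prodMk_right v)
  have hint := intervalIntegral.integral_eq_sub_of_hasDerivAt
    (f := fun s : ℝ => f (v - (1 - s) • L v))
    (f' := fun s : ℝ => fderiv ℝ f (v - (1 - s) • L v) (L v)) (a := 0) (b := 1) (fun s _ => ?_)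
    ((hc.clm_apply continuous_const).intervalIntegrable _ _)
  · have := ContinuousLinearMap.intervalIntegral_apply (hc.intervalIntegrable
      (μ := MeasureTheory.volume) 0 1) (L v)
    simp only [this, hint]
    simp
  · have h1 : HasDerivAt (fun s : ℝ => v - (1 - s) • L v) (L v) s := by
      have := ((((hasDerivAt_id s).const_sub 1).smul_const (L v)).const_sub v)
      simpa using this
    exact ((hf.differentiable (by simp)) _).hasFDerivAt.comp_hasDerivAt s h1

end Hadamard

/-! ### Formal Taylor series in a conjugate variable. -/

section Dbar

variable {H : Type} [NormedAddCommGroup H] [NormedSpace ℝ H]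

/-- The operator `∂/∂w̄ = (∂/∂x + √-1 ∂/∂y) / 2` for the coordinate directions `a, b`. -/
noncomputable def dbar (a b : H) (f : H → ℂ) (v : H) : ℂ :=
  (1 / 2) * (fderiv ℝ f v a + Complex.I * fderiv ℝ f v b)

theorem ContDiff.dbar {a b : H} {f : H → ℂ} (hf : ContDiff ℝ ∞ f) : ContDiff ℝ ∞ (dbar a b f) :=
  contDiff_const.mul ((((hf.fderiv_right (m := ∞) (by simp)).clm_apply contDiff_const)).add
    (contDiff_const.mul ((hf.fderiv_right (m := ∞) (by simp)).clm_apply contDiff_const)))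

theorem ContDiff.dbar_iterate {a b : H} {f : H → ℂ} (hf : ContDiff ℝ ∞ f) (k : ℕ) :
    ContDiff ℝ ∞ ((_root_.dbar a b)^[k] f) := by
  induction k generalizing f with
  | zero => exact hf
  | succ k ih => exact ih hf.dbar

theorem dbar_add {a b : H} {f g : H → ℂ} (hf : ContDiff ℝ ∞ f) (hg : ContDiff ℝ ∞ g) :
    dbar a b (f + g) = dbar a b f + dbar a b g := by
  funext v
  simp only [dbar, Pi.add_apply]
  rw [fderiv_add (hf.differentiable (by simp) v) (hg.differentiable (by simp) v)]
  simp only [add_apply]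
  ring

theorem dbar_mul {a b : H} {f g : H → ℂ} (hf : ContDiff ℝ ∞ f) (hg : ContDiff ℝ ∞ g) :
    dbar a b (f * g) = f * dbar a b g + g * dbar a b f := by
  funext v
  simp only [dbar, Pi.add_apply, Pi.mul_apply]
  rw [fderiv_mul (hf.differentiable (by simp) v) (hg.differentiable (by simp) v)]
  simp only [add_apply, smul_apply, smul_eq_mul]
  ring

theorem dbar_eventuallyEq {a b : H} {f g : H → ℂ} {q : H} (h : f =ᶠ[𝓝 q] g) :
    dbar a b f =ᶠ[𝓝 q] dbar a b g := by
  filter_upwards [h.eventuallyEq_nhds] with y hy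
  simp only [dbar, hy.fderiv_eq]

/-- The formal Taylor series of `f` at `q` in the variable `w̄`. -/
noncomputable def dbarSeries (a b q : H) (f : H → ℂ) : PowerSeries ℂ :=
  PowerSeries.mk fun k => ((dbar a b)^[k] f q) / (k.factorial : ℂ)

theorem dbarSeries_eventuallyEq {a b : H} {f g : H → ℂ} {q : H} (h : f =ᶠ[𝓝 q] g) :
    dbarSeries a b q f = dbarSeries a b q g := by
  ext k
  simp only [dbarSeries, PowerSeries.coeff_mk]
  congr 1
  suffices (dbar a b)^[k] f =ᶠ[𝓝 q] (dbar a b)^[k] g from this.eq_of_nhds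
  induction k generalizing f g with
  | zero => exact h
  | succ k ih => exact ih (dbar_eventuallyEq h)

theorem dbarSeries_eq_zero_iff {a b q : H} {f : H → ℂ} :
    dbarSeries a b q f = 0 ↔ ∀ k, (dbar a b)^[k] f q = 0 := by
  simp [PowerSeries.ext_iff, dbarSeries, Nat.factorial_ne_zero]

theorem dbarSeries_add {a b q : H} {f g : H → ℂ} (hf : ContDiff ℝ ∞ f) (hg : ContDiff ℝ ∞ g) :
    dbarSeries a b q (f + g) = dbarSeries a b q f + dbarSeries a b q g := by
  ext k
  simp only [dbarSeries, PowerSeries.coeff_mk, map_add]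
  rw [← add_div]
  congr 1
  induction k generalizing f g with
  | zero => rfl
  | succ k ih => simp only [Function.iterate_succ, Function.comp, dbar_add hf hg, ih hf.dbar hg.dbar]

theorem derivative_dbarSeries (a b q : H) (f : H → ℂ) :
    PowerSeries.derivative ℂ (dbarSeries a b q f) = dbarSeries a b q (dbar a b f) := by
  ext k
  simp only [PowerSeries.coeff_derivative]
  simp only [dbarSeries, PowerSeries.coeff_mk, Function.iterate_succ, Function.comp,
    Nat.factorial_succ]
  have h1 : (k.factorial : ℂ) ≠ 0 := by exact_mod_cast k.factorial_ne_zero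
  have h2 : ((k : ℂ) + 1) ≠ 0 := by exact_mod_cast k.succ_ne_zero
  push_cast
  field_simp

/-- Since ∂/∂w̄ is a derivation corresponding to the formal derivative of the series, each
coefficient of the product follows from the preceding one for the derivatives. Multiplicativity
transfers the absence of zero divisors and nilpotents in ℂ⟦X⟧ to questions of divisibility. -/
theorem dbarSeries_mul {a b q : H} {f g : H → ℂ} (hf : ContDiff ℝ ∞ f) (hg : ContDiff ℝ ∞ g) :
    dbarSeries a b q (f * g) = dbarSeries a b q f * dbarSeries a b q g := by
  ext k
  induction k generalizing f g with
  | zero =>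
    simp [dbarSeries]
  | succ k ih =>
    have h2 : ((k : ℂ) + 1) ≠ 0 := by exact_mod_cast k.succ_ne_zero
    refine mul_right_cancel₀ h2 ?_
    rw [← PowerSeries.coeff_derivative, ← PowerSeries.coeff_derivative, derivative_dbarSeries,
      dbar_mul hf hg, dbarSeries_add (f := f * dbar a b g) (g := g * dbar a b f) (hf.mul hg.dbar) (hg.mul hf.dbar), map_add,
      ih hf hg.dbar, ih hg hf.dbar, ← map_add, Derivation.leibniz, derivative_dbarSeries,
      derivative_dbarSeries, smul_eq_mul, smul_eq_mul]

theorem dbarSeries_const (a b q : H) (c : ℂ) :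
    dbarSeries a b q (fun _ => c) = PowerSeries.C c := by
  have h0 : dbar a b (fun _ => c) = fun _ => 0 := by funext v; simp [dbar]
  have h1 : ∀ k, (dbar a b)^[k] (fun _ => (0 : ℂ)) = fun _ => 0 := by
    intro k
    induction k with
    | zero => rfl
    | succ k ih =>
      rw [Function.iterate_succ, Function.comp,
        show dbar a b (fun _ => (0 : ℂ)) = fun _ => 0 by funext v; simp [dbar], ih]
  ext k
  rw [PowerSeries.coeff_C]
  cases k with
  | zero => simp [dbarSeries]
  | succ k => simp [dbarSeries, h0, h1]

theorem dbarSeries_pow {a b q : H} {f : H → ℂ} (hf : ContDiff ℝ ∞ f) (N : ℕ) :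
    dbarSeries a b q (f ^ N) = dbarSeries a b q f ^ N := by
  induction N with
  | zero => exact (dbarSeries_const a b q 1).trans (by simp)
  | succ N ih => rw [pow_succ, pow_succ, dbarSeries_mul (f := f ^ N) (hf.pow N) hf, ih]

/-- The `w̄`-series of an affine function. -/
theorem dbarSeries_clm (a b q : H) (l : H →L[ℝ] ℂ) :
    dbarSeries a b q l = PowerSeries.C (l q) +
      PowerSeries.C ((1 / 2) * (l a + Complex.I * l b)) * PowerSeries.X := by
  have h0 : dbar a b l = fun _ => (1 / 2) * (l a + Complex.I * l b) := by
    funext v; simp [dbar]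
  ext k
  cases k with
  | zero => simp [dbarSeries]
  | succ k =>
    have := congrArg (PowerSeries.coeff k) (derivative_dbarSeries a b q l)
    rw [h0, dbarSeries_const, PowerSeries.coeff_derivative] at this
    have h2 : ((k : ℂ) + 1) ≠ 0 := by exact_mod_cast k.succ_ne_zero
    refine mul_right_cancel₀ h2 (this.trans ?_)
    rw [PowerSeries.coeff_C, map_add, PowerSeries.coeff_C, PowerSeries.coeff_succ_mul_X,
      PowerSeries.coeff_C]
    split_ifs with h <;> simp_all

end Dbar


/-! ### Division of smooth functions by a complex coordinate. -/

section Division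

open ComplexConjugate

/-- Both terms of the derivative have the same shape as the function, with N - k lowered by one,
which permits induction on the order of differentiability. -/
theorem hasFDerivAt_conj_pow_div_pow {N k : ℕ} (h : k + 2 ≤ N) (z : ℂ) :
    HasFDerivAt (fun z : ℂ => conj z ^ N / z ^ k)
      ((N * (conj z ^ (N - 1) / z ^ k)) • (Complex.conjCLE : ℂ →L[ℝ] ℂ)
        - (k * (conj z ^ N / z ^ (k + 1))) • ContinuousLinearMap.id ℝ ℂ) z := by
  rcases eq_or_ne z 0 with rfl | hz
  · have h1 : N - 1 ≠ 0 := by omega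
    have h2 : N ≠ 0 := by omega
    -- At the origin the quotient has absolute value |z|^(N-k) with N - k ≥ 2, so its derivative
    -- there is zero.
    have : (fun z : ℂ => conj z ^ N / z ^ k) =O[𝓝 0] fun z => ‖z - 0‖ ^ 2 := by
      refine Asymptotics.IsBigO.of_bound 1 ?_
      filter_upwards [Metric.ball_mem_nhds (0 : ℂ) one_pos] with z hz
      rcases eq_or_ne z 0 with rfl | hz0
      · simp [h2]
      have hz1 : ‖z‖ ≤ 1 := by simpa using (Metric.mem_ball.1 hz).le
      obtain ⟨j, rfl⟩ := Nat.exists_eq_add_of_le h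
      simp only [norm_div, norm_pow, RCLike.norm_conj, sub_zero, one_mul, norm_norm]
      rw [add_assoc, pow_add, mul_div_cancel_left₀ _ (pow_ne_zero _ (norm_ne_zero_iff.2 hz0)),
        pow_add]
      exact mul_le_of_le_one_right (by positivity) (pow_le_one₀ (norm_nonneg z) hz1)
    have := Asymptotics.IsBigO.hasFDerivAt (𝕜 := ℝ) this (by norm_num)
    refine this.congr_fderiv (ContinuousLinearMap.ext fun v => ?_)
    simp [h1, h2]
  · have hc : HasFDerivAt (fun z : ℂ => conj z) (Complex.conjCLE : ℂ →L[ℝ] ℂ) z :=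
      Complex.conjCLE.hasFDerivAt
    have h1 := hc.pow N
    have h3 := ((hasDerivAt_pow k z).inv (pow_ne_zero k hz)).hasFDerivAt.restrictScalars ℝ
    have h4 := h1.mul h3
    simp only [div_eq_mul_inv]
    refine h4.congr_fderiv (ContinuousLinearMap.ext fun v => ?_)
    simp only [sub_apply, smul_apply, add_apply, smul_eq_mul, nsmul_eq_mul,
      ContinuousLinearMap.coe_id', id, ContinuousLinearMap.coe_restrictScalars',
      ContinuousLinearMap.toSpanSingleton_apply, Pi.inv_apply]
    cases k with
    | zero => simp
    | succ k =>
      simp only [Nat.add_sub_cancel]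
      field_simp
      ring

theorem contDiff_conj_pow_div_pow {N k m : ℕ} (h : k + m + 1 ≤ N) :
    ContDiff ℝ m (fun z : ℂ => conj z ^ N / z ^ k) := by
  induction m generalizing N k with
  | zero =>
    refine contDiff_zero.2 (continuous_iff_continuousAt.2 fun z => ?_)
    rcases eq_or_ne z 0 with rfl | hz
    · have h0 : N ≠ 0 := by omega
      rw [ContinuousAt, map_zero, zero_pow h0, zero_div]
      refine squeeze_zero_norm' ?_ (tendsto_norm_zero (E := ℂ))
      filter_upwards [Metric.ball_mem_nhds (0 : ℂ) one_pos] with z hz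
      rcases eq_or_ne z 0 with rfl | hz0
      · simp [h0]
      have hz1 : ‖z‖ ≤ 1 := by simpa using (Metric.mem_ball.1 hz).le
      obtain ⟨j, rfl⟩ := Nat.exists_eq_add_of_le h
      simp only [norm_div, norm_pow, RCLike.norm_conj]
      rw [add_zero, add_assoc, pow_add, mul_div_cancel_left₀ _ (pow_ne_zero _ (norm_ne_zero_iff.2 hz0)),
        pow_add, pow_one]
      exact mul_le_of_le_one_right (by positivity) (pow_le_one₀ (norm_nonneg z) hz1)
    · exact ((continuous_star.pow N).continuousAt).div (continuous_pow k).continuousAt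
        (pow_ne_zero k hz)
  | succ m ih =>
    have hd := fun z => hasFDerivAt_conj_pow_div_pow (N := N) (k := k) (by omega) z
    rw [Nat.cast_add, Nat.cast_one, contDiff_succ_iff_fderiv]
    refine ⟨fun z => (hd z).differentiableAt, fun h => by simp at h, ?_⟩
    rw [funext fun z => (hd z).fderiv]
    exact ((contDiff_const.mul (ih (by omega))).smul contDiff_const).sub
      ((contDiff_const.mul (ih (by omega))).smul contDiff_const)

variable {H : Type} [NormedAddCommGroup H] [NormedSpace ℝ H]
  {w : H →L[ℝ] ℂ} {a b : H}

theorem ContinuousLinearMap.contDiff_conj (w : H →L[ℝ] ℂ) : ContDiff ℝ ∞ fun v => conj (w v) :=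
  Complex.conjCLE.contDiff.comp w.contDiff

/-- Hadamard's lemma for the projection onto the plane of a and b, along {w = 0}: the leading term
vanishes, and the linear form Re(w) Φ(a) + Im(w) Φ(b) is rewritten in terms of w and its conjugate.
-/
theorem exists_eq_mul_add_conj_mul [FiniteDimensional ℝ H] (ha : w a = 1) (hb : w b = Complex.I) {f : H → ℂ}
    (hf : ContDiff ℝ ∞ f) (h0 : ∀ v, w v = 0 → f v = 0) :
    ∃ α β : H → ℂ, ContDiff ℝ ∞ α ∧ ContDiff ℝ ∞ β ∧
      ∀ v, f v = w v * α v + conj (w v) * β v := by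
  obtain ⟨Φ, hΦ, hΦ', -⟩ := exists_hadamard hf
    ((Complex.reCLM.comp w).smulRight a + (Complex.imCLM.comp w).smulRight b)
  refine ⟨fun v => (1 / 2) * (Φ v a - Complex.I * Φ v b),
    fun v => (1 / 2) * (Φ v a + Complex.I * Φ v b), ?_, ?_, fun v => ?_⟩
  · exact contDiff_const.mul ((hΦ.clm_apply contDiff_const).sub
      (contDiff_const.mul (hΦ.clm_apply contDiff_const)))
  · exact contDiff_const.mul ((hΦ.clm_apply contDiff_const).add
      (contDiff_const.mul (hΦ.clm_apply contDiff_const)))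
  · rw [hΦ' v, h0]
    · simp only [add_apply, ContinuousLinearMap.smulRight_apply, ContinuousLinearMap.comp_apply,
        Complex.reCLM_apply, Complex.imCLM_apply, map_add, map_smul, Complex.real_smul]
      rw [Complex.re_eq_add_conj, Complex.im_eq_sub_conj]
      field_simp
      ring_nf
      simp
      ring
    · simp only [add_apply, ContinuousLinearMap.smulRight_apply, ContinuousLinearMap.comp_apply,
        Complex.reCLM_apply, Complex.imCLM_apply, map_add, map_smul, Complex.real_smul, map_sub,
        ha, hb]
      rw [mul_one, Complex.re_add_im, sub_self]

theorem dbarSeries_coord (ha : w a = 1) (hb : w b = Complex.I) {q : H} (hq : w q = 0) :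
    dbarSeries a b q w = 0 := by
  rw [dbarSeries_clm, ha, hb, hq]
  simp

theorem dbarSeries_conj_coord (ha : w a = 1) (hb : w b = Complex.I) {q : H} (hq : w q = 0) :
    dbarSeries a b q (fun v => conj (w v)) = PowerSeries.X := by
  have := dbarSeries_clm a b q ((Complex.conjCLE : ℂ →L[ℝ] ℂ).comp w)
  simp only [ContinuousLinearMap.comp_apply, ha, hb, hq] at this
  refine Eq.trans this ?_
  have h2 : (1 / 2 : ℂ) * (1 + 1) = 1 := by norm_num
  simp [-one_div]
  rw [← map_one (PowerSeries.C (R := ℂ)), ← map_add, ← map_mul, h2]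

/-- One conjugate factor is split off at a time. Along {w = 0} the series of w is 0 and that of its
conjugate is X, so the series of the old remainder is X times that of the new one, which therefore
vanishes too. -/
theorem exists_eq_mul_add_conj_pow_mul [FiniteDimensional ℝ H] (ha : w a = 1) (hb : w b = Complex.I) {f : H → ℂ}
    (hf : ContDiff ℝ ∞ f) (h0 : ∀ v, w v = 0 → dbarSeries a b v f = 0) (N : ℕ) :
    ∃ α β : H → ℂ, ContDiff ℝ ∞ α ∧ ContDiff ℝ ∞ β ∧
      (∀ v, w v = 0 → dbarSeries a b v β = 0) ∧
      ∀ v, f v = w v * α v + conj (w v) ^ N * β v := by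
  induction N with
  | zero => exact ⟨fun _ => 0, f, contDiff_const, hf, h0, fun v => by simp⟩
  | succ N ih =>
    obtain ⟨α, β, hα, hβ, hβ0, h⟩ := ih
    obtain ⟨α', β', hα', hβ', h'⟩ := exists_eq_mul_add_conj_mul ha hb hβ
      fun v hv => dbarSeries_eq_zero_iff.1 (hβ0 v hv) 0
    refine ⟨fun v => α v + conj (w v) ^ N * α' v, β', hα.add ((w.contDiff_conj.pow N).mul hα'),
      hβ', fun v hv => ?_, fun v => ?_⟩
    · have h1 := hβ0 v hv
      rw [show β = (w : H → ℂ) * α' + (fun v => conj (w v)) * β' from funext h',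
        dbarSeries_add (f := (w : H → ℂ) * α') (g := (fun v => conj (w v)) * β') (w.contDiff.mul hα')
          (w.contDiff_conj.mul hβ'), dbarSeries_mul w.contDiff hα',
        dbarSeries_mul w.contDiff_conj hβ', dbarSeries_coord ha hb hv,
        dbarSeries_conj_coord ha hb hv, zero_mul, zero_add] at h1
      exact (mul_eq_zero.1 h1).resolve_left PowerSeries.X_ne_zero
    · rw [h, h']
      ring

/-- A smooth function with vanishing `w̄`-series along `{w = 0}` is divisible by `w`. -/
theorem exists_eq_coord_mul [FiniteDimensional ℝ H] (ha : w a = 1) (hb : w b = Complex.I) {f : H → ℂ}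
    (hf : ContDiff ℝ ∞ f) (h0 : ∀ v, w v = 0 → dbarSeries a b v f = 0) :
    ∃ g : H → ℂ, ContDiff ℝ ∞ g ∧ ∀ v, f v = w v * g v := by
  obtain ⟨α, β, hα, hβ, hβ0, h⟩ := exists_eq_mul_add_conj_pow_mul ha hb hf h0 1
  refine ⟨fun v => α v + conj (w v) / w v * β v, hα.add ?_, fun v => ?_⟩
  · rw [contDiff_infty]
    intro m
    -- The quotient is fixed by the splitting of order 1; its C^m regularity is seen by splitting
    -- the remainder to order m + 1, which leaves the singular factor conj(w)^(m+2)/w. Where w = 0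
    -- both expressions are 0 by the convention for division.
    obtain ⟨α', β', hα', hβ', -, h'⟩ := exists_eq_mul_add_conj_pow_mul ha hb hβ hβ0 (m + 1)
    have : (fun v => conj (w v) / w v * β v) =
        fun v => conj (w v) * α' v + conj (w v) ^ (m + 2) / w v ^ 1 * β' v := by
      funext v
      rw [h']
      rcases eq_or_ne (w v) 0 with hv | hv
      · simp [hv]
      · field_simp
        ring
    rw [this]
    exact ((w.contDiff_conj.mul hα').of_le (by exact_mod_cast le_top)).add
      (((contDiff_conj_pow_div_pow (by omega)).comp w.contDiff).mul
        (hβ'.of_le (by exact_mod_cast le_top)))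
  · rw [h]
    rcases eq_or_ne (w v) 0 with hv | hv
    · simp [hv]
    · field_simp

end Division


/-! ### Global smooth functions and cut-offs. -/

namespace SmoothFn

variable {n : ℕ} {M : Type*} [TopologicalSpace M] [ChartedSpace (EuclideanSpace ℝ (Fin n)) M]
  {𝕂 : Type*} [NormedField 𝕂] [NormedAlgebra ℝ 𝕂]

theorem contMDiff (f : SmoothFn n M 𝕂) : ContMDiff (𝓡 n) 𝓘(ℝ, 𝕂) ∞ f := f.2

theorem continuous (f : SmoothFn n M 𝕂) : Continuous f := f.contMDiff.continuous

@[ext]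
theorem ext {f g : SmoothFn n M 𝕂} (h : ∀ x, f x = g x) : f = g := DFunLike.ext f g h

/-- A smooth function as an element of `SmoothFn`. -/
def of (f : M → 𝕂) (hf : ContMDiff (𝓡 n) 𝓘(ℝ, 𝕂) ∞ f) : SmoothFn n M 𝕂 := ⟨f, hf⟩

@[simp] theorem coe_of (f : M → 𝕂) (hf : ContMDiff (𝓡 n) 𝓘(ℝ, 𝕂) ∞ f) : ⇑(of f hf) = f := rfl

@[simp] theorem add_apply (f g : SmoothFn n M 𝕂) (x : M) : (f + g) x = f x + g x := rfl

@[simp] theorem mul_apply (f g : SmoothFn n M 𝕂) (x : M) : (f * g) x = f x * g x := rfl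

@[simp] theorem sub_apply (f g : SmoothFn n M 𝕂) (x : M) : (f - g) x = f x - g x := rfl

@[simp] theorem neg_apply (f : SmoothFn n M 𝕂) (x : M) : (-f) x = -f x := rfl

@[simp] theorem zero_apply (x : M) : (0 : SmoothFn n M 𝕂) x = 0 := rfl

@[simp] theorem one_apply (x : M) : (1 : SmoothFn n M 𝕂) x = 1 := rfl

@[simp] theorem smul_apply (c : ℝ) (f : SmoothFn n M 𝕂) (x : M) : (c • f) x = c • f x := rfl

@[simp] theorem algebraMap_apply (c : ℝ) (x : M) : algebraMap ℝ (SmoothFn n M ℝ) c x = c := rfl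

/-- Evaluation at a point. -/
def evalHom (x : M) : SmoothFn n M 𝕂 →+* 𝕂 where
  toFun f := f x
  map_one' := rfl
  map_zero' := rfl
  map_add' _ _ := rfl
  map_mul' _ _ := rfl

@[simp] theorem pow_apply (f : SmoothFn n M 𝕂) (N : ℕ) (x : M) : (f ^ N) x = f x ^ N :=
  map_pow (evalHom x) f N

@[simp] theorem sum_apply {ι : Type*} (s : Finset ι) (f : ι → SmoothFn n M 𝕂) (x : M) :
    (∑ i ∈ s, f i) x = ∑ i ∈ s, f i x :=
  map_sum (evalHom x) f s

@[simp] theorem comp_apply {d : ℕ} {N : Type*} [TopologicalSpace N]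
    [ChartedSpace (EuclideanSpace ℝ (Fin d)) N] (f : SmoothFn n M 𝕂) (p : C^∞⟮𝓡 d, N; 𝓡 n, M⟯)
    (x : N) : f.comp p x = f (p x) := rfl

theorem exists_bump [IsManifold (𝓡 n) ∞ M] [T2Space M] {x : M} {U : Set M} (hU : U ∈ 𝓝 x) :
    ∃ χ : SmoothFn n M ℝ, χ =ᶠ[𝓝 x] 1 ∧ tsupport χ ⊆ U := by
  obtain ⟨f, -, hf⟩ := (SmoothBumpFunction.nhds_basis_tsupport (I := 𝓡 n) x).mem_iff.1 hU
  exact ⟨⟨f, f.contMDiff⟩, f.eventuallyEq_one, hf⟩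

theorem exists_smul_eq {χ : SmoothFn n M ℝ} {U : Set M} (hU : IsOpen U) (hχ : tsupport χ ⊆ U)
    {g : M → 𝕂} (hg : ContMDiffOn (𝓡 n) 𝓘(ℝ, 𝕂) ∞ g U) :
    ∃ F : SmoothFn n M 𝕂, ∀ y, F y = χ y • g y := by
  refine ⟨⟨fun y => χ y • g y, contMDiff_of_tsupport fun y hy => ?_⟩, fun _ => rfl⟩
  exact (χ.contMDiff y).smul
    (hg.contMDiffAt (hU.mem_nhds (hχ (tsupport_smul_subset_left _ _ hy))))

/-- Every locally defined smooth germ has a global representative, so stalks can be computed with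
coefficients in `SmoothFn`. -/
theorem exists_eventuallyEq [IsManifold (𝓡 n) ∞ M] [T2Space M] {x : M} {U : Set M} (hU : IsOpen U) (hx : x ∈ U)
    {g : M → 𝕂} (hg : ContMDiffOn (𝓡 n) 𝓘(ℝ, 𝕂) ∞ g U) :
    ∃ F : SmoothFn n M 𝕂, F =ᶠ[𝓝 x] g := by
  obtain ⟨χ, h1, h2⟩ := exists_bump (n := n) (hU.mem_nhds hx)
  obtain ⟨F, hF⟩ := exists_smul_eq hU h2 hg
  refine ⟨F, ?_⟩
  filter_upwards [h1] with y hy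
  rw [hF, hy, Pi.one_apply, one_smul]

end SmoothFn

/-! ### Stalks of ideals, local generators and pullbacks. -/

section Germs

variable {n : ℕ} {M : Type*} [TopologicalSpace M] [ChartedSpace (EuclideanSpace ℝ (Fin n)) M]
  {𝕂 : Type*} [NormedField 𝕂] [NormedAlgebra ℝ 𝕂]

theorem germMem_congr {I : Ideal (SmoothFn n M 𝕂)} {x : M} {g g' : M → 𝕂} (h : g =ᶠ[𝓝 x] g') :
    GermMem I x g ↔ GermMem I x g' :=
  ⟨fun ⟨f, hf, hf'⟩ => ⟨f, hf, h.symm.trans hf'⟩, fun ⟨f, hf, hf'⟩ => ⟨f, hf, h.trans hf'⟩⟩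

theorem germMem_coe {I : Ideal (SmoothFn n M 𝕂)} {x : M} {f : SmoothFn n M 𝕂} (hf : f ∈ I) :
    GermMem I x f :=
  ⟨f, hf, .rfl⟩

theorem GeneratedOn.mono {r : ℕ} {I : Ideal (SmoothFn n M 𝕂)} {U V : Set M} {s : Fin r → M → 𝕂}
    (h : GeneratedOn I U s) (hV : V ⊆ U) : GeneratedOn I V s := fun x hx => h x (hV hx)

theorem GeneratedOn.congr {r : ℕ} {I : Ideal (SmoothFn n M 𝕂)} {U : Set M} {s s' : Fin r → M → 𝕂}
    (h : GeneratedOn I U s) (hU : IsOpen U) (hs : ∀ x ∈ U, ∀ i, s i x = s' i x) :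
    GeneratedOn I U s' := by
  intro x hx g
  rw [h x hx g]
  refine exists_congr fun c => ?_
  have : (fun y => ∑ i, c i y * s i y) =ᶠ[𝓝 x] fun y => ∑ i, c i y * s' i y := by
    filter_upwards [hU.mem_nhds hx] with y hy
    exact Finset.sum_congr rfl fun i _ => by rw [hs y hy i]
  exact ⟨fun h => h.trans this, fun h => h.trans this.symm⟩

/-- A local generator is the germ of a member of the ideal. -/
theorem GeneratedOn.germMem {r : ℕ} {I : Ideal (SmoothFn n M 𝕂)} {U : Set M} {s : Fin r → M → 𝕂}
    (h : GeneratedOn I U s) {x : M} (hx : x ∈ U) (i : Fin r) : GermMem I x (s i) := by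
  classical
  refine (h x hx _).2 ⟨fun j => if j = i then 1 else 0, .of_forall fun y => ?_⟩
  beta_reduce
  rw [Finset.sum_eq_single i]
  · simp
  · intro j _ hj
    simp [hj]
  · simp

theorem GeneratedOn.germMem_iff {I : Ideal (SmoothFn n M 𝕂)} {U : Set M} {s : M → 𝕂}
    (h : GeneratedOn I U (fun _ : Fin 1 => s)) {x : M} (hx : x ∈ U) (g : M → 𝕂) :
    GermMem I x g ↔ ∃ c : SmoothFn n M 𝕂, g =ᶠ[𝓝 x] fun y => c y * s y := by
  rw [h x hx g]
  simp only [Fin.sum_univ_one]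
  exact ⟨fun ⟨c, hc⟩ => ⟨c 0, hc⟩, fun ⟨c, hc⟩ => ⟨fun _ => c, hc⟩⟩

theorem generatedOn_one_iff {I : Ideal (SmoothFn n M 𝕂)} {U : Set M} {s : M → 𝕂} :
    GeneratedOn I U (fun _ : Fin 1 => s) ↔ ∀ x ∈ U, ∀ g, GermMem I x g ↔
      ∃ c : SmoothFn n M 𝕂, g =ᶠ[𝓝 x] fun y => c y * s y := by
  refine ⟨fun h x hx g => h.germMem_iff hx g, fun h x hx g => ?_⟩
  rw [h x hx g]
  simp only [Fin.sum_univ_one]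
  exact ⟨fun ⟨c, hc⟩ => ⟨fun _ => c, hc⟩, fun ⟨c, hc⟩ => ⟨c 0, hc⟩⟩

theorem le_localize (I : Ideal (SmoothFn n M 𝕂)) : I ≤ localize I := fun _ hf _ => germMem_coe hf

theorem germMem_localize {I : Ideal (SmoothFn n M 𝕂)} {x : M} {g : M → 𝕂} :
    GermMem (localize I) x g ↔ GermMem I x g := by
  refine ⟨fun ⟨f, hf, hg⟩ => (germMem_congr hg).2 (hf x),
    fun ⟨f, hf, hg⟩ => ⟨f, le_localize I hf, hg⟩⟩

theorem isLocalIdeal_localize (I : Ideal (SmoothFn n M 𝕂)) : IsLocalIdeal (localize I) :=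
  fun _ hf x => germMem_localize.1 (hf x)

variable {d : ℕ} {N : Type*} [TopologicalSpace N] [ChartedSpace (EuclideanSpace ℝ (Fin d)) N]

theorem comp_mem_pullbackIdeal {p : C^∞⟮𝓡 d, N; 𝓡 n, M⟯} {I : Ideal (SmoothFn n M 𝕂)}
    {f : SmoothFn n M 𝕂} (hf : f ∈ I) : f.comp p ∈ pullbackIdeal p I :=
  le_localize _ (Ideal.subset_span ⟨f, hf, rfl⟩)

/-- Germs of the pullback ideal are induced from properties stable under sums and multiples. -/
theorem germMem_pullbackIdeal_induction {p : C^∞⟮𝓡 d, N; 𝓡 n, M⟯} {I : Ideal (SmoothFn n M 𝕂)}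
    {x : N} {P : (N → 𝕂) → Prop} (hcongr : ∀ g g', g =ᶠ[𝓝 x] g' → P g → P g')
    (hcomp : ∀ f ∈ I, P (f ∘ p)) (hzero : P 0) (hadd : ∀ g g', P g → P g' → P (g + g'))
    (hmul : ∀ (c : SmoothFn d N 𝕂) g, P g → P (c * g)) {g : N → 𝕂}
    (hg : GermMem (pullbackIdeal p I) x g) : P g := by
  obtain ⟨f, hf, hgf⟩ := germMem_localize.1 hg
  refine hcongr _ _ hgf.symm ?_
  refine Submodule.span_induction (p := fun (f : SmoothFn d N 𝕂) _ => P f) ?_ hzero (fun a b _ _ ha hb => hadd a b ha hb)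
    (fun c a _ ha => hmul c a ha) hf
  rintro _ ⟨f, hf, rfl⟩
  exact hcomp f hf

theorem GeneratedOn.pullback {p : C^∞⟮𝓡 d, N; 𝓡 n, M⟯} {I : Ideal (SmoothFn n M 𝕂)} {U : Set M}
    {r : ℕ} {s : Fin r → M → 𝕂} (h : GeneratedOn I U s) :
    GeneratedOn (pullbackIdeal p I) (p ⁻¹' U) fun i => s i ∘ p := by
  intro x hx g
  constructor
  · refine germMem_pullbackIdeal_induction (p := p) (I := I) (P := fun g : N → 𝕂 =>
      ∃ c : Fin r → SmoothFn d N 𝕂, g =ᶠ[𝓝 x] fun y => ∑ i, c i y * (s i ∘ p) y) ?_ ?_ ?_ ?_ ?_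
    · rintro g g' hg ⟨c, hc⟩
      exact ⟨c, hg.symm.trans hc⟩
    · intro f hf
      obtain ⟨c, hc⟩ := (h _ hx f).1 (germMem_coe hf)
      exact ⟨fun i => (c i).comp p, p.contMDiff.continuous.continuousAt.eventually hc⟩
    · exact ⟨0, .of_forall fun y => by simp⟩
    · rintro g g' ⟨c, hc⟩ ⟨c', hc'⟩
      refine ⟨c + c', ?_⟩
      filter_upwards [hc, hc'] with y hy hy'
      simp only [Pi.add_apply, hy, hy', SmoothFn.add_apply, add_mul, Finset.sum_add_distrib]
    · rintro a g ⟨c, hc⟩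
      refine ⟨fun i => a * c i, ?_⟩
      filter_upwards [hc] with y hy
      simp only [Pi.mul_apply, hy, SmoothFn.mul_apply, Finset.mul_sum, mul_assoc]
  · rintro ⟨c, hc⟩
    choose t ht hst using fun i => h.germMem hx i
    refine ⟨∑ i, c i * (t i).comp p, Ideal.sum_mem _ fun i _ =>
      Ideal.mul_mem_left _ _ (comp_mem_pullbackIdeal (ht i)), ?_⟩
    have : ∀ᶠ y in 𝓝 x, ∀ i, s i (p y) = t i (p y) :=
      Filter.eventually_all.2 fun i => p.contMDiff.continuous.continuousAt.eventually (hst i)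
    filter_upwards [hc, this] with y hy hy'
    simp [hy, hy']

end Germs


/-! ### Divisibility by complex coordinates and by the elliptic model. -/

section Coordinates

open ComplexConjugate

/-- `ℝⁿ` with its Euclidean norm. -/
abbrev Euc (n : ℕ) : Type := EuclideanSpace ℝ (Fin n)

variable {n : ℕ}

/-- The complex coordinate as a continuous linear map. -/
noncomputable def zCLM (n i : ℕ) : Euc n →L[ℝ] ℂ :=
  if h : 2 * i + 1 < n then
    Complex.ofRealCLM.comp (EuclideanSpace.proj ⟨2 * i, by omega⟩) +
      (EuclideanSpace.proj ⟨2 * i + 1, h⟩ : Euc n →L[ℝ] ℝ).smulRight Complex.I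
  else 0

theorem coe_zCLM (i : ℕ) : ⇑(zCLM n i) = zCoord i := by
  funext v
  unfold zCLM zCoord
  split_ifs with h
  · apply Complex.ext <;> simp
  · rfl

/-- The inclusion of the `i`-th complex coordinate axis. -/
noncomputable def zIncl (n i : ℕ) : ℂ →L[ℝ] Euc n :=
  if h : 2 * i + 1 < n then
    Complex.reCLM.smulRight (EuclideanSpace.single ⟨2 * i, by omega⟩ (1 : ℝ)) +
      Complex.imCLM.smulRight (EuclideanSpace.single ⟨2 * i + 1, h⟩ (1 : ℝ))
  else 0

theorem zCoord_zIncl {i : ℕ} (hi : 2 * i + 1 < n) (c : ℂ) : zCoord i (zIncl n i c) = c := by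
  unfold zIncl zCoord
  rw [dif_pos hi, dif_pos hi]
  apply Complex.ext <;> simp

theorem zCoord_zIncl_of_ne {i j : ℕ} (hij : i ≠ j) (c : ℂ) : zCoord j (zIncl n i c) = 0 := by
  unfold zIncl zCoord
  split_ifs with h1 h2
  · apply Complex.ext <;>
    simp only [add_apply, ContinuousLinearMap.smulRight_apply, Complex.reCLM_apply,
      Complex.imCLM_apply, PiLp.add_apply, PiLp.smul_apply, PiLp.single_apply,
      Fin.mk.injEq, Complex.zero_re, Complex.zero_im, smul_eq_mul, mul_ite, mul_one, mul_zero] <;>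
    rw [if_neg (by omega), if_neg (by omega), add_zero]
  · apply Complex.ext <;> simp
  · rfl

theorem zIncl_apply_of_ne {i : ℕ} {j : Fin n} (h1 : (j : ℕ) ≠ 2 * i) (h2 : (j : ℕ) ≠ 2 * i + 1)
    (c : ℂ) : zIncl n i c j = 0 := by
  unfold zIncl
  split_ifs with h
  · simp [Fin.ext_iff, h1, h2]
  · rfl

theorem zCoord_add (i : ℕ) (v v' : Euc n) : zCoord i (v + v') = zCoord i v + zCoord i v' := by
  simp only [← coe_zCLM, map_add]

theorem zCoord_sub (i : ℕ) (v v' : Euc n) : zCoord i (v - v') = zCoord i v - zCoord i v' := by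
  simp only [← coe_zCLM, map_sub]

theorem contDiff_zCoord (i : ℕ) : ContDiff ℝ ∞ (zCoord i : Euc n → ℂ) := by
  rw [← coe_zCLM]; exact (zCLM n i).contDiff

theorem contDiff_normSq : ContDiff ℝ ∞ Complex.normSq := by
  have : (Complex.normSq : ℂ → ℝ) = fun z => z.re * z.re + z.im * z.im := rfl
  rw [this]
  exact (Complex.reCLM.contDiff.mul Complex.reCLM.contDiff).add
    (Complex.imCLM.contDiff.mul Complex.imCLM.contDiff)

theorem contDiff_ellipticModel (k : ℕ) : ContDiff ℝ ∞ (ellipticModel k : Euc n → ℝ) :=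
  contDiff_prod fun i _ => contDiff_normSq.comp (contDiff_zCoord i)

theorem ellipticModel_ne_zero_iff {k : ℕ} {v : Euc n} :
    ellipticModel k v ≠ 0 ↔ ∀ i < k, zCoord i v ≠ 0 := by
  simp [ellipticModel, Finset.prod_eq_zero_iff]

/-- Points may be moved off the zero sets of finitely many complex coordinates, keeping the other
complex coordinates fixed. -/
theorem mem_closure_zCoord_ne_zero (S : Finset ℕ) (hS : ∀ j ∈ S, 2 * j + 1 < n) (q : Euc n) :
    q ∈ closure {v : Euc n | (∀ j ∉ S, zCoord j v = zCoord j q) ∧ ∀ j ∈ S, zCoord j v ≠ 0} := by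
  classical
  have hz : ∀ (ε : ℝ) (j : ℕ), zCoord j (q + ε • ∑ i ∈ S, zIncl n i 1) =
      zCoord j q + if j ∈ S then (ε : ℂ) else 0 := by
    intro ε j
    rw [zCoord_add, ← coe_zCLM, map_smul, map_sum, coe_zCLM]
    congr 1
    split_ifs with hj
    · rw [Finset.sum_eq_single_of_mem j hj fun i _ hi => zCoord_zIncl_of_ne hi 1,
        zCoord_zIncl (hS j hj)]
      simp
    · rw [Finset.sum_eq_zero fun i hi => zCoord_zIncl_of_ne (by rintro rfl; exact hj hi) 1, smul_zero]
  have hc : Filter.Tendsto (fun ε : ℝ => q + ε • ∑ i ∈ S, zIncl n i 1) (𝓝[≠] 0) (𝓝 q) := by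
    have : Continuous fun ε : ℝ => q + ε • ∑ i ∈ S, zIncl n i 1 := by fun_prop
    simpa using (this.tendsto 0).mono_left nhdsWithin_le_nhds
  refine mem_closure_of_tendsto hc ?_
  have h1 : ∀ᶠ ε : ℝ in 𝓝[≠] 0, ∀ j ∈ S, (ε : ℂ) ≠ -zCoord j q := by
    refine (Filter.eventually_all_finset S).2 fun j _ => ?_
    rcases eq_or_ne (zCoord j q) 0 with h | h
    · filter_upwards [self_mem_nhdsWithin] with ε hε
      simpa [h] using hε
    · have : ContinuousAt (fun ε : ℝ => (ε : ℂ)) 0 := Complex.continuous_ofReal.continuousAt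
      exact (this.eventually_ne (by simpa using (neg_ne_zero.2 h).symm)).filter_mono
        nhdsWithin_le_nhds
  filter_upwards [h1] with ε hε
  refine ⟨fun j hj => by rw [hz, if_neg hj, add_zero], fun j hj h => hε j hj ?_⟩
  rw [hz, if_pos hj] at h
  exact eq_neg_of_add_eq_zero_right h

theorem dense_ellipticModel_ne_zero {k : ℕ} (hk : 2 * k ≤ n) :
    Dense {v : Euc n | ellipticModel k v ≠ 0} := by
  intro q
  refine closure_mono ?_ (mem_closure_zCoord_ne_zero (Finset.range k) (fun j hj => ?_) q)
  · rintro v ⟨-, hv⟩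
    exact ellipticModel_ne_zero_iff.2 fun i hi => hv i (Finset.mem_range.2 hi)
  · have := Finset.mem_range.1 hj
    omega

/-- The germ of `f` at `q` is divisible by the `i`-th complex coordinate. -/
def ZDvdAt (i : ℕ) (q : Euc n) (f : Euc n → ℂ) : Prop :=
  ∃ g : Euc n → ℂ, ContDiff ℝ ∞ g ∧ f =ᶠ[𝓝 q] fun v => zCoord i v * g v

/-- The Taylor series in the conjugate of the `i`-th complex coordinate. -/
noncomputable abbrev zSeries (i : ℕ) (q : Euc n) (f : Euc n → ℂ) : PowerSeries ℂ :=
  dbarSeries (zIncl n i 1) (zIncl n i Complex.I) q f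

theorem zSeries_mul {i : ℕ} {q : Euc n} {f g : Euc n → ℂ} (hf : ContDiff ℝ ∞ f)
    (hg : ContDiff ℝ ∞ g) : zSeries i q (fun v => f v * g v) = zSeries i q f * zSeries i q g :=
  dbarSeries_mul hf hg

theorem zSeries_zCoord {i : ℕ} (hi : 2 * i + 1 < n) {q : Euc n} (hq : zCoord i q = 0) :
    zSeries i q (zCoord i) = 0 := by
  rw [zSeries, ← coe_zCLM]
  exact dbarSeries_coord (by rw [coe_zCLM, zCoord_zIncl hi]) (by rw [coe_zCLM, zCoord_zIncl hi])
    (by rw [coe_zCLM, hq])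

theorem zSeries_conj_zCoord {i : ℕ} (hi : 2 * i + 1 < n) {q : Euc n} (hq : zCoord i q = 0) :
    zSeries i q (fun v => conj (zCoord i v)) = PowerSeries.X := by
  rw [zSeries, ← coe_zCLM]
  exact dbarSeries_conj_coord (by rw [coe_zCLM, zCoord_zIncl hi])
    (by rw [coe_zCLM, zCoord_zIncl hi]) (by rw [coe_zCLM, hq])

theorem zSeries_ne_zero_of_apply_ne_zero {i : ℕ} {q : Euc n} {f : Euc n → ℂ} (h : f q ≠ 0) :
    zSeries i q f ≠ 0 := fun h0 => h (dbarSeries_eq_zero_iff.1 h0 0)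

/-- The division theorem is made local by a bump function supported where the series condition
holds: by multiplicativity of the series, the cut-off function has zero series along all of {z_i =
0}. -/
theorem zDvdAt_iff {i : ℕ} (hi : 2 * i + 1 < n) {q : Euc n} {f : Euc n → ℂ}
    (hf : ContDiff ℝ ∞ f) :
    ZDvdAt i q f ↔ ∀ᶠ v in 𝓝 q, zCoord i v = 0 → zSeries i v f = 0 := by
  constructor
  · rintro ⟨g, hg, h⟩
    filter_upwards [h.eventuallyEq_nhds] with v hv h0
    rw [zSeries, dbarSeries_eventuallyEq hv]
    exact (zSeries_mul (contDiff_zCoord i) hg).trans (by rw [zSeries_zCoord hi h0, zero_mul])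
  · intro h
    obtain ⟨χ, h1, h2⟩ := SmoothFn.exists_bump (n := n) (M := Euc n) h
    have hχ : ContDiff ℝ ∞ fun v : Euc n => ((χ v : ℝ) : ℂ) :=
      Complex.ofRealCLM.contDiff.comp χ.contMDiff.contDiff
    have h0 : ∀ v : Euc n, zCLM n i v = 0 → zSeries i v (fun v => ((χ v : ℝ) : ℂ) * f v) = 0 := by
      intro v hv
      by_cases hv' : v ∈ tsupport χ
      · refine (zSeries_mul hχ hf).trans ?_
        rw [h2 hv' (by rw [← coe_zCLM, hv]), mul_zero]
      · have h0 := notMem_tsupport_iff_eventuallyEq.1 hv'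
        have : (fun v => (χ v : ℂ) * f v) =ᶠ[𝓝 v] fun _ => 0 := by
          filter_upwards [h0] with y hy
          rw [hy]
          simp
        rw [zSeries, dbarSeries_eventuallyEq this, dbarSeries_const, map_zero]
    obtain ⟨g, hg, hfg⟩ := exists_eq_coord_mul (w := zCLM n i) (by rw [coe_zCLM, zCoord_zIncl hi])
      (by rw [coe_zCLM, zCoord_zIncl hi]) (hχ.mul hf) h0
    refine ⟨g, hg, ?_⟩
    filter_upwards [h1] with v hv
    rw [← coe_zCLM, ← hfg, hv]
    simp

theorem ZDvdAt.congr {i : ℕ} {q : Euc n} {f g : Euc n → ℂ} (h : ZDvdAt i q f) (hfg : f =ᶠ[𝓝 q] g) :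
    ZDvdAt i q g := by
  obtain ⟨c, hc, h⟩ := h
  exact ⟨c, hc, hfg.symm.trans h⟩

theorem zDvdAt_zCoord_mul (i : ℕ) (q : Euc n) {f : Euc n → ℂ} (hf : ContDiff ℝ ∞ f) :
    ZDvdAt i q fun v => zCoord i v * f v := ⟨f, hf, .rfl⟩

theorem ZDvdAt.sub {i : ℕ} {q : Euc n} {f g : Euc n → ℂ} (hf : ZDvdAt i q f) (hg : ZDvdAt i q g) :
    ZDvdAt i q fun v => f v - g v := by
  obtain ⟨c, hc, hf⟩ := hf
  obtain ⟨c', hc', hg⟩ := hg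
  refine ⟨fun v => c v - c' v, hc.sub hc', ?_⟩
  filter_upwards [hf, hg] with v h1 h2
  rw [h1, h2]
  ring

theorem ZDvdAt.sum {ι : Type*} {s : Finset ι} {i : ℕ} {q : Euc n} {f : ι → Euc n → ℂ}
    (hf : ∀ j ∈ s, ZDvdAt i q (f j)) : ZDvdAt i q fun v => ∑ j ∈ s, f j v := by
  classical
  induction s using Finset.induction_on with
  | empty => exact ⟨fun _ => 0, contDiff_const, .of_forall fun v => by simp⟩
  | insert a s ha ih =>
    obtain ⟨c, hc, h1⟩ := hf a (Finset.mem_insert_self a s)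
    obtain ⟨c', hc', h2⟩ := ih fun j hj => hf j (Finset.mem_insert_of_mem hj)
    refine ⟨fun v => c v + c' v, hc.add hc', ?_⟩
    filter_upwards [h1, h2] with v h1 h2
    rw [Finset.sum_insert ha, h1, h2]
    ring

/-- Cancellation of a factor which is not divisible by the coordinate. -/
theorem ZDvdAt.of_mul {i : ℕ} (hi : 2 * i + 1 < n) {q : Euc n} {f g : Euc n → ℂ}
    (hf : ContDiff ℝ ∞ f) (hg : ContDiff ℝ ∞ g) (h : ZDvdAt i q fun v => f v * g v)
    (hd : ∀ v : Euc n, zCoord i v = 0 →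
      v ∈ closure {v | zCoord i v = 0 ∧ zSeries i v g ≠ 0}) : ZDvdAt i q f := by
  rw [zDvdAt_iff hi (hf.mul hg)] at h
  rw [zDvdAt_iff hi hf]
  filter_upwards [h.eventually_nhds] with v hv hv0
  refine dbarSeries_eq_zero_iff.2 fun k => ?_
  have hcl : IsClosed {v | (dbar (zIncl n i 1) (zIncl n i Complex.I))^[k] f v = 0} :=
    isClosed_eq (hf.dbar_iterate k).continuous continuous_const
  -- Where the series of g is nonzero, that of f must vanish because ℂ⟦X⟧ is a domain. Such points
  -- are dense in {z_i = 0}, and the zero set of each iterated derivative of f is closed.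
  refine (closure_minimal (s := {v | zCoord i v = 0 ∧ zSeries i v g ≠ 0} ∩
    {v | zCoord i v = 0 → zSeries i v (fun v => f v * g v) = 0}) ?_ hcl) ?_
  · rintro y ⟨⟨hy0, hyg⟩, hy⟩
    exact dbarSeries_eq_zero_iff.1
      ((mul_eq_zero.1 ((zSeries_mul hf hg).symm.trans (hy hy0))).resolve_right hyg) k
  · rw [mem_closure_iff_nhds]
    intro t ht
    obtain ⟨y, hy, hy'⟩ := mem_closure_iff_nhds.1 (hd v hv0) _ (Filter.inter_mem ht hv)
    exact ⟨y, hy.1, hy', hy.2⟩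

theorem ZDvdAt.of_pow {i : ℕ} (hi : 2 * i + 1 < n) {q : Euc n} {f : Euc n → ℂ}
    (hf : ContDiff ℝ ∞ f) {N : ℕ} (h : ZDvdAt i q fun v => f v ^ N) : ZDvdAt i q f := by
  rw [zDvdAt_iff hi (hf.pow N)] at h
  rw [zDvdAt_iff hi hf]
  filter_upwards [h] with v hv hv0
  exact eq_zero_of_pow_eq_zero ((dbarSeries_pow hf N).symm.trans (hv hv0))

/-- The product of all but one of the factors of the elliptic model. -/
theorem ellipticModel_eq_mul_erase {k i : ℕ} (hi : i < k) (v : Euc n) :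
    ((ellipticModel k v : ℝ) : ℂ) = zCoord i v * (conj (zCoord i v) *
      ((∏ j ∈ (Finset.range k).erase i, Complex.normSq (zCoord j v) : ℝ) : ℂ)) := by
  rw [ellipticModel, ← Finset.mul_prod_erase _ _ (Finset.mem_range.2 hi), Complex.ofReal_mul,
    ← mul_assoc, Complex.mul_conj]

theorem contDiff_ofReal {f : Euc n → ℝ} (hf : ContDiff ℝ ∞ f) :
    ContDiff ℝ ∞ fun v => (f v : ℂ) := Complex.ofRealCLM.contDiff.comp hf

theorem contDiff_conj_comp {f : Euc n → ℂ} (hf : ContDiff ℝ ∞ f) :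
    ContDiff ℝ ∞ fun v => conj (f v) := Complex.conjCLE.contDiff.comp hf

theorem contDiff_erase (S : Finset ℕ) :
    ContDiff ℝ ∞ fun v : Euc n => ∏ j ∈ S, Complex.normSq (zCoord j v) :=
  contDiff_prod fun j _ => contDiff_normSq.comp (contDiff_zCoord j)

theorem zDvdAt_mul_ellipticModel {k i : ℕ} (hi : i < k) (q : Euc n) {f : Euc n → ℂ}
    (hf : ContDiff ℝ ∞ f) : ZDvdAt i q fun v => f v * (ellipticModel k v : ℝ) := by
  refine ⟨fun v => f v * (conj (zCoord i v) *
    ((∏ j ∈ (Finset.range k).erase i, Complex.normSq (zCoord j v) : ℝ) : ℂ)),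
    hf.mul ((contDiff_conj_comp (contDiff_zCoord i)).mul (contDiff_ofReal (contDiff_erase _))),
    .of_forall fun v => ?_⟩
  beta_reduce
  rw [ellipticModel_eq_mul_erase hi]
  ring

/-- A real function divisible by the first `k` complex coordinates is divisible by the elliptic
model. -/
theorem exists_eq_mul_ellipticModel {k : ℕ} (hk : 2 * k ≤ n) {q : Euc n} {f : Euc n → ℝ}
    (hf : ContDiff ℝ ∞ f) (h : ∀ i < k, ZDvdAt i q fun v => (f v : ℂ)) :
    ∃ g : Euc n → ℝ, ContDiff ℝ ∞ g ∧ f =ᶠ[𝓝 q] fun v => g v * ellipticModel k v := by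
  induction k with
  | zero => exact ⟨f, hf, .of_forall fun v => by simp [ellipticModel]⟩
  | succ k ih =>
    obtain ⟨g, hg, hfg⟩ := ih (by omega) fun i hi => h i (by omega)
    have hk' : 2 * k + 1 < n := by omega
    -- The product of the earlier factors is nonzero on a dense part of {z_k = 0}, so it can be
    -- cancelled.
    have h1 : ZDvdAt k q fun v => (g v : ℂ) := by
      refine ZDvdAt.of_mul hk' (contDiff_ofReal hg) (contDiff_ofReal (contDiff_ellipticModel k))
        ((h k (by omega)).congr ?_) fun v hv => ?_
      · filter_upwards [hfg] with v hv
        rw [hv, Complex.ofReal_mul]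
      · refine closure_mono ?_ (mem_closure_zCoord_ne_zero (Finset.range k)
          (fun j hj => by have := Finset.mem_range.1 hj; omega) v)
        rintro y ⟨hy1, hy2⟩
        refine ⟨by rw [hy1 k (by simp), hv], zSeries_ne_zero_of_apply_ne_zero ?_⟩
        exact_mod_cast ellipticModel_ne_zero_iff.2 fun i hi => hy2 i (Finset.mem_range.2 hi)
    obtain ⟨c, hc, hgc⟩ := h1
    -- As g = z_k c is real, conj(c) conj(z_k) = z_k c. The series of conj(z_k) is X ≠ 0, so
    -- conj(z_k) cancels and z_k divides conj(c); together these give the factor |z_k|².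
    have h2 : ZDvdAt k q fun v => conj (c v) := by
      refine ZDvdAt.of_mul hk' (contDiff_conj_comp hc) (contDiff_conj_comp (contDiff_zCoord k))
        ((zDvdAt_zCoord_mul k q hc).congr ?_) fun v hv => subset_closure ⟨hv, ?_⟩
      · filter_upwards [hgc] with v hv
        rw [← map_mul, mul_comm (c v), ← hv, Complex.conj_ofReal]
      · rw [zSeries_conj_zCoord hk' hv]
        exact PowerSeries.X_ne_zero
    obtain ⟨e, he, hce⟩ := h2
    refine ⟨fun v => (e v).re, Complex.reCLM.contDiff.comp he, ?_⟩
    filter_upwards [hfg, hgc, hce] with v h1 h2 h3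
    have h4 : (g v : ℂ) = (Complex.normSq (zCoord k v) : ℂ) * conj (e v) := by
      rw [h2, ← Complex.conj_conj (c v), h3, map_mul, ← Complex.mul_conj]
      ring
    have h5 : g v = Complex.normSq (zCoord k v) * (e v).re := by
      simpa using congrArg Complex.re h4
    rw [h1, h5]
    simp only [ellipticModel, Finset.prod_range_succ]
    ring

/-- The ideal generated by the elliptic model is radical. -/
theorem exists_eq_mul_ellipticModel_of_pow {k : ℕ} (hk : 2 * k ≤ n) {q : Euc n} {f g : Euc n → ℝ}
    (hf : ContDiff ℝ ∞ f) (hg : ContDiff ℝ ∞ g) {N : ℕ}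
    (h : (fun v => f v ^ N) =ᶠ[𝓝 q] fun v => g v * ellipticModel k v) :
    ∃ g : Euc n → ℝ, ContDiff ℝ ∞ g ∧ f =ᶠ[𝓝 q] fun v => g v * ellipticModel k v := by
  refine exists_eq_mul_ellipticModel hk hf fun i hi => ?_
  refine ZDvdAt.of_pow (N := N) (by omega) (contDiff_ofReal hf) ?_
  refine (zDvdAt_mul_ellipticModel hi q (contDiff_ofReal hg)).congr ?_
  filter_upwards [h] with v hv
  rw [← Complex.ofReal_pow, hv, Complex.ofReal_mul]

/-- Vector fields preserving the elliptic model are logarithmic. -/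
theorem zDvdAt_of_logarithmic {k : ℕ} (hk : 2 * k ≤ n) {q : Euc n} {α : ℕ → Euc n → ℂ}
    (hα : ∀ i, ContDiff ℝ ∞ (α i)) {g : Euc n → ℝ} (hg : ContDiff ℝ ∞ g)
    (h : (fun v => ∑ i ∈ Finset.range k, (∏ j ∈ (Finset.range k).erase i,
        Complex.normSq (zCoord j v)) * (2 * (conj (zCoord i v) * α i v).re)) =ᶠ[𝓝 q]
      fun v => g v * ellipticModel k v) {i : ℕ} (hi : i < k) : ZDvdAt i q (α i) := by
  have hi' : 2 * i + 1 < n := by omega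
  set P : ℕ → Euc n → ℝ := fun i v => ∏ j ∈ (Finset.range k).erase i,
        Complex.normSq (zCoord j v) with hP
  have hPs : ∀ i, ContDiff ℝ ∞ (P i) := fun i => contDiff_erase _
  have hcz : ContDiff ℝ ∞ fun v : Euc n => conj (zCoord i v) :=
    contDiff_conj_comp (contDiff_zCoord i)
  refine ZDvdAt.of_mul hi' (hα i) (g := fun v => (P i v : ℂ) * conj (zCoord i v))
    ((contDiff_ofReal (hPs i)).mul hcz) ?_ fun v hv => ?_
  · have h1 := zDvdAt_mul_ellipticModel hi q (contDiff_ofReal hg)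
    -- The summands with j ≠ i still contain |z_i|². In the i-th one, 2 Re(conj(z_i) α_i) =
    -- conj(z_i) α_i + z_i conj(α_i) and the second term is divisible, so only P_i conj(z_i) α_i is
    -- left over.
    have h2 : ZDvdAt i q fun v => ∑ j ∈ (Finset.range k).erase i,
        (P j v : ℂ) * ((2 * (conj (zCoord j v) * α j v).re : ℝ) : ℂ) := by
      refine ZDvdAt.sum fun j hj => ?_
      have hji : i ∈ (Finset.range k).erase j :=
        Finset.mem_erase.2 ⟨(Finset.mem_erase.1 hj).1.symm, Finset.mem_range.2 hi⟩
      refine ⟨fun v => conj (zCoord i v) * ((∏ m ∈ ((Finset.range k).erase j).erase i,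
        Complex.normSq (zCoord m v) : ℝ) : ℂ) * ((2 * (conj (zCoord j v) * α j v).re : ℝ) : ℂ),
        (hcz.mul (contDiff_ofReal (contDiff_erase _))).mul (contDiff_ofReal (contDiff_const.mul
          (Complex.reCLM.contDiff.comp ((contDiff_conj_comp (contDiff_zCoord j)).mul (hα j))))),
        .of_forall fun v => ?_⟩
      simp only [hP]
      rw [← Finset.mul_prod_erase _ _ hji, Complex.ofReal_mul, ← Complex.mul_conj]
      ring
    have h3 : ZDvdAt i q fun v => zCoord i v * ((P i v : ℂ) * conj (α i v)) :=
      zDvdAt_zCoord_mul i q ((contDiff_ofReal (hPs i)).mul (contDiff_conj_comp (hα i)))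
    refine ((h1.sub h2).sub h3).congr ?_
    filter_upwards [h] with v hv
    have hv' := congrArg (fun r : ℝ => (r : ℂ)) hv
    rw [← Finset.add_sum_erase _ _ (Finset.mem_range.2 hi)] at hv'
    simp only [Complex.ofReal_add, Complex.ofReal_sum, Complex.ofReal_mul] at hv'
    have h4 : (((2 : ℝ) : ℂ) * ((conj (zCoord i v) * α i v).re : ℂ)) =
        conj (zCoord i v) * α i v + zCoord i v * conj (α i v) := by
      rw [Complex.re_eq_add_conj]
      simp
      ring
    rw [h4] at hv'
    simp only [Complex.ofReal_mul]
    rw [← hv']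
    ring
  · refine closure_mono ?_ (mem_closure_zCoord_ne_zero ((Finset.range k).erase i)
      (fun j hj => by have := Finset.mem_range.1 (Finset.mem_of_mem_erase hj); omega) v)
    rintro y ⟨hy1, hy2⟩
    have hy0 : zCoord i y = 0 := by rw [hy1 i (by simp), hv]
    refine ⟨hy0, ?_⟩
    rw [zSeries_mul (contDiff_ofReal (hPs i)) hcz, zSeries_conj_zCoord hi' hy0]
    refine mul_ne_zero (zSeries_ne_zero_of_apply_ne_zero ?_) PowerSeries.X_ne_zero
    have : P i y ≠ 0 := Finset.prod_ne_zero_iff.2 fun j hj => by simpa using hy2 j hj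
    exact_mod_cast this

end Coordinates


/-! ### Logarithmic vectors and the blow-up map in coordinates. -/

section Model

open ComplexConjugate

variable {n : ℕ}

theorem euc_ext {k : ℕ} (hk : 2 * k ≤ n) {v v' : Euc n} (h1 : ∀ i < k, zCoord i v = zCoord i v')
    (h2 : ∀ j : Fin n, 2 * k ≤ (j : ℕ) → v j = v' j) : v = v' := by
  ext j
  by_cases hj : 2 * k ≤ (j : ℕ)
  · exact h2 j hj
  · have hj' := j.2
    obtain ⟨i, hi | hi⟩ : ∃ i, (j : ℕ) = 2 * i ∨ (j : ℕ) = 2 * i + 1 :=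
      ⟨j / 2, by omega⟩
    · have := congrArg Complex.re (h1 i (by omega))
      simp only [zCoord, dif_pos (show 2 * i + 1 < n by omega)] at this
      rwa [show j = ⟨2 * i, by omega⟩ from Fin.ext hi]
    · have := congrArg Complex.im (h1 i (by omega))
      simp only [zCoord, dif_pos (show 2 * i + 1 < n by omega)] at this
      rwa [show j = ⟨2 * i + 1, by omega⟩ from Fin.ext hi]

/-- Replace the complex coordinates `z_i`, `i ∈ S`, of `v` by `c i`. -/
noncomputable def replaceZ (S : Finset ℕ) (c : ℕ → ℂ) (v : Euc n) : Euc n :=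
  v + ∑ i ∈ S, zIncl n i (c i - zCoord i v)

theorem zCoord_replaceZ {S : Finset ℕ} (hS : ∀ i ∈ S, 2 * i + 1 < n) (c : ℕ → ℂ) (v : Euc n)
    (i : ℕ) : zCoord i (replaceZ S c v) = if i ∈ S then c i else zCoord i v := by
  rw [replaceZ, zCoord_add, ← coe_zCLM, map_sum, coe_zCLM]
  split_ifs with hi
  · rw [Finset.sum_eq_single_of_mem i hi fun j _ hj => zCoord_zIncl_of_ne hj _,
      zCoord_zIncl (hS i hi)]
    ring
  · rw [Finset.sum_eq_zero fun j hj => zCoord_zIncl_of_ne (by rintro rfl; exact hi hj) _, add_zero]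

theorem replaceZ_apply_of_le {S : Finset ℕ} {k : ℕ} (hS : ∀ i ∈ S, i < k) (c : ℕ → ℂ) (v : Euc n)
    {j : Fin n} (hj : 2 * k ≤ (j : ℕ)) : replaceZ S c v j = v j := by
  rw [replaceZ, PiLp.add_apply, WithLp.ofLp_sum, Finset.sum_apply, Finset.sum_eq_zero, add_zero]
  intro i hi
  have := hS i hi
  exact zIncl_apply_of_ne (by omega) (by omega) _

theorem contDiffOn_replaceZ {H : Type} [NormedAddCommGroup H] [NormedSpace ℝ H] {O : Set H}
    {S : Finset ℕ} {c : ℕ → H → ℂ} {v : H → Euc n} (hc : ∀ i ∈ S, ContDiffOn ℝ ∞ (c i) O)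
    (hv : ContDiffOn ℝ ∞ v O) : ContDiffOn ℝ ∞ (fun x => replaceZ S (fun i => c i x) (v x)) O :=
  hv.add (ContDiffOn.sum fun i hi => (zIncl n i).contDiff.comp_contDiffOn
    ((hc i hi).sub ((contDiff_zCoord i).comp_contDiffOn hv)))

theorem contDiff_replaceZ {H : Type} [NormedAddCommGroup H] [NormedSpace ℝ H]
    {S : Finset ℕ} {c : ℕ → H → ℂ} {v : H → Euc n} (hc : ∀ i ∈ S, ContDiff ℝ ∞ (c i))
    (hv : ContDiff ℝ ∞ v) : ContDiff ℝ ∞ (fun x => replaceZ S (fun i => c i x) (v x)) :=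
  contDiffOn_univ.1 (contDiffOn_replaceZ (fun i hi => (hc i hi).contDiffOn) hv.contDiffOn)

/-- The logarithmic vector at `v` with constant coefficients `c`: multiply the first `k` complex
coordinates of `c` by those of `v`. -/
noncomputable def logVec (k : ℕ) (v c : Euc n) : Euc n :=
  replaceZ (Finset.range k) (fun i => zCoord i v * zCoord i c) c

theorem zCoord_logVec {k : ℕ} (hk : 2 * k ≤ n) (v c : Euc n) (i : ℕ) :
    zCoord i (logVec k v c) = if i < k then zCoord i v * zCoord i c else zCoord i c := by
  rw [logVec, zCoord_replaceZ (fun i hi => by have := Finset.mem_range.1 hi; omega)]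
  simp only [Finset.mem_range]

theorem logVec_apply_of_le {k : ℕ} (v c : Euc n) {j : Fin n} (hj : 2 * k ≤ (j : ℕ)) :
    logVec k v c j = c j :=
  replaceZ_apply_of_le (fun _ => Finset.mem_range.1) _ _ hj

theorem contDiff_logVec (k : ℕ) {H : Type} [NormedAddCommGroup H] [NormedSpace ℝ H]
    {v c : H → Euc n} (hv : ContDiff ℝ ∞ v) (hc : ContDiff ℝ ∞ c) :
    ContDiff ℝ ∞ fun x => logVec k (v x) (c x) :=
  contDiff_replaceZ (fun i _ => ((contDiff_zCoord i).comp hv).mul ((contDiff_zCoord i).comp hc)) hc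

theorem logVec_add {k : ℕ} (hk : 2 * k ≤ n) (v c c' : Euc n) :
    logVec k v (c + c') = logVec k v c + logVec k v c' := by
  refine euc_ext hk (fun i hi => ?_) fun j hj => ?_
  · simp only [zCoord_add, zCoord_logVec hk, if_pos hi, mul_add]
  · simp only [PiLp.add_apply, logVec_apply_of_le _ _ hj]

theorem zCoord_smul (i : ℕ) (r : ℝ) (v : Euc n) : zCoord i (r • v) = r • zCoord i v := by
  simp only [← coe_zCLM, map_smul]

theorem logVec_smul {k : ℕ} (hk : 2 * k ≤ n) (v : Euc n) (r : ℝ) (c : Euc n) :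
    logVec k v (r • c) = r • logVec k v c := by
  refine euc_ext hk (fun i hi => ?_) fun j hj => ?_
  · simp only [zCoord_smul, zCoord_logVec hk, if_pos hi, mul_smul_comm]
  · simp only [PiLp.smul_apply, logVec_apply_of_le _ _ hj]

theorem logVec_sum {k : ℕ} (hk : 2 * k ≤ n) (v : Euc n) {ι : Type*} (s : Finset ι) (r : ι → ℝ)
    (c : ι → Euc n) : logVec k v (∑ i ∈ s, r i • c i) = ∑ i ∈ s, r i • logVec k v (c i) := by
  refine (map_sum (AddMonoidHom.mk' (logVec k v) (logVec_add hk v)) (fun i => r i • c i) s).trans ?_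
  exact Finset.sum_congr rfl fun i _ => logVec_smul hk v _ _

/-- Each of the first k complex coordinates is multiplied by a nonzero number. This is injectivity
of the anchor off the divisor. -/
theorem eq_zero_of_logVec_eq_zero {k : ℕ} (hk : 2 * k ≤ n) {v c : Euc n}
    (hv : ellipticModel k v ≠ 0) (h : logVec k v c = 0) : c = 0 := by
  refine euc_ext hk (fun i hi => ?_) fun j hj => ?_
  · have := congrArg (zCoord i) h
    rw [zCoord_logVec hk, if_pos hi] at this
    rw [← coe_zCLM, map_zero, coe_zCLM] at this ⊢
    exact (mul_eq_zero.1 this).resolve_left (ellipticModel_ne_zero_iff.1 hv i hi)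
  · rw [← logVec_apply_of_le v c hj, h]

theorem exists_eq_logVec {k : ℕ} (hk : 2 * k ≤ n) {v X : Euc n} {β : ℕ → ℂ}
    (h : ∀ i < k, zCoord i X = zCoord i v * β i) :
    X = logVec k v (replaceZ (Finset.range k) β X) := by
  refine euc_ext hk (fun i hi => ?_) fun j hj => ?_
  · rw [zCoord_logVec hk, if_pos hi,
      zCoord_replaceZ (fun i hi => by have := Finset.mem_range.1 hi; omega),
      if_pos (Finset.mem_range.2 hi), h i hi]
  · rw [logVec_apply_of_le _ _ hj, replaceZ_apply_of_le (fun _ => Finset.mem_range.1) _ _ hj]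

theorem hasFDerivAt_zCoord (i : ℕ) (v : Euc n) : HasFDerivAt (zCoord i) (zCLM n i) v := by
  rw [← coe_zCLM]
  exact (zCLM n i).hasFDerivAt

theorem fderiv_normSq_zCoord (i : ℕ) (v u : Euc n) :
    fderiv ℝ (fun v : Euc n => Complex.normSq (zCoord i v)) v u =
      2 * (conj (zCoord i v) * zCoord i u).re := by
  have h1 : HasFDerivAt (fun v : Euc n => (zCoord i v).re) (Complex.reCLM.comp (zCLM n i)) v :=
    Complex.reCLM.hasFDerivAt.comp v (hasFDerivAt_zCoord i v)
  have h2 : HasFDerivAt (fun v : Euc n => (zCoord i v).im) (Complex.imCLM.comp (zCLM n i)) v :=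
    Complex.imCLM.hasFDerivAt.comp v (hasFDerivAt_zCoord i v)
  have h3 := (h1.mul h1).add (h2.mul h2)
  have : (fun v : Euc n => Complex.normSq (zCoord i v)) =
      fun v => (zCoord i v).re * (zCoord i v).re + (zCoord i v).im * (zCoord i v).im := rfl
  rw [this]
  refine (congrArg (fun L : Euc n →L[ℝ] ℝ => L u) h3.fderiv).trans ?_
  simp [coe_zCLM]
  ring

theorem fderiv_ellipticModel (k : ℕ) (v u : Euc n) :
    fderiv ℝ (ellipticModel k) v u = ∑ i ∈ Finset.range k, (∏ j ∈ (Finset.range k).erase i,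
      Complex.normSq (zCoord j v)) * (2 * (conj (zCoord i v) * zCoord i u).re) := by
  have h := HasFDerivAt.finsetProd (u := Finset.range k)
    (g := fun i (v : Euc n) => Complex.normSq (zCoord i v)) (x := v) fun i _ =>
      (((contDiff_normSq.comp (contDiff_zCoord i)).differentiable (by simp)) v).hasFDerivAt
  refine (congrArg (fun L : Euc n →L[ℝ] ℝ => L u) h.fderiv).trans ?_
  simp only [sum_apply, smul_apply, smul_eq_mul]
  exact Finset.sum_congr rfl fun i _ => by rw [← fderiv_normSq_zCoord]; rfl

/-- Each factor |z_i|² is an eigenfunction with eigenvalue 2 Re(c_i). Consequently logarithmic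
fields preserve the elliptic ideal. -/
theorem fderiv_ellipticModel_logVec {k : ℕ} (hk : 2 * k ≤ n) (v c : Euc n) :
    fderiv ℝ (ellipticModel k) v (logVec k v c) =
      (∑ i ∈ Finset.range k, 2 * (zCoord i c).re) * ellipticModel k v := by
  rw [fderiv_ellipticModel, Finset.sum_mul]
  refine Finset.sum_congr rfl fun i hi => ?_
  rw [zCoord_logVec hk, if_pos (Finset.mem_range.1 hi), ellipticModel,
    ← Finset.mul_prod_erase _ _ hi, ← mul_assoc (conj _), mul_comm (conj _), Complex.mul_conj,
    Complex.re_ofReal_mul]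
  ring

/-- The blow-up map in the chart with index `α`: `z_i = w_α w_i` for `i < m`, `i ≠ α`, while the
other coordinates are unchanged. -/
noncomputable def blowMap (m α : ℕ) (v : Euc n) : Euc n :=
  replaceZ ((Finset.range m).erase α) (fun i => zCoord α v * zCoord i v) v

theorem mem_erase_lt {m α k : ℕ} (hm : m ≤ k) {i : ℕ} (hi : i ∈ (Finset.range m).erase α) :
    i < k := by
  have := Finset.mem_range.1 (Finset.mem_of_mem_erase hi)
  omega

theorem zCoord_blowMap {m α : ℕ} (hm : 2 * m ≤ n) (v : Euc n) (i : ℕ) :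
    zCoord i (blowMap m α v) = if i ≠ α ∧ i < m then zCoord α v * zCoord i v else zCoord i v := by
  rw [blowMap, zCoord_replaceZ fun i hi => by have := mem_erase_lt le_rfl hi; omega]
  simp only [Finset.mem_erase, Finset.mem_range]

theorem blowMap_apply_of_le {m α : ℕ} (v : Euc n) {j : Fin n} (hj : 2 * m ≤ (j : ℕ)) :
    blowMap m α v j = v j :=
  replaceZ_apply_of_le (fun _ hi => mem_erase_lt le_rfl hi) _ _ hj

theorem contDiff_blowMap (m α : ℕ) : ContDiff ℝ ∞ (blowMap m α : Euc n → Euc n) :=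
  contDiff_replaceZ (fun i _ => (contDiff_zCoord α).mul (contDiff_zCoord i)) contDiff_id

/-- Every index below m other than α contributes one additional |w_α|². For m = 0 the map is the
identity and truncated subtraction gives the exponent 0. -/
theorem ellipticModel_blowMap {m α k : ℕ} (hk : 2 * k ≤ n) (hm : m = 0 ∨ α < m) (hmk : m ≤ k)
    (v : Euc n) : ellipticModel k (blowMap m α v) =
      Complex.normSq (zCoord α v) ^ (m - 1) * ellipticModel k v := by
  simp only [ellipticModel, zCoord_blowMap (show 2 * m ≤ n by omega)]
  have h1 : ∀ i ∈ Finset.range k, Complex.normSq (if i ≠ α ∧ i < m then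
      zCoord α v * zCoord i v else zCoord i v) =
      (if i ∈ (Finset.range m).erase α then Complex.normSq (zCoord α v) else 1) *
        Complex.normSq (zCoord i v) := by
    intro i _
    simp only [Finset.mem_erase, Finset.mem_range]
    split_ifs <;> simp
  rw [Finset.prod_congr rfl h1, Finset.prod_mul_distrib, Finset.prod_ite_mem,
    Finset.inter_eq_right.2 fun i hi => Finset.mem_range.2 (mem_erase_lt hmk hi),
    Finset.prod_const]
  congr 2
  rcases hm with rfl | hm
  · simp
  · rw [Finset.card_erase_of_mem (Finset.mem_range.2 hm), Finset.card_range]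

/-- The effect of the blow-up map on coefficients of logarithmic vectors. -/
noncomputable def blowCoeff (m α : ℕ) (v : Euc n) : Euc n :=
  replaceZ ((Finset.range m).erase α) (fun i => zCoord α v + zCoord i v) v

theorem zCoord_blowCoeff {m α : ℕ} (hm : 2 * m ≤ n) (v : Euc n) (i : ℕ) :
    zCoord i (blowCoeff m α v) = if i ≠ α ∧ i < m then zCoord α v + zCoord i v else zCoord i v := by
  rw [blowCoeff, zCoord_replaceZ fun i hi => by have := mem_erase_lt le_rfl hi; omega]
  simp only [Finset.mem_erase, Finset.mem_range]

theorem blowCoeff_apply_of_le {m α : ℕ} (v : Euc n) {j : Fin n} (hj : 2 * m ≤ (j : ℕ)) :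
    blowCoeff m α v j = v j :=
  replaceZ_apply_of_le (fun _ hi => mem_erase_lt le_rfl hi) _ _ hj

/-- `blowCoeff` as a linear equivalence. -/
noncomputable def blowCoeffEquiv {m : ℕ} (α : ℕ) (hm : 2 * m ≤ n) : Euc n ≃ₗ[ℝ] Euc n where
  toFun := blowCoeff m α
  map_add' v v' := by
    refine euc_ext hm (fun i hi => ?_) fun j hj => ?_
    · simp only [zCoord_add, zCoord_blowCoeff hm]
      split_ifs <;> ring
    · simp only [PiLp.add_apply, blowCoeff_apply_of_le _ hj]
  map_smul' r v := by
    refine euc_ext hm (fun i hi => ?_) fun j hj => ?_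
    · simp only [zCoord_smul, zCoord_blowCoeff hm, RingHom.id_apply]
      split_ifs
      · rw [smul_add]
      · rfl
    · simp only [PiLp.smul_apply, blowCoeff_apply_of_le _ hj, RingHom.id_apply]
  invFun v := replaceZ ((Finset.range m).erase α) (fun i => zCoord i v - zCoord α v) v
  left_inv v := by
    have hS : ∀ i ∈ (Finset.range m).erase α, 2 * i + 1 < n := fun i hi => by
      have := mem_erase_lt le_rfl hi; omega
    refine euc_ext hm (fun i hi => ?_) fun j hj => ?_
    · simp only [zCoord_replaceZ hS, zCoord_blowCoeff hm, Finset.mem_erase, Finset.mem_range]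
      split_ifs with h1 h2
      · exact absurd rfl h2.1
      · ring
      · rfl
    · rw [replaceZ_apply_of_le (fun _ hi => mem_erase_lt le_rfl hi) _ _ hj,
        blowCoeff_apply_of_le _ hj]
  right_inv v := by
    have hS : ∀ i ∈ (Finset.range m).erase α, 2 * i + 1 < n := fun i hi => by
      have := mem_erase_lt le_rfl hi; omega
    refine euc_ext hm (fun i hi => ?_) fun j hj => ?_
    · simp only [zCoord_blowCoeff hm, zCoord_replaceZ hS, Finset.mem_erase, Finset.mem_range]
      split_ifs with h1 h2
      · exact absurd rfl h2.1
      · ring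
      · rfl
    · rw [blowCoeff_apply_of_le _ hj,
        replaceZ_apply_of_le (fun _ hi => mem_erase_lt le_rfl hi) _ _ hj]

theorem fderiv_zCoord_blowMap {m α : ℕ} (hm : 2 * m ≤ n) (v u : Euc n) (i : ℕ) :
    zCoord i (fderiv ℝ (blowMap m α) v u) = if i ≠ α ∧ i < m then
      zCoord α v * zCoord i u + zCoord i v * zCoord α u else zCoord i u := by
  have h1 : HasFDerivAt (fun v : Euc n => zCoord i (blowMap m α v))
      ((zCLM n i).comp (fderiv ℝ (blowMap m α) v)) v :=
    (hasFDerivAt_zCoord i _).comp v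
      (((contDiff_blowMap m α).differentiable (by simp)) v).hasFDerivAt
  have h2 : zCoord i (fderiv ℝ (blowMap m α) v u) =
      fderiv ℝ (fun v : Euc n => zCoord i (blowMap m α v)) v u := by
    rw [h1.fderiv, ContinuousLinearMap.comp_apply, coe_zCLM]
  rw [h2]
  simp only [zCoord_blowMap hm]
  split_ifs with h
  · have h3 := ((hasFDerivAt_zCoord α v).mul (hasFDerivAt_zCoord i v)).fderiv
    refine (congrArg (fun L : Euc n →L[ℝ] ℂ => L u) h3).trans ?_
    simp [coe_zCLM]
  · rw [(hasFDerivAt_zCoord i v).fderiv, coe_zCLM]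

theorem fderiv_blowMap_apply_of_le {m α : ℕ} (v u : Euc n) {j : Fin n} (hj : 2 * m ≤ (j : ℕ)) :
    fderiv ℝ (blowMap m α) v u j = u j := by
  have h1 : HasFDerivAt (fun v : Euc n => blowMap m α v j)
      ((EuclideanSpace.proj j : Euc n →L[ℝ] ℝ).comp (fderiv ℝ (blowMap m α) v)) v :=
    (EuclideanSpace.proj j : Euc n →L[ℝ] ℝ).hasFDerivAt.comp v
      (((contDiff_blowMap m α).differentiable (by simp)) v).hasFDerivAt
  have h2 : fderiv ℝ (blowMap m α) v u j = fderiv ℝ (fun v : Euc n => blowMap m α v j) v u := by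
    rw [h1.fderiv]
    rfl
  rw [h2]
  simp only [blowMap_apply_of_le _ hj]
  exact congrArg (fun L : Euc n →L[ℝ] ℝ => L u)
    (EuclideanSpace.proj j : Euc n →L[ℝ] ℝ).hasFDerivAt.fderiv

/-- This is d log z_i = d log w_α + d log w_i, written without denominators so that it also holds on
the divisor. The coefficients change by a matrix that does not depend on v; this is the reason for
the isomorphism of elliptic tangent bundles. -/
theorem fderiv_blowMap_logVec {m α k : ℕ} (hk : 2 * k ≤ n) (hm : m = 0 ∨ α < m) (hmk : m ≤ k)
    (v c : Euc n) : fderiv ℝ (blowMap m α) v (logVec k v c) =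
      logVec k (blowMap m α v) (blowCoeff m α c) := by
  have hm' : 2 * m ≤ n := by omega
  refine euc_ext hk (fun i hi => ?_) fun j hj => ?_
  · rw [fderiv_zCoord_blowMap hm', zCoord_logVec hk, zCoord_logVec hk, zCoord_logVec hk,
      zCoord_blowMap hm', zCoord_blowCoeff hm', if_pos hi, if_pos hi]
    split_ifs with h1 h2
    · ring
    · omega
    · rfl
  · rw [fderiv_blowMap_apply_of_le _ _ (by omega), logVec_apply_of_le _ _ hj,
      logVec_apply_of_le _ _ hj, blowCoeff_apply_of_le _ (by omega)]

end Model


/-! ### Functions and vector fields in charts. -/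

section Charts

variable {n : ℕ} {M : Type*} [TopologicalSpace M] [ChartedSpace (Euc n) M]
  {φ : OpenPartialHomeomorph M (Euc n)} {y : M}

theorem OpenPartialHomeomorph.eventually_of_comp {X Y : Type*} [TopologicalSpace X]
    [TopologicalSpace Y] (φ : OpenPartialHomeomorph X Y) {y : X} (hy : y ∈ φ.source) {P : Y → Prop}
    (h : ∀ᶠ q in 𝓝 y, P (φ q)) : ∀ᶠ v in 𝓝 (φ y), P v := by
  have h1 := φ.tendsto_symm hy
  filter_upwards [h1.eventually h, φ.open_target.mem_nhds (φ.map_source hy)] with v hv hv'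
  rwa [φ.right_inv hv'] at hv

theorem contMDiffOn_comp_symm (hφ : φ ∈ IsManifold.maximalAtlas (𝓡 n) ∞ M) {𝕂 : Type*}
    [NormedField 𝕂] [NormedAlgebra ℝ 𝕂] (f : SmoothFn n M 𝕂) :
    ContDiffOn ℝ ∞ (f ∘ φ.symm) φ.target :=
  (f.contMDiff.comp_contMDiffOn (contMDiffOn_symm_of_mem_maximalAtlas hφ)).contDiffOn

theorem exists_contDiff_rep (hφ : φ ∈ IsManifold.maximalAtlas (𝓡 n) ∞ M) (hy : y ∈ φ.source)
    {𝕂 : Type*} [NormedField 𝕂] [NormedAlgebra ℝ 𝕂] (f : SmoothFn n M 𝕂) :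
    ∃ F : Euc n → 𝕂, ContDiff ℝ ∞ F ∧ f =ᶠ[𝓝 y] fun q => F (φ q) := by
  obtain ⟨F, hF⟩ := SmoothFn.exists_eventuallyEq (n := n) φ.open_target (φ.map_source hy)
    (contMDiffOn_comp_symm hφ f).contMDiffOn
  refine ⟨F, F.contMDiff.contDiff, ?_⟩
  have := φ.continuousAt hy
  filter_upwards [this.eventually hF, φ.open_source.mem_nhds hy] with q hq hq'
  rw [hq, Function.comp, φ.left_inv hq']

theorem contMDiffOn_comp_chart (hφ : φ ∈ IsManifold.maximalAtlas (𝓡 n) ∞ M) {G : Type*}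
    [NormedAddCommGroup G] [NormedSpace ℝ G] {F : Euc n → G} (hF : ContDiff ℝ ∞ F) :
    ContMDiffOn (𝓡 n) 𝓘(ℝ, G) ∞ (fun q => F (φ q)) φ.source :=
  hF.contMDiff.comp_contMDiffOn (contMDiffOn_of_mem_maximalAtlas hφ)

theorem contMDiffOn_comp_chart' (hφ : φ ∈ IsManifold.maximalAtlas (𝓡 n) ∞ M) {G : Type*}
    [NormedAddCommGroup G] [NormedSpace ℝ G] {F : Euc n → G} (hF : ContDiffOn ℝ ∞ F φ.target) :
    ContMDiffOn (𝓡 n) 𝓘(ℝ, G) ∞ (fun q => F (φ q)) φ.source :=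
  hF.contMDiffOn.comp (contMDiffOn_of_mem_maximalAtlas hφ) fun _ hq => φ.map_source hq

/-- The vector field with components `A` in the chart `φ`, cut off by `χ`. -/
theorem exists_vecField (hφ : φ ∈ IsManifold.maximalAtlas (𝓡 n) ∞ M) {χ : SmoothFn n M ℝ}
    (hχ : tsupport χ ⊆ φ.source) {A : Euc n → Euc n} (hA : ContDiff ℝ ∞ A) :
    ∃ Z : VecField n M, ∀ g q, Z g q = χ q * fderiv ℝ (g ∘ φ.symm) (φ q) (A (φ q)) := by
  have hsm : ∀ g : SmoothFn n M ℝ, ∃ F : SmoothFn n M ℝ, ∀ q, F q = χ q •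
      fderiv ℝ (g ∘ φ.symm) (φ q) (A (φ q)) := by
    intro g
    refine SmoothFn.exists_smul_eq φ.open_source hχ (contMDiffOn_comp_chart' hφ
      (F := fun v => fderiv ℝ (g ∘ φ.symm) v (A v)) ?_)
    exact ((contMDiffOn_comp_symm hφ g).fderiv_of_isOpen φ.open_target (m := ∞)
      (by simp)).clm_apply hA.contDiffOn
  choose Z hZ using hsm
  have hd : ∀ (g : SmoothFn n M ℝ) (q : M), χ q = 0 ∨ DifferentiableAt ℝ (g ∘ φ.symm) (φ q) := by
    intro g q
    by_cases hq : q ∈ φ.source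
    · exact .inr (((contMDiffOn_comp_symm hφ g).contDiffAt
        (φ.open_target.mem_nhds (φ.map_source hq))).differentiableAt (by simp))
    · exact .inl (image_eq_zero_of_notMem_tsupport fun h => hq (hχ h))
  have hsrc : ∀ (q : M), χ q = 0 ∨ φ.symm (φ q) = q := by
    intro q
    by_cases hq : q ∈ φ.source
    · exact .inr (φ.left_inv hq)
    · exact .inl (image_eq_zero_of_notMem_tsupport fun h => hq (hχ h))
  refine ⟨Derivation.mk' { toFun := Z, map_add' := fun f g => ?_, map_smul' := fun c f => ?_ }
    fun f g => ?_, hZ⟩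
  · ext q
    rcases hd f q with h | hf
    · simp [hZ, h]
    rcases hd g q with h | hg
    · simp [hZ, h]
    simp only [hZ, SmoothFn.add_apply]
    rw [show (⇑(f + g) ∘ φ.symm) = (f ∘ φ.symm) + (g ∘ φ.symm) from rfl, fderiv_add hf hg]
    simp [mul_add]
  · ext q
    rcases hd f q with h | hf
    · simp [hZ, h]
    simp only [hZ, SmoothFn.smul_apply, RingHom.id_apply]
    rw [show (⇑(c • f) ∘ φ.symm) = c • (f ∘ φ.symm) from rfl, fderiv_const_smul hf]
    simp [mul_left_comm]
  · ext q
    change Z (f * g) q = f q * Z g q + g q * Z f q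
    rcases hd f q with h | hf
    · simp [hZ, h]
    rcases hd g q with h | hg
    · simp [hZ, h]
    rcases hsrc q with h | hq
    · simp [hZ, h]
    simp only [hZ]
    rw [show (⇑(f * g) ∘ φ.symm) = (f ∘ φ.symm) * (g ∘ φ.symm) from rfl, fderiv_mul hf hg]
    simp [hq]
    ring

variable [IsManifold (𝓡 n) ∞ M] [T2Space M]

theorem exists_smoothFn_chart (hφ : φ ∈ IsManifold.maximalAtlas (𝓡 n) ∞ M) (hy : y ∈ φ.source)
    {𝕂 : Type*} [NormedField 𝕂] [NormedAlgebra ℝ 𝕂] {F : Euc n → 𝕂} (hF : ContDiff ℝ ∞ F) :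
    ∃ f : SmoothFn n M 𝕂, f =ᶠ[𝓝 y] fun q => F (φ q) :=
  SmoothFn.exists_eventuallyEq φ.open_source hy (contMDiffOn_comp_chart hφ hF)

/-- With a bump function χ supported where f = g one has χ (f - g) = 0, and the Leibniz rule at x
leaves X (f - g) (x) = 0. -/
theorem VecField.eventuallyEq (X : VecField n M) {f g : SmoothFn n M ℝ} {x : M}
    (h : f =ᶠ[𝓝 x] g) : X f x = X g x := by
  obtain ⟨χ, h1, h2⟩ := SmoothFn.exists_bump (n := n) (eventually_eventually_nhds.2 h)
  have h3 : χ * (f - g) = 0 := by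
    ext q
    by_cases hq : q ∈ tsupport χ
    · have := (h2 hq : ∀ᶠ q in 𝓝 q, f q = g q).self_of_nhds
      simp [this]
    · simp [image_eq_zero_of_notMem_tsupport hq]
  have h4 := congrArg (fun a : SmoothFn n M ℝ => a x) (X.leibniz χ (f - g))
  rw [h3, map_zero] at h4
  have h5 : χ x = 1 := h1.self_of_nhds
  have h6 : f x = g x := h.self_of_nhds
  simp only [smul_eq_mul, SmoothFn.zero_apply, SmoothFn.add_apply, SmoothFn.mul_apply, h5, map_sub,
    SmoothFn.sub_apply, h6, sub_self, zero_mul, add_zero, one_mul] at h4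
  linarith

/-- Smooth functions which coincide with the coordinates of `φ` near `y`. -/
theorem exists_coordFn (hφ : φ ∈ IsManifold.maximalAtlas (𝓡 n) ∞ M) (hy : y ∈ φ.source) :
    ∃ ξ : Fin n → SmoothFn n M ℝ, ∀ᶠ q in 𝓝 y, ∀ j, ξ j q = φ q j := by
  choose ξ hξ using fun j : Fin n => exists_smoothFn_chart hφ hy
    (F := fun v : Euc n => v j) (EuclideanSpace.proj j : Euc n →L[ℝ] ℝ).contDiff
  exact ⟨ξ, Filter.eventually_all.2 hξ⟩

/-- The components of a vector field in terms of the coordinate functions `ξ`. -/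
noncomputable def VecField.vec (X : VecField n M) (ξ : Fin n → SmoothFn n M ℝ) (q : M) : Euc n :=
  WithLp.toLp 2 fun j => X (ξ j) q

theorem euc_eq_sum (v : Euc n) : v = ∑ j, v j • EuclideanSpace.single j (1 : ℝ) := by
  ext i
  simp [Pi.single_apply]

/-- Hadamard's lemma for the identity projection gives g = g(q) + ∑ (ξ_j - ξ_j(q)) γ_j near q, where
γ_j(q) is a partial derivative; a derivation evaluated at q sees only ∑ X(ξ_j)(q) γ_j(q). -/
theorem VecField.apply_eq_fderiv (hφ : φ ∈ IsManifold.maximalAtlas (𝓡 n) ∞ M) {q : M}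
    (hq : q ∈ φ.source) {ξ : Fin n → SmoothFn n M ℝ} (hξ : ∀ᶠ q in 𝓝 q, ∀ j, ξ j q = φ q j)
    (X : VecField n M) (g : SmoothFn n M ℝ) :
    X g q = fderiv ℝ (g ∘ φ.symm) (φ q) (X.vec ξ q) := by
  obtain ⟨F, hF, hgF⟩ := exists_contDiff_rep hφ hq g
  obtain ⟨Ψ, hΨ, hΨ1, hΨ2⟩ := exists_hadamard (f := fun v => F (φ q + v))
    (hF.comp (contDiff_const.add contDiff_id)) (ContinuousLinearMap.id ℝ (Euc n))
  choose γ hγ using fun j : Fin n => exists_smoothFn_chart hφ hq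
    (F := fun v : Euc n => Ψ (v - φ q) (EuclideanSpace.single j (1 : ℝ)))
    ((hΨ.comp (contDiff_id.sub contDiff_const)).clm_apply contDiff_const)
  have hξq : ∀ j, ξ j q = φ q j := hξ.self_of_nhds
  have h1 : g =ᶠ[𝓝 q] (algebraMap ℝ (SmoothFn n M ℝ) (F (φ q)) +
      ∑ j, (ξ j - algebraMap ℝ _ (ξ j q)) * γ j : SmoothFn n M ℝ) := by
    filter_upwards [hgF, hξ, Filter.eventually_all.2 hγ] with z hz1 hz2 hz3
    have h2 := hΨ1 (φ z - φ q)
    simp only [ContinuousLinearMap.id_apply, sub_self, add_zero, add_sub_cancel] at h2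
    rw [hz1, h2]
    simp only [SmoothFn.add_apply, SmoothFn.algebraMap_apply, SmoothFn.sum_apply,
      SmoothFn.mul_apply, SmoothFn.sub_apply, hz2, hz3, hξq]
    have h3 := congrArg (Ψ (φ z - φ q)) (euc_eq_sum (φ z - φ q))
    simp only [map_sum, map_smul, smul_eq_mul, PiLp.sub_apply] at h3
    rw [h3]
  have h3 : fderiv ℝ (g ∘ φ.symm) (φ q) = fderiv ℝ F (φ q) := by
    refine Filter.EventuallyEq.fderiv_eq ?_
    have := φ.eventually_of_comp hq (P := fun v => g (φ.symm v) = F v) (by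
      filter_upwards [hgF, φ.open_source.mem_nhds hq] with z hz hz'
      rw [φ.left_inv hz', hz])
    exact this
  have h4 : Ψ 0 = fderiv ℝ F (φ q) := by
    rw [hΨ2 0 rfl]
    rw [fderiv_comp_add_left, add_zero]
  rw [X.eventuallyEq h1, h3, euc_eq_sum (X.vec ξ q)]
  simp only [map_add, Derivation.map_algebraMap, zero_add, map_sum, Derivation.leibniz, map_sub,
    sub_zero, smul_eq_mul, SmoothFn.sum_apply, SmoothFn.add_apply, SmoothFn.mul_apply,
    SmoothFn.sub_apply, SmoothFn.algebraMap_apply, sub_self, zero_mul, map_smul, VecField.vec]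
  refine Finset.sum_congr rfl fun j _ => ?_
  have h5 := (hγ j).self_of_nhds
  simp only [sub_self, h4] at h5
  rw [h5, mul_comm]

end Charts


/-! ### Fibres of the elliptic tangent bundle and local frames. -/

section Fibres

variable {n : ℕ} {M : Type*} [TopologicalSpace M] [ChartedSpace (Euc n) M]
  {I : Ideal (SmoothFn n M ℝ)} {y : M}

theorem valueAt_add (X Z : ellipticSections I) :
    valueAt I y (X + Z) = valueAt I y X + valueAt I y Z := rfl

theorem valueAt_real_smul (r : ℝ) (X : ellipticSections I) :
    valueAt I y (r • X) = r • valueAt I y X := rfl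

theorem valueAt_sum {ι : Type*} (s : Finset ι) (X : ι → ellipticSections I) :
    valueAt I y (∑ i ∈ s, X i) = ∑ i ∈ s, valueAt I y (X i) :=
  map_sum (Submodule.mkQ (vanishingIdealAt n y • (⊤ : Submodule (SmoothFn n M ℝ)
    (ellipticSections I)))) X s

theorem valueAt_eq_zero_iff (X : ellipticSections I) : valueAt I y X = 0 ↔
    X ∈ vanishingIdealAt n y • (⊤ : Submodule (SmoothFn n M ℝ) (ellipticSections I)) :=
  Submodule.Quotient.mk_eq_zero _

theorem valueAt_smul_of_apply_eq_zero {c : SmoothFn n M ℝ} (hc : c y = 0)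
    (X : ellipticSections I) : valueAt I y (c • X) = 0 :=
  (valueAt_eq_zero_iff _).2 (Submodule.smul_mem_smul hc trivial)

theorem valueAt_smul (c : SmoothFn n M ℝ) (X : ellipticSections I) :
    valueAt I y (c • X) = c y • valueAt I y X := by
  have h1 : c • X = (c - algebraMap ℝ _ (c y)) • X + (c y) • X := by
    apply Subtype.ext
    ext g q
    change c q * (X : VecField n M) g q =
      (c q - c y) * (X : VecField n M) g q + c y * (X : VecField n M) g q
    ring
  rw [h1, valueAt_add, valueAt_smul_of_apply_eq_zero (by simp), zero_add, valueAt_real_smul]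

theorem coe_smul_apply (c : SmoothFn n M ℝ) (X : ellipticSections I) (g : SmoothFn n M ℝ) (q : M) :
    ((c • X : ellipticSections I) : VecField n M) g q = c q * (X : VecField n M) g q := rfl

theorem coe_sum_apply {ι : Type*} (s : Finset ι) (X : ι → ellipticSections I)
    (g : SmoothFn n M ℝ) (q : M) :
    ((∑ i ∈ s, X i : ellipticSections I) : VecField n M) g q =
      ∑ i ∈ s, (X i : VecField n M) g q := by
  classical
  induction s using Finset.induction_on with
  | empty => rfl
  | insert a s ha ih =>
    rw [Finset.sum_insert ha, Finset.sum_insert ha, ← ih]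
    rfl

variable [IsManifold (𝓡 n) ∞ M] [T2Space M]

/-- The sections differ by (1 - χ)(X - Z) for a bump function χ, and 1 - χ vanishes at y. -/
theorem valueAt_congr {X Z : ellipticSections I}
    (h : ∀ᶠ q in 𝓝 y, ∀ g, (X : VecField n M) g q = (Z : VecField n M) g q) :
    valueAt I y X = valueAt I y Z := by
  obtain ⟨χ, h1, h2⟩ := SmoothFn.exists_bump (n := n) h
  have h3 : X = Z + (1 - χ) • (X - Z) := by
    apply Subtype.ext
    ext g q
    change (X : VecField n M) g q = (Z : VecField n M) g q +
      (1 - χ q) * ((X : VecField n M) g q - (Z : VecField n M) g q)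
    by_cases hq : q ∈ tsupport χ
    · rw [h2 hq g]
      ring
    · rw [image_eq_zero_of_notMem_tsupport hq]
      ring
  have h4 : (1 - χ) y = 0 := by
    have := h1.self_of_nhds
    simp [this]
  rw [h3, valueAt_add, valueAt_smul_of_apply_eq_zero h4, add_zero]

theorem valueAt_eq_sum {ι : Type*} [Fintype ι] {X : ellipticSections I} {c : ι → SmoothFn n M ℝ}
    {F : ι → ellipticSections I}
    (h : ∀ᶠ q in 𝓝 y, ∀ g, (X : VecField n M) g q = ∑ j, c j q * (F j : VecField n M) g q) :
    valueAt I y X = ∑ j, c j y • valueAt I y (F j) := by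
  rw [valueAt_congr (Z := ∑ j, c j • F j), valueAt_sum]
  · simp only [valueAt_smul]
  · filter_upwards [h] with q hq g
    rw [hq, coe_sum_apply]
    rfl

/-- `F` is a local frame at `y` of the elliptic tangent bundle of `I`, whose anchors are linearly
independent at the points of `G` near `y`. -/
structure IsFrameAt {ι : Type*} [Fintype ι] (I : Ideal (SmoothFn n M ℝ)) (y : M) (G : Set M)
    (F : ι → ellipticSections I) : Prop where
  spans : ∀ X : ellipticSections I, ∃ c : ι → SmoothFn n M ℝ, ∀ᶠ q in 𝓝 y, ∀ g,
    (X : VecField n M) g q = ∑ j, c j q * (F j : VecField n M) g q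
  indep : ∀ᶠ q in 𝓝 y, q ∈ G → ∀ c : ι → ℝ,
    (∀ g, ∑ j, c j * (F j : VecField n M) g q = 0) → ∀ j, c j = 0

section IsFrameAt

variable {ι : Type*} [Fintype ι] {G : Set M} {F : ι → ellipticSections I}

omit [IsManifold (𝓡 n) ∞ M] [T2Space M] in
theorem IsFrameAt.exists_eq_of_mem (h : IsFrameAt I y G F) {X : ellipticSections I}
    (hX : X ∈ vanishingIdealAt n y • (⊤ : Submodule (SmoothFn n M ℝ) (ellipticSections I))) :
    ∃ c : ι → SmoothFn n M ℝ, (∀ j, c j y = 0) ∧ ∀ᶠ q in 𝓝 y, ∀ g,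
      (X : VecField n M) g q = ∑ j, c j q * (F j : VecField n M) g q := by
  refine Submodule.smul_induction_on hX ?_ ?_
  · intro a ha Z _
    obtain ⟨c, hc⟩ := h.spans Z
    refine ⟨fun j => a * c j, fun j => ?_, ?_⟩
    · rw [SmoothFn.mul_apply, show a y = 0 from ha, zero_mul]
    · filter_upwards [hc] with q hq g
      rw [coe_smul_apply, hq, Finset.mul_sum]
      exact Finset.sum_congr rfl fun j _ => by rw [SmoothFn.mul_apply, mul_assoc]
  · rintro X Z ⟨c, hc0, hc⟩ ⟨c', hc0', hc'⟩
    refine ⟨c + c', fun j => ?_, ?_⟩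
    · simp [hc0, hc0']
    · filter_upwards [hc, hc'] with q hq hq' g
      have : ((X + Z : ellipticSections I) : VecField n M) g q =
        (X : VecField n M) g q + (Z : VecField n M) g q := rfl
      rw [this, hq, hq', ← Finset.sum_add_distrib]
      exact Finset.sum_congr rfl fun j _ => by simp [add_mul]

omit [IsManifold (𝓡 n) ∞ M] [T2Space M] in
/-- The values of a frame are linearly independent. -/
theorem IsFrameAt.eq_zero_of_sum (h : IsFrameAt I y G F) (hG : ∃ᶠ q in 𝓝 y, q ∈ G) {c : ι → ℝ}
    (hc : ∑ j, c j • valueAt I y (F j) = 0) (j : ι) : c j = 0 := by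
  have h1 : valueAt I y (∑ j, c j • F j) = 0 := by
    rw [valueAt_sum, ← hc]
    rfl
  obtain ⟨d, hd0, hd⟩ := h.exists_eq_of_mem ((valueAt_eq_zero_iff _).1 h1)
  -- Independence on G forces d_j = c_j at points accumulating at y, whereas d_j is continuous and
  -- vanishes at y.
  have h2 : ∃ᶠ q in 𝓝 y, d j q = c j := by
    refine (hG.and_eventually (h.indep.and hd)).mono ?_
    rintro q ⟨hqG, hq1, hq2⟩
    have := hq1 hqG (fun j => d j q - c j) (fun g => ?_) j
    · linarith
    · have h3 := hq2 g
      rw [coe_sum_apply] at h3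
      have h4 : ∀ j, ((c j • F j : ellipticSections I) : VecField n M) g q =
        c j * (F j : VecField n M) g q := fun _ => rfl
      simp only [h4] at h3
      simp only [sub_mul, Finset.sum_sub_distrib, h3, sub_self]
  by_contra hne
  have h3 : ∀ᶠ q in 𝓝 y, d j q ≠ c j :=
    (d j).continuous.continuousAt.eventually_ne (by rw [hd0]; exact Ne.symm hne)
  exact h2 h3

end IsFrameAt

variable {m : ℕ} {B : Type*} [TopologicalSpace B] [ChartedSpace (Euc m) B]
  {p : C^∞⟮𝓡 m, B; 𝓡 n, M⟯}

/-- Linear relations along `p` between sections hold in the fibres. -/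
theorem IsFrameAt.sum_eq_zero {ι κ : Type*} [Fintype ι] [Fintype κ] {G : Set M}
    {F : ι → ellipticSections I} {x : B} (h : IsFrameAt I (p x) G F)
    (hG : ∃ᶠ z in 𝓝 x, p z ∈ G) {f : κ → SmoothFn m B ℝ} {Z : κ → ellipticSections I}
    (hf : ∀ᶠ z in 𝓝 x, ∀ g, ∑ i, f i z * (Z i : VecField n M) g (p z) = 0) :
    ∑ i, f i x • valueAt I (p x) (Z i) = 0 := by
  have hp : Filter.Tendsto p (𝓝 x) (𝓝 (p x)) := p.contMDiff.continuous.continuousAt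
  choose c hc using fun i => h.spans (Z i)
  -- The frame coefficients of the relation vanish at the points lying over G. These accumulate at
  -- x, so continuity gives vanishing at x, although the anchor over p x need not be injective.
  have h1 : ∀ j, ∑ i, f i x * c i j (p x) = 0 := by
    intro j
    by_contra hne
    have hcont : Continuous fun z => ∑ i, f i z * c i j (p z) :=
      continuous_finsetSum _ fun i _ =>
        (f i).continuous.mul ((c i j).continuous.comp p.contMDiff.continuous)
    have h2 := hcont.continuousAt.eventually_ne hne
    refine (hG.and_eventually ((hp.eventually h.indep).and
      ((hp.eventually (Filter.eventually_all.2 hc)).and hf))).mono ?_ h2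
    rintro z ⟨hzG, hz1, hz2, hz3⟩
    refine hz1 hzG (fun j => ∑ i, f i z * c i j (p z)) (fun g => ?_) j
    rw [← hz3 g]
    simp only [hz2, Finset.sum_mul, Finset.mul_sum]
    rw [Finset.sum_comm]
    simp only [mul_assoc]
  have h3 : ∀ i, valueAt I (p x) (Z i) = ∑ j, c i j (p x) • valueAt I (p x) (F j) :=
    fun i => valueAt_eq_sum (hc i)
  simp only [h3, Finset.smul_sum, smul_smul]
  rw [Finset.sum_comm]
  simp only [← Finset.sum_smul, h1, zero_smul, Finset.sum_const_zero]

end Fibres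

/-! ### Logarithmic frames of the elliptic tangent bundle. -/

section LogFrame

open ComplexConjugate

theorem fderiv_comp_symm_of_eventuallyEq {n : ℕ} {M : Type*} [TopologicalSpace M]
    {φ : OpenPartialHomeomorph M (Euc n)} {q : M} (hq : q ∈ φ.source) {g : M → ℝ} {F : Euc n → ℝ}
    (h : g =ᶠ[𝓝 q] fun q => F (φ q)) :
    fderiv ℝ (g ∘ φ.symm) (φ q) = fderiv ℝ F (φ q) := by
  refine Filter.EventuallyEq.fderiv_eq ?_
  refine φ.eventually_of_comp hq (P := fun v => g (φ.symm v) = F v) ?_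
  filter_upwards [h, φ.open_source.mem_nhds hq] with z hz hz'
  rw [φ.left_inv hz', hz]

variable {n : ℕ} {M : Type*} [TopologicalSpace M] [ChartedSpace (Euc n) M]
  [IsManifold (𝓡 n) ∞ M] [T2Space M] {I : Ideal (SmoothFn n M ℝ)} {y : M}
  {φ : OpenPartialHomeomorph M (Euc n)} {k : ℕ}

omit [T2Space M] in
/-- A logarithmic vector field with constant coefficients extends from a neighbourhood. -/
theorem exists_logSection (hI : IsLocalIdeal I) (hφ : φ ∈ IsManifold.maximalAtlas (𝓡 n) ∞ M)
    (hy : y ∈ φ.source) (hk : 2 * k ≤ n) [T2Space M]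
    (hg : GeneratedOn I φ.source (fun _ : Fin 1 => fun q => ellipticModel k (φ q))) (c : Euc n) :
    ∃ Z : ellipticSections I, ∀ᶠ q in 𝓝 y, ∀ g,
      (Z : VecField n M) g q = fderiv ℝ (g ∘ φ.symm) (φ q) (logVec k (φ q) c) := by
  obtain ⟨χ, h1, h2⟩ := SmoothFn.exists_bump (n := n) (φ.open_source.mem_nhds hy)
  obtain ⟨Z, hZ⟩ := exists_vecField hφ h2 (A := fun v => logVec k v c)
    (contDiff_logVec k contDiff_id contDiff_const)
  refine ⟨⟨Z, fun f hf => hI _ fun q => ?_⟩, ?_⟩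
  · by_cases hq : q ∈ tsupport χ
    · have hqs := h2 hq
      obtain ⟨a, ha⟩ := (hg.germMem_iff hqs _).1 (germMem_coe hf)
      obtain ⟨H, hH, haH⟩ := exists_contDiff_rep hφ hqs a
      obtain ⟨b, hb⟩ := exists_smoothFn_chart hφ hqs (F := fun v => fderiv ℝ H v (logVec k v c) +
        H v * (∑ i ∈ Finset.range k, 2 * (zCoord i c).re))
        (((hH.fderiv_right (m := ∞) (by simp)).clm_apply
          (contDiff_logVec k contDiff_id contDiff_const)).add (hH.mul contDiff_const))
      refine (hg.germMem_iff hqs _).2 ⟨χ * b, ?_⟩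
      have h3 : f =ᶠ[𝓝 q] fun q => (H * (ellipticModel k : Euc n → ℝ)) (φ q) := by
        filter_upwards [ha, haH] with z hz hz'
        rw [hz, hz']
        rfl
      filter_upwards [h3.eventuallyEq_nhds, hb, φ.open_source.mem_nhds hqs] with z hz hz' hz''
      rw [hZ, fderiv_comp_symm_of_eventuallyEq hz'' hz, fderiv_mul
        (hH.differentiable (by simp) _) ((contDiff_ellipticModel k).differentiable (by simp) _)]
      simp only [add_apply, smul_apply, smul_eq_mul, fderiv_ellipticModel_logVec hk,
        SmoothFn.mul_apply, hz']
      ring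
    · refine ⟨0, I.zero_mem, ?_⟩
      filter_upwards [notMem_tsupport_iff_eventuallyEq.1 hq] with z hz
      rw [hZ, hz]
      simp
  · filter_upwards [h1] with q hq g
    rw [hZ, hq, Pi.one_apply, one_mul]

/-- Sections of the elliptic tangent bundle are logarithmic in elliptic coordinates. -/
theorem exists_coeff_of_mem_ellipticSections (hφ : φ ∈ IsManifold.maximalAtlas (𝓡 n) ∞ M)
    (hy : y ∈ φ.source) (hk : 2 * k ≤ n)
    (hg : GeneratedOn I φ.source (fun _ : Fin 1 => fun q => ellipticModel k (φ q)))
    (X : ellipticSections I) :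
    ∃ c : Euc n → Euc n, ContDiff ℝ ∞ c ∧ ∀ᶠ q in 𝓝 y, ∀ g,
      (X : VecField n M) g q = fderiv ℝ (g ∘ φ.symm) (φ q) (logVec k (φ q) (c (φ q))) := by
  obtain ⟨ξ, hξ⟩ := exists_coordFn hφ hy
  have hX : ∀ᶠ q in 𝓝 y, ∀ g, (X : VecField n M) g q =
      fderiv ℝ (g ∘ φ.symm) (φ q) (X.1.vec ξ q) := by
    filter_upwards [hξ.eventually_nhds, φ.open_source.mem_nhds hy] with q hq hq' g
    exact VecField.apply_eq_fderiv hφ hq' hq _ g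
  choose Ξ hΞ hXΞ using fun j => exists_contDiff_rep hφ hy ((X : VecField n M) (ξ j))
  set V : Euc n → Euc n := fun v => WithLp.toLp 2 fun j => Ξ j v with hV
  have hVs : ContDiff ℝ ∞ V := contDiff_euclidean.2 fun j => hΞ j
  have hXV : ∀ᶠ q in 𝓝 y, X.1.vec ξ q = V (φ q) := by
    filter_upwards [Filter.eventually_all.2 hXΞ] with q hq
    ext j
    exact hq j
  -- Preservation of I is needed only for one member δ whose germ at y is the elliptic model: X δ is
  -- a multiple of the model, which is the hypothesis of `zDvdAt_of_logarithmic`.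
  obtain ⟨δ, hδ, hδ'⟩ := hg.germMem hy 0
  obtain ⟨a, ha⟩ := (hg.germMem_iff hy _).1 (germMem_coe (X.2 δ hδ))
  obtain ⟨A, hA, haA⟩ := exists_contDiff_rep hφ hy a
  have hlog : (fun v => ∑ i ∈ Finset.range k, (∏ j ∈ (Finset.range k).erase i,
        Complex.normSq (zCoord j v)) * (2 * (conj (zCoord i v) * zCoord i (V v)).re)) =ᶠ[𝓝 (φ y)]
      fun v => A v * ellipticModel k v := by
    refine φ.eventually_of_comp hy ?_
    filter_upwards [hX, hXV, hδ'.eventuallyEq_nhds, ha, haA, φ.open_source.mem_nhds hy]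
      with q h1 h2 h3 h4 h5 h6
    rw [← fderiv_ellipticModel, ← h2, ← fderiv_comp_symm_of_eventuallyEq h6 h3.symm, ← h1, h4, h5]
  choose! β hβ hVβ using fun i (hi : i < k) => zDvdAt_of_logarithmic hk
    (fun i => (contDiff_zCoord i).comp hVs) hA hlog hi
  refine ⟨fun v => replaceZ (Finset.range k) (fun i => β i v) (V v),
    contDiff_replaceZ (fun i hi => hβ i (Finset.mem_range.1 hi)) hVs, ?_⟩
  have hVβ' : ∀ᶠ v in 𝓝 (φ y), ∀ i ∈ Finset.range k, zCoord i (V v) = zCoord i v * β i v :=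
    (Filter.eventually_all_finset _).2 fun i hi => hVβ i (Finset.mem_range.1 hi)
  filter_upwards [hX, hXV, (φ.continuousAt hy).eventually hVβ'] with q h1 h2 h3 g
  rw [h1, h2, ← exists_eq_logVec hk fun i hi => h3 i (Finset.mem_range.2 hi)]

/-- The freedom to choose C is used with `blowCoeffEquiv`, to make a frame on M match the standard
one on the blow-up. -/
theorem exists_logFrame (hI : IsLocalIdeal I) (hφ : φ ∈ IsManifold.maximalAtlas (𝓡 n) ∞ M)
    (hy : y ∈ φ.source) (hk : 2 * k ≤ n)
    (hg : GeneratedOn I φ.source (fun _ : Fin 1 => fun q => ellipticModel k (φ q)))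
    (C : Euc n ≃ₗ[ℝ] Euc n) :
    ∃ F : Fin n → ellipticSections I, (∀ᶠ q in 𝓝 y, ∀ j g, (F j : VecField n M) g q =
        fderiv ℝ (g ∘ φ.symm) (φ q) (logVec k (φ q) (C (EuclideanSpace.single j 1)))) ∧
      IsFrameAt I y {q | ellipticModel k (φ q) ≠ 0} F := by
  choose F hF using fun j => exists_logSection hI hφ hy hk hg (C (EuclideanSpace.single j 1))
  have hF' := Filter.eventually_all.2 hF
  have hsum : ∀ (c : Fin n → ℝ) (q : M) (g : SmoothFn n M ℝ), ∑ j, c j *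
      fderiv ℝ (g ∘ φ.symm) (φ q) (logVec k (φ q) (C (EuclideanSpace.single j 1))) =
      fderiv ℝ (g ∘ φ.symm) (φ q) (logVec k (φ q) (C (WithLp.toLp 2 c))) := by
    intro c q g
    rw [euc_eq_sum (WithLp.toLp 2 c)]
    simp only [map_sum, map_smul, logVec_sum hk, smul_eq_mul]
  refine ⟨F, hF', ⟨fun X => ?_, ?_⟩⟩
  · obtain ⟨c, hc, hXc⟩ := exists_coeff_of_mem_ellipticSections hφ hy hk hg X
    choose d hd using fun j : Fin n => exists_smoothFn_chart hφ hy
      (F := fun v => C.symm (c v) j) ((EuclideanSpace.proj j : Euc n →L[ℝ] ℝ).contDiff.comp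
        (C.toContinuousLinearEquiv.symm.contDiff.comp hc))
    refine ⟨d, ?_⟩
    filter_upwards [hXc, Filter.eventually_all.2 hd, hF'] with q h1 h2 h3 g
    simp only [h3, h2]
    rw [hsum, h1]
    simp
  · obtain ⟨ξ, hξ⟩ := exists_coordFn hφ hy
    filter_upwards [hξ.eventually_nhds, hF', φ.open_source.mem_nhds hy] with q h1 h2 h3 h4 c hc
    have h5 : logVec k (φ q) (C (WithLp.toLp 2 c)) = 0 := by
      ext j
      have h6 := hc (ξ j)
      simp only [h2] at h6
      rw [hsum, fderiv_comp_symm_of_eventuallyEq h3 (F := fun v => v j)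
        (h1.mono fun z hz => hz j)] at h6
      refine Eq.trans ?_ h6
      exact (congrArg (fun L : Euc n →L[ℝ] ℝ => L (logVec k (φ q) (C (WithLp.toLp 2 c))))
        (EuclideanSpace.proj j : Euc n →L[ℝ] ℝ).hasFDerivAt.fderiv).symm
    have h6 := eq_zero_of_logVec_eq_zero hk h4 h5
    intro j
    have h7 := congrArg (fun v : Euc n => v j) ((LinearEquiv.map_eq_zero_iff C).1 h6)
    simpa using h7

end LogFrame


/-! ### The Lie algebroid map induced by related frames. -/

section AlgebroidMap

variable {n m : ℕ} {M : Type*} [TopologicalSpace M] [ChartedSpace (Euc n) M]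
  {B : Type*} [TopologicalSpace B] [ChartedSpace (Euc m) B]

/-- Near `x`, the image of the section `X` under `Tp` is `∑ fᵢ p^*Zᵢ`. -/
def PushesTo {I' : Ideal (SmoothFn m B ℝ)} {I : Ideal (SmoothFn n M ℝ)}
    (p : C^∞⟮𝓡 m, B; 𝓡 n, M⟯) (x : B) (X : ellipticSections I') {κ : Type*} [Fintype κ]
    (f : κ → SmoothFn m B ℝ) (Z : κ → ellipticSections I) : Prop :=
  ∀ᶠ z in 𝓝 x, ∀ g : SmoothFn n M ℝ, (X : VecField m B) (g.comp p) z =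
    ∑ i, f i z * (Z i : VecField n M) g (p z)

/-- There are frames `E` of `I'` at `x` and `F` of `I` at `p x` which are `p`-related. -/
def HasRelatedFrames (I' : Ideal (SmoothFn m B ℝ)) (I : Ideal (SmoothFn n M ℝ))
    (p : C^∞⟮𝓡 m, B; 𝓡 n, M⟯) (x : B) : Prop :=
  ∃ (r : ℕ) (E : Fin r → ellipticSections I') (F : Fin r → ellipticSections I) (G' : Set B)
    (G : Set M), IsFrameAt I' x G' E ∧ IsFrameAt I (p x) G F ∧ (∃ᶠ z in 𝓝 x, p z ∈ G) ∧
    ∀ᶠ z in 𝓝 x, ∀ j, ∀ g : SmoothFn n M ℝ,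
      (E j : VecField m B) (g.comp p) z = (F j : VecField n M) g (p z)

variable {I' : Ideal (SmoothFn m B ℝ)} {I : Ideal (SmoothFn n M ℝ)} {p : C^∞⟮𝓡 m, B; 𝓡 n, M⟯}
  {x : B}

theorem PushesTo.of_frame {r : ℕ} {E : Fin r → ellipticSections I'} {F : Fin r → ellipticSections I}
    (hrel : ∀ᶠ z in 𝓝 x, ∀ j, ∀ g : SmoothFn n M ℝ,
      (E j : VecField m B) (g.comp p) z = (F j : VecField n M) g (p z))
    {X : ellipticSections I'} {c : Fin r → SmoothFn m B ℝ}
    (hc : ∀ᶠ z in 𝓝 x, ∀ g, (X : VecField m B) g z = ∑ j, c j z * (E j : VecField m B) g z) :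
    PushesTo p x X c F := by
  filter_upwards [hrel, hc] with z h1 h2 g
  rw [h2]
  simp only [h1]

theorem HasRelatedFrames.exists_pushesTo (h : HasRelatedFrames I' I p x)
    (X : ellipticSections I') : ∃ (r : ℕ) (f : Fin r → SmoothFn m B ℝ)
      (Z : Fin r → ellipticSections I), PushesTo p x X f Z := by
  obtain ⟨r, E, F, G', G, hE, hF, hG, hrel⟩ := h
  obtain ⟨c, hc⟩ := hE.spans X
  exact ⟨r, c, F, .of_frame hrel hc⟩

theorem PushesTo.add {X X' : ellipticSections I'} {κ κ' : Type*} [Fintype κ] [Fintype κ']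
    {f : κ → SmoothFn m B ℝ} {Z : κ → ellipticSections I} {f' : κ' → SmoothFn m B ℝ}
    {Z' : κ' → ellipticSections I} (h : PushesTo p x X f Z) (h' : PushesTo p x X' f' Z') :
    PushesTo p x (X + X') (Sum.elim f f') (Sum.elim Z Z') := by
  filter_upwards [h, h'] with z h1 h2 g
  simp only [Fintype.sum_sum_type, Sum.elim_inl, Sum.elim_inr, ← h1, ← h2]
  rfl

theorem PushesTo.smul {X : ellipticSections I'} {κ : Type*} [Fintype κ]
    {f : κ → SmoothFn m B ℝ} {Z : κ → ellipticSections I} (h : PushesTo p x X f Z)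
    (a : SmoothFn m B ℝ) : PushesTo p x (a • X) (fun i => a * f i) Z := by
  filter_upwards [h] with z h1 g
  simp only [coe_smul_apply, h1, Finset.mul_sum, SmoothFn.mul_apply, mul_assoc]

variable [IsManifold (𝓡 n) ∞ M] [T2Space M]

/-- The difference of the two expressions has zero anchor near x, hence vanishes in the fibre by
`IsFrameAt.sum_eq_zero`. This makes the fibre map independent of the chosen expression. -/
theorem PushesTo.value_eq (hrf : HasRelatedFrames I' I p x) {X : ellipticSections I'}
    {κ κ' : Type*} [Fintype κ] [Fintype κ']
    {f : κ → SmoothFn m B ℝ} {Z : κ → ellipticSections I} {f' : κ' → SmoothFn m B ℝ}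
    {Z' : κ' → ellipticSections I} (h : PushesTo p x X f Z) (h' : PushesTo p x X f' Z') :
    ∑ i, f i x • valueAt I (p x) (Z i) = ∑ i, f' i x • valueAt I (p x) (Z' i) := by
  obtain ⟨r, E, F, G', G, hE, hF, hG, hrel⟩ := hrf
  have := hF.sum_eq_zero hG (f := Sum.elim f fun i => -f' i) (Z := Sum.elim Z Z') (by
    filter_upwards [h, h'] with z h1 h2 g
    simp only [Fintype.sum_sum_type, Sum.elim_inl, Sum.elim_inr, SmoothFn.neg_apply, neg_mul,
      Finset.sum_neg_distrib, ← h1, ← h2]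
    ring)
  simp only [Fintype.sum_sum_type, Sum.elim_inl, Sum.elim_inr, SmoothFn.neg_apply, neg_smul,
      Finset.sum_neg_distrib] at this
  rwa [← sub_eq_add_neg, sub_eq_zero] at this

/-- The map on fibres induced by `p`, on sections. -/
noncomputable def pushSection (hrf : HasRelatedFrames I' I p x) :
    ellipticSections I' →ₗ[ℝ] EllipticFibre I (p x) where
  toFun X := ∑ i, (hrf.exists_pushesTo X).choose_spec.choose i x •
    valueAt I (p x) ((hrf.exists_pushesTo X).choose_spec.choose_spec.choose i)
  map_add' X X' := by
    rw [(hrf.exists_pushesTo (X + X')).choose_spec.choose_spec.choose_spec.value_eq hrf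
      ((hrf.exists_pushesTo X).choose_spec.choose_spec.choose_spec.add
        (hrf.exists_pushesTo X').choose_spec.choose_spec.choose_spec)]
    simp only [Fintype.sum_sum_type, Sum.elim_inl, Sum.elim_inr]
  map_smul' a X := by
    have h := ((hrf.exists_pushesTo X).choose_spec.choose_spec.choose_spec.smul
        (algebraMap ℝ _ a))
    rw [(hrf.exists_pushesTo (a • X)).choose_spec.choose_spec.choose_spec.value_eq hrf
      (X := a • X) h]
    simp only [SmoothFn.mul_apply, SmoothFn.algebraMap_apply, mul_smul, Finset.smul_sum,
      RingHom.id_apply]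

theorem pushSection_eq (hrf : HasRelatedFrames I' I p x) {X : ellipticSections I'}
    {κ : Type*} [Fintype κ] {f : κ → SmoothFn m B ℝ} {Z : κ → ellipticSections I}
    (h : PushesTo p x X f Z) : pushSection hrf X = ∑ i, f i x • valueAt I (p x) (Z i) :=
  (hrf.exists_pushesTo X).choose_spec.choose_spec.choose_spec.value_eq hrf h

theorem pushSection_eq_zero (hrf : HasRelatedFrames I' I p x) {X : ellipticSections I'}
    (hX : X ∈ vanishingIdealAt m x • (⊤ : Submodule (SmoothFn m B ℝ) (ellipticSections I'))) :
    pushSection hrf X = 0 := by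
  refine Submodule.smul_induction_on hX ?_ ?_
  · intro a ha Z _
    obtain ⟨r, f, W, h⟩ := hrf.exists_pushesTo Z
    rw [pushSection_eq hrf (h.smul a)]
    refine Finset.sum_eq_zero fun i _ => ?_
    rw [SmoothFn.mul_apply, show a x = 0 from ha, zero_mul, zero_smul]
  · intro X Z hX hZ
    rw [map_add, hX, hZ, add_zero]

/-- The map on fibres induced by `p`. -/
noncomputable def pushFibre (hrf : HasRelatedFrames I' I p x) :
    EllipticFibre I' x →ₗ[ℝ] EllipticFibre I (p x) where
  toFun := Quotient.lift (fun X : ellipticSections I' => pushSection hrf X) (by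
    intro X Z hXZ
    have h := pushSection_eq_zero hrf ((Submodule.quotientRel_def _).1 hXZ)
    rw [map_sub] at h
    exact sub_eq_zero.1 h)
  map_add' := by
    rintro ⟨X⟩ ⟨Z⟩
    exact map_add (pushSection hrf) X Z
  map_smul' := by
    rintro c ⟨X⟩
    exact map_smul (pushSection hrf) c X

theorem pushFibre_valueAt (hrf : HasRelatedFrames I' I p x) {X : ellipticSections I'}
    {κ : Type*} [Fintype κ] {f : κ → SmoothFn m B ℝ} {Z : κ → ellipticSections I}
    (h : PushesTo p x X f Z) :
    pushFibre hrf (valueAt I' x X) = ∑ i, f i x • valueAt I (p x) (Z i) :=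
  pushSection_eq hrf h

omit [IsManifold (𝓡 n) ∞ M] [T2Space M] in
theorem anchor_valueAt (X : ellipticSections I) (y : M) (g : SmoothFn n M ℝ) :
    anchor I y (valueAt I y X) g = (X : VecField n M) g y := rfl

omit [IsManifold (𝓡 n) ∞ M] [T2Space M] in
theorem anchor_sum {κ : Type*} [Fintype κ] (y : M) (c : κ → ℝ) (Z : κ → ellipticSections I)
    (g : SmoothFn n M ℝ) : anchor I y (∑ i, c i • valueAt I y (Z i)) g =
      ∑ i, c i * (Z i : VecField n M) g y := by
  rw [map_sum, LinearMap.sum_apply]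
  refine Finset.sum_congr rfl fun i _ => ?_
  rw [map_smul, LinearMap.smul_apply, anchor_valueAt, smul_eq_mul]

theorem pushFibre_anchor (hrf : HasRelatedFrames I' I p x) (a : EllipticFibre I' x)
    (g : SmoothFn n M ℝ) :
    anchor I (p x) (pushFibre hrf a) g = anchor I' x a (SmoothFn.comp g p) := by
  obtain ⟨X, rfl⟩ : ∃ X, valueAt I' x X = a := Quotient.exists_rep a
  obtain ⟨r, f, Z, h⟩ := hrf.exists_pushesTo X
  rw [pushFibre_valueAt hrf h, anchor_sum, anchor_valueAt, h.self_of_nhds]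

/-- The map sends the value of E_j to that of F_j, and both families are frames; independence of the
values of F gives injectivity and spanning gives surjectivity. -/
theorem pushFibre_bijective [IsManifold (𝓡 m) ∞ B] [T2Space B] (hrf : HasRelatedFrames I' I p x) :
    Function.Bijective (pushFibre hrf) := by
  have hrf' := hrf
  obtain ⟨r, E, F, G', G, hE, hF, hG, hrel⟩ := hrf'
  constructor
  · rw [injective_iff_map_eq_zero]
    intro a ha
    obtain ⟨X, rfl⟩ : ∃ X, valueAt I' x X = a := Quotient.exists_rep a
    obtain ⟨c, hc⟩ := hE.spans X
    rw [pushFibre_valueAt hrf (.of_frame hrel hc)] at ha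
    have hG' : ∃ᶠ q in 𝓝 (p x), q ∈ G :=
      Filter.Tendsto.frequently p.contMDiff.continuous.continuousAt hG
    rw [valueAt_eq_sum hc]
    exact Finset.sum_eq_zero fun j _ => by rw [hF.eq_zero_of_sum hG' ha j, zero_smul]
  · intro b
    obtain ⟨Z, rfl⟩ : ∃ Z, valueAt I (p x) Z = b := Quotient.exists_rep b
    obtain ⟨c, hc⟩ := hF.spans Z
    -- Only the values of the coefficients at p x matter, so constants suffice for the preimage.
    refine ⟨valueAt I' x (∑ j, c j (p x) • E j), ?_⟩
    have h1 : PushesTo p x (∑ j, c j (p x) • E j) (fun j => algebraMap ℝ _ (c j (p x))) F := by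
      filter_upwards [hrel] with z hz g
      rw [coe_sum_apply]
      exact Finset.sum_congr rfl fun j _ => congrArg (c j (p x) * ·) (hz j g)
    rw [pushFibre_valueAt hrf h1, valueAt_eq_sum hc]
    rfl

omit [IsManifold (𝓡 n) ∞ M] [T2Space M] in
theorem PushesTo.bracket [IsManifold (𝓡 m) ∞ B] [T2Space B] {X X' : ellipticSections I'}
    {r s : ℕ} {f : Fin r → SmoothFn m B ℝ} {Z : Fin r → ellipticSections I}
    {g : Fin s → SmoothFn m B ℝ} {W : Fin s → ellipticSections I} (hX : PushesTo p x X f Z)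
    (hX' : PushesTo p x X' g W) :
    PushesTo p x (ellipticBracket I' X X')
      (Sum.elim (fun ij : Fin r × Fin s => f ij.1 * g ij.2)
        (Sum.elim (fun j => (X : VecField m B) (g j)) fun i => -(X' : VecField m B) (f i)))
      (Sum.elim (fun ij => ellipticBracket I (Z ij.1) (W ij.2)) (Sum.elim W Z)) := by
  filter_upwards [hX.eventually_nhds, hX'.eventually_nhds] with z hz hz' h
  -- Differentiating X'(h ∘ p) = ∑ g_j (W_j h) ∘ p along X gives terms with X(g_j) and terms with
  -- Z_i W_j h; antisymmetrising turns the latter into brackets.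
  have key : ∀ {X X' : ellipticSections I'} {r s : ℕ} {f : Fin r → SmoothFn m B ℝ}
      {Z : Fin r → ellipticSections I} {g : Fin s → SmoothFn m B ℝ}
      {W : Fin s → ellipticSections I}, PushesTo p z X f Z → PushesTo p z X' g W →
      (X : VecField m B) ((X' : VecField m B) (h.comp p)) z =
        ∑ j, g j z * ∑ i, f i z * (Z i : VecField n M) ((W j : VecField n M) h) (p z) +
        ∑ j, (X : VecField m B) (g j) z * (W j : VecField n M) h (p z) := by
    intro X X' r s f Z g W hX hX'
    have h1 : (X' : VecField m B) (h.comp p) =ᶠ[𝓝 z]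
        (∑ j, g j * ((W j : VecField n M) h).comp p : SmoothFn m B ℝ) := by
      filter_upwards [hX'] with q hq
      rw [hq h]
      simp
    rw [VecField.eventuallyEq _ h1, map_sum, SmoothFn.sum_apply, ← Finset.sum_add_distrib]
    refine Finset.sum_congr rfl fun j _ => ?_
    rw [Derivation.leibniz]
    simp only [smul_eq_mul, SmoothFn.add_apply, SmoothFn.mul_apply, SmoothFn.comp_apply]
    rw [hX.self_of_nhds]
    ring
  have h1 : ((ellipticBracket I' X X' : ellipticSections I') : VecField m B) (h.comp p) z =
      (X : VecField m B) ((X' : VecField m B) (h.comp p)) z -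
        (X' : VecField m B) ((X : VecField m B) (h.comp p)) z := by
    change (⁅(X : VecField m B), (X' : VecField m B)⁆ : VecField m B) (h.comp p) z = _
    rw [Derivation.commutator_apply]
    rfl
  have h2 : ∀ i j, ((ellipticBracket I (Z i) (W j) : ellipticSections I) : VecField n M) h (p z) =
      (Z i : VecField n M) ((W j : VecField n M) h) (p z) -
        (W j : VecField n M) ((Z i : VecField n M) h) (p z) := by
    intro i j
    change (⁅(Z i : VecField n M), (W j : VecField n M)⁆ : VecField n M) h (p z) = _
    rw [Derivation.commutator_apply]
    rfl
  rw [h1, key hz hz', key hz' hz]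
  simp only [Fintype.sum_sum_type, Sum.elim_inl, Sum.elim_inr, SmoothFn.neg_apply,
    SmoothFn.mul_apply, h2, Fintype.sum_prod_type, mul_sub, Finset.sum_sub_distrib, neg_mul,
    Finset.sum_neg_distrib, Finset.mul_sum]
  have e1 : ∑ j, ∑ i, g j z * (f i z * (Z i : VecField n M) ((W j : VecField n M) h) (p z)) =
      ∑ i, ∑ j, f i z * g j z * (Z i : VecField n M) ((W j : VecField n M) h) (p z) := by
    rw [Finset.sum_comm]
    exact Finset.sum_congr rfl fun i _ => Finset.sum_congr rfl fun j _ => by ring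
  have e2 : ∑ i, ∑ j, f i z * (g j z * (W j : VecField n M) ((Z i : VecField n M) h) (p z)) =
      ∑ i, ∑ j, f i z * g j z * (W j : VecField n M) ((Z i : VecField n M) h) (p z) :=
    Finset.sum_congr rfl fun i _ => Finset.sum_congr rfl fun j _ => by ring
  rw [e1, e2]
  ring

/-- A smooth map with `p`-related frames everywhere induces a fibrewise bijective Lie algebroid
map. -/
theorem exists_lieAlgebroidMap [IsManifold (𝓡 m) ∞ B] [T2Space B]
    (hrf : ∀ x, HasRelatedFrames I' I p x) :
    ∃ Φ : ∀ x : B, EllipticFibre I' x →ₗ[ℝ] EllipticFibre I (p x),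
      IsLieAlgebroidMap I' I p Φ ∧ ∀ x : B, Function.Bijective (Φ x) := by
  -- Applying the anchor turns an identity in the fibres near x into one between derivations, to
  -- which `PushesTo.bracket` applies.
  have hpush : ∀ {X : ellipticSections I'} {x : B} {r : ℕ} {f : Fin r → SmoothFn m B ℝ}
      {Z : Fin r → ellipticSections I},
      (∀ᶠ y in 𝓝 x, pushFibre (hrf y) (valueAt I' y X) = ∑ i, f i y • valueAt I (p y) (Z i)) →
      PushesTo p x X f Z := by
    intro X x r f Z h
    filter_upwards [h] with z hz g
    rw [← anchor_valueAt, ← pushFibre_anchor (hrf z), hz, anchor_sum]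
  refine ⟨fun x => pushFibre (hrf x), ⟨fun X x => ?_, fun x => pushFibre_anchor (hrf x), ?_⟩,
    fun x => pushFibre_bijective (hrf x)⟩
  · obtain ⟨r, f, Z, h⟩ := (hrf x).exists_pushesTo X
    refine ⟨r, f, Z, ?_⟩
    filter_upwards [h.eventually_nhds] with y hy
    exact pushFibre_valueAt (hrf y) hy
  · intro X X' x r s f Z g W hX hX'
    have h := pushFibre_valueAt (hrf x) ((hpush hX).bracket (hpush hX'))
    refine h.trans ?_
    simp only [Fintype.sum_sum_type, Sum.elim_inl, Sum.elim_inr, SmoothFn.neg_apply,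
      SmoothFn.mul_apply, Fintype.sum_prod_type, neg_smul, Finset.sum_neg_distrib]
    abel

end AlgebroidMap


/-! ### Nowhere dense zero sets. -/

section NowhereDense

variable {X 𝕂 : Type*} [TopologicalSpace X] [NormedField 𝕂]

theorem isNowhereDense_zeros {U : Set X} (hU : IsOpen U) {f : X → 𝕂} (hf : ContinuousOn f U)
    (h : ∀ x ∈ U, ∃ᶠ y in 𝓝 x, f y ≠ 0) : IsNowhereDense {y ∈ U | f y = 0} := by
  rw [IsNowhereDense, Set.eq_empty_iff_forall_notMem]
  intro z hz
  obtain ⟨O, hO, hOo, hzO⟩ := mem_interior.1 hz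
  obtain ⟨z', hz'O, hz'U, -⟩ := mem_closure_iff.1 (hO hzO) O hOo hzO
  have hOU : ∀ᶠ y in 𝓝 z', y ∈ O ∩ U := (hOo.inter hU).mem_nhds ⟨hz'O, hz'U⟩
  obtain ⟨y, hy, hyO, hyU⟩ := ((h z' hz'U).and_eventually hOU).exists
  have h1 : ∀ᶠ w in 𝓝 y, f w ≠ 0 := (hf.continuousAt (hU.mem_nhds hyU)).eventually_ne hy
  obtain ⟨w, hw1, -, hw2⟩ := mem_closure_iff_nhds.1 (hO hyO) _ h1
  exact hw1 hw2

theorem frequently_ne_zero_of_isNowhereDense {U : Set X} (hU : IsOpen U) {f : X → 𝕂}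
    (h : IsNowhereDense {y ∈ U | f y = 0}) {x : X} (hx : x ∈ U) : ∃ᶠ y in 𝓝 x, f y ≠ 0 := by
  intro hn
  have h1 : {y ∈ U | f y = 0} ∈ 𝓝 x := by
    filter_upwards [hn, hU.mem_nhds hx] with y hy hy'
    exact ⟨hy', not_not.1 hy⟩
  have h2 := interior_mono subset_closure (mem_interior_iff_mem_nhds.2 h1)
  rw [h] at h2
  exact h2

end NowhereDense

/-! ### Centring elliptic coordinates at a given point. -/

section Elliptic

variable {n : ℕ} {M : Type*} [TopologicalSpace M] [ChartedSpace (Euc n) M]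
  [IsManifold (𝓡 n) ∞ M] [T2Space M] {I : Ideal (SmoothFn n M ℝ)}
  {ψ : OpenPartialHomeomorph M (Euc n)} {k : ℕ} {x : M}

theorem GeneratedOn.of_eq_mul_unit {𝕂 : Type*} [NormedField 𝕂] [NormedAlgebra ℝ 𝕂] [CompleteSpace 𝕂]
    {I : Ideal (SmoothFn n M 𝕂)} {U : Set M} (hU : IsOpen U) {s s' v : M → 𝕂}
    (h : GeneratedOn I U (fun _ : Fin 1 => s)) (hv : ContMDiffOn (𝓡 n) 𝓘(ℝ, 𝕂) ∞ v U)
    (hv0 : ∀ y ∈ U, v y ≠ 0) (hs : ∀ y ∈ U, s y = v y * s' y) :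
    GeneratedOn I U (fun _ : Fin 1 => s') := by
  refine generatedOn_one_iff.2 fun x hx g => ?_
  rw [h.germMem_iff hx]
  constructor
  · rintro ⟨c, hc⟩
    obtain ⟨a, ha⟩ := SmoothFn.exists_eventuallyEq hU hx hv
    refine ⟨c * a, ?_⟩
    filter_upwards [hc, ha, hU.mem_nhds hx] with y h1 h2 h3
    rw [h1, hs y h3, SmoothFn.mul_apply, h2, mul_assoc]
  · rintro ⟨c, hc⟩
    obtain ⟨a, ha⟩ := SmoothFn.exists_eventuallyEq (g := fun y => (v y)⁻¹) hU hx
      (fun y hy => (contDiffAt_inv ℝ (hv0 y hy)).contMDiffAt.comp_contMDiffWithinAt y (hv y hy))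
    refine ⟨c * a, ?_⟩
    filter_upwards [hc, ha, hU.mem_nhds hx] with y h1 h2 h3
    rw [h1, hs y h3, SmoothFn.mul_apply, h2]
    have := hv0 y h3
    field_simp

omit [ChartedSpace (Euc n) M] [IsManifold (𝓡 n) ∞ M] [T2Space M] in
theorem frequently_ellipticModel_ne_zero (hx : x ∈ ψ.source) (hk : 2 * k ≤ n) :
    ∃ᶠ y in 𝓝 x, ellipticModel k (ψ y) ≠ 0 := fun h =>
  (mem_closure_iff_frequently.1 (dense_ellipticModel_ne_zero hk (ψ x)))
    (ψ.eventually_of_comp hx (P := fun v => ¬ v ∈ {v : Euc n | ellipticModel k v ≠ 0}) h)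

/-- Permute the complex coordinates so that the coordinates `s 0, …, s (r - 1)` come first. -/
theorem exists_permute_zCoord {r : ℕ} {s : ℕ → ℕ} (hs : ∀ i < r, 2 * s i + 1 < n)
    (hr : 2 * r ≤ n) (hinj : Set.InjOn s (Set.Iio r)) :
    ∃ L : Euc n ≃L[ℝ] Euc n, ∀ i < r, ∀ v, zCoord i (L v) = zCoord (s i) v := by
  classical
  have hlt : ∀ j : Fin n, (j : ℕ) < 2 * r → 2 * s (j / 2) + j % 2 < n := by
    intro j hj
    have := hs (j / 2) (by omega)
    omega
  -- On real indices the prescription 2i ↦ 2 s(i), 2i + 1 ↦ 2 s(i) + 1 is injective on the first 2r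
  -- indices and extends to a permutation of all of them.
  obtain ⟨e, he⟩ := Finset.exists_equiv_extend_of_card_eq (α := Fin n) (β := Fin n)
    (t := Finset.univ) (by simp) (s := Finset.univ.filter fun j => (j : ℕ) < 2 * r)
    (f := fun j => if h : (j : ℕ) < 2 * r then ⟨2 * s (j / 2) + j % 2, hlt j h⟩ else j)
    (Finset.subset_univ _) (by
      intro j hj j' hj' h
      simp only [Finset.coe_filter, Finset.mem_univ, true_and, Set.mem_ofPred_eq] at hj hj'
      simp only [dif_pos hj, dif_pos hj', Fin.mk.injEq] at h
      have h1 : s (j / 2) = s (j' / 2) := by omega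
      have h2 := hinj (show (j : ℕ) / 2 < r by omega) (show (j' : ℕ) / 2 < r by omega) h1
      apply Fin.ext
      omega)
  have he' : ∀ j : Fin n, ∀ h : (j : ℕ) < 2 * r,
      (e j : Fin n) = ⟨2 * s (j / 2) + j % 2, hlt j h⟩ := by
    intro j h
    rw [he j (by simp [h]), dif_pos h]
  set π : Fin n ≃ Fin n := e.trans (Equiv.subtypeUnivEquiv (by simp)) with hπ
  have hπe : ∀ j, π j = (e j : Fin n) := fun j => rfl
  refine ⟨(LinearIsometryEquiv.piLpCongrLeft 2 ℝ ℝ π.symm).toContinuousLinearEquiv,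
    fun i hi v => ?_⟩
  have h1 : 2 * i + 1 < n := by omega
  have hL : ∀ j, (LinearIsometryEquiv.piLpCongrLeft 2 ℝ ℝ π.symm).toContinuousLinearEquiv v j =
      v (π j) := fun j => rfl
  unfold zCoord
  rw [dif_pos h1, dif_pos (hs i hi), hL, hL, hπe, hπe, he' _ (show 2 * i < 2 * r by omega),
    he' _ (show 2 * i + 1 < 2 * r by omega)]
  refine Complex.ext (congrArg (fun j => v j) (Fin.ext ?_)) (congrArg (fun j => v j) (Fin.ext ?_))
  · change 2 * s (2 * i / 2) + 2 * i % 2 = 2 * s i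
    rw [show 2 * i / 2 = i by omega]
    omega
  · change 2 * s ((2 * i + 1) / 2) + (2 * i + 1) % 2 = 2 * s i + 1
    rw [show (2 * i + 1) / 2 = i by omega]
    omega

/-- Elliptic coordinates on a neighbourhood of a point may be centred at that point. -/
theorem exists_centred_chart (hψ : ψ ∈ IsManifold.maximalAtlas (𝓡 n) ∞ M) (hx : x ∈ ψ.source)
    (hk : 2 * k ≤ n)
    (hg : GeneratedOn I ψ.source (fun _ : Fin 1 => fun y => ellipticModel k (ψ y))) :
    ∃ φ ∈ IsManifold.maximalAtlas (𝓡 n) ∞ M, x ∈ φ.source ∧ φ x = 0 ∧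
      ∃ k : ℕ, 2 * k ≤ n ∧
        GeneratedOn I φ.source (fun _ : Fin 1 => fun y => ellipticModel k (φ y)) := by
  classical
  -- Only the factors vanishing at x count there. The others are nonzero on W and are absorbed as a
  -- unit, so the multiplicity of x is the cardinality of S.
  set S : Finset ℕ := (Finset.range k).filter fun i => zCoord i (ψ x) = 0 with hS
  have hSk : ∀ i ∈ S, i < k := fun i hi => Finset.mem_range.1 (Finset.mem_filter.1 hi).1
  have hr : S.card ≤ k := by simpa using Finset.card_le_card (Finset.filter_subset _ _ : S ⊆ _)
  set s : ℕ → ℕ := fun i => if h : i < S.card then S.orderEmbOfFin rfl ⟨i, h⟩ else 0 with hs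
  have hs' : ∀ i (h : i < S.card), s i = S.orderEmbOfFin rfl ⟨i, h⟩ := fun i h => dif_pos h
  have hsS : ∀ i < S.card, s i ∈ S := fun i h => by
    rw [hs' i h]; exact Finset.orderEmbOfFin_mem _ _ _
  have hinj : Set.InjOn s (Set.Iio S.card) := by
    intro i hi j hj hij
    rw [hs' i hi, hs' j hj] at hij
    exact congrArg Fin.val ((S.orderEmbOfFin rfl).injective hij)
  have himg : (Finset.range S.card).image s = S := by
    refine Finset.eq_of_subset_of_card_le (fun j hj => ?_) ?_
    · obtain ⟨i, hi, rfl⟩ := Finset.mem_image.1 hj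
      exact hsS i (Finset.mem_range.1 hi)
    · rw [Finset.card_image_of_injOn (by simpa [Set.InjOn] using hinj), Finset.card_range]
  obtain ⟨L, hL⟩ := exists_permute_zCoord (n := n) (r := S.card) (s := s)
    (fun i hi => by have := hSk _ (hsS i hi); omega) (by omega) hinj
  set W : Set (Euc n) := {v | ∀ j ∈ Finset.range k \ S, zCoord j v ≠ 0} with hW
  have hWo : IsOpen W := by
    have : W = ⋂ j ∈ Finset.range k \ S, {v | zCoord j v ≠ 0} := by ext v; simp [hW]
    rw [this]
    exact isOpen_biInter_finset fun j _ =>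
      isOpen_ne_fun (contDiff_zCoord j).continuous continuous_const
  set e : Euc n ≃ₜ Euc n := (Homeomorph.subRight (ψ x)).trans L.toHomeomorph with he
  have hev : ∀ v, e v = L (v - ψ x) := fun v => rfl
  have hes : ∀ v, e.symm v = L.symm v + ψ x := fun v => rfl
  set φ := (ψ.restrOpen (ψ.source ∩ ψ ⁻¹' W)
    (ψ.isOpen_inter_preimage hWo)).transHomeomorph e with hφ
  have hsrc : φ.source = ψ.source ∩ (ψ.source ∩ ψ ⁻¹' W) := rfl
  have hφv : ∀ y, φ y = L (ψ y - ψ x) := fun y => rfl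
  have hmodel : ∀ y, (∏ j ∈ Finset.range k \ S, Complex.normSq (zCoord j (ψ y))) *
      ellipticModel S.card (φ y) = ellipticModel k (ψ y) := by
    intro y
    have h1 : ellipticModel S.card (φ y) = ∏ j ∈ S, Complex.normSq (zCoord j (ψ y)) := by
      rw [← himg, Finset.prod_image (by simpa [Set.InjOn] using hinj), himg]
      refine Finset.prod_congr rfl fun i hi => ?_
      have hi' := Finset.mem_range.1 hi
      rw [hφv, hL i hi', zCoord_sub, (Finset.mem_filter.1 (hsS i hi')).2, sub_zero]
    rw [h1, ellipticModel, Finset.prod_sdiff (Finset.filter_subset _ _)]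
  refine ⟨φ, ?_, ?_, ?_, S.card, by omega, ?_⟩
  · refine OpenPartialHomeomorph.mem_maximalAtlas_of_contMDiffOn _ ?_ ?_
    · have : ContDiff ℝ ∞ fun v => L (v - ψ x) :=
        L.contDiff.comp (contDiff_id.sub contDiff_const)
      exact (contMDiffOn_comp_chart hψ this).mono fun y hy => hy.1
    · have h1 : ContDiff ℝ ∞ fun v => L.symm v + ψ x := L.symm.contDiff.add contDiff_const
      refine (contMDiffOn_symm_of_mem_maximalAtlas hψ).comp h1.contMDiff.contMDiffOn ?_
      intro v hv
      exact hv.1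
  · refine ⟨hx, hx, fun j hj h0 => ?_⟩
    rw [Finset.mem_sdiff] at hj
    exact hj.2 (Finset.mem_filter.2 ⟨hj.1, h0⟩)
  · rw [hφv, sub_self, map_zero]
  · refine GeneratedOn.of_eq_mul_unit φ.open_source (hg.mono fun y hy => hy.1)
      ((contMDiffOn_comp_chart hψ (contDiff_erase (Finset.range k \ S))).mono fun y hy => hy.1) ?_
      fun y _ => (hmodel y).symm
    intro y hy
    exact Finset.prod_ne_zero_iff.2 fun j hj => by simpa using hy.2.2 j hj

end Elliptic


/-! ### The radical of the pulled-back divisor in local models. -/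

section LocalModel

variable {n : ℕ} {M : Type*} [TopologicalSpace M] [ChartedSpace (Euc n) M]
  {B : Type*} [TopologicalSpace B] [ChartedSpace (Euc n) B]

/-- In the charts `ψ` and `φ` the map `p` is the blow-up map `blowMap m α` with `m ≤ l`, and the
ideal `I` is generated by the elliptic model with `k` factors. -/
structure IsLocalModel (I : Ideal (SmoothFn n M ℝ)) (p : C^∞⟮𝓡 n, B; 𝓡 n, M⟯) (l : ℕ)
    (ψ : OpenPartialHomeomorph B (Euc n)) (φ : OpenPartialHomeomorph M (Euc n)) (k m α : ℕ) :
    Prop where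
  mem_source : ψ ∈ IsManifold.maximalAtlas (𝓡 n) ∞ B
  mem_target : φ ∈ IsManifold.maximalAtlas (𝓡 n) ∞ M
  mapsTo : ∀ x ∈ ψ.source, p x ∈ φ.source
  two_mul_le : 2 * k ≤ n
  index : m = 0 ∨ α < m
  le_mult : m ≤ k
  le_codim : m ≤ l
  apply_eq : ∀ x ∈ ψ.source, φ (p x) = blowMap m α (ψ x)
  generated : GeneratedOn I φ.source (fun _ : Fin 1 => fun y => ellipticModel k (φ y))

variable {I : Ideal (SmoothFn n M ℝ)} {p : C^∞⟮𝓡 n, B; 𝓡 n, M⟯} {l : ℕ}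
  {ψ : OpenPartialHomeomorph B (Euc n)} {φ : OpenPartialHomeomorph M (Euc n)} {k m α : ℕ} {x : B}

theorem IsLocalModel.model_eq (h : IsLocalModel I p l ψ φ k m α) (hx : x ∈ ψ.source) :
    ellipticModel k (φ (p x)) = Complex.normSq (zCoord α (ψ x)) ^ (m - 1) *
      ellipticModel k (ψ x) := by
  rw [h.apply_eq x hx, ellipticModel_blowMap h.two_mul_le h.index h.le_mult]

theorem IsLocalModel.model_ne_zero (h : IsLocalModel I p l ψ φ k m α) (hx : x ∈ ψ.source)
    (h0 : ellipticModel k (ψ x) ≠ 0) : ellipticModel k (φ (p x)) ≠ 0 := by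
  rw [h.model_eq hx]
  refine mul_ne_zero ?_ h0
  rcases h.index with rfl | hm
  · simp
  · exact pow_ne_zero _ (by simpa using ellipticModel_ne_zero_iff.1 h0 α (hm.trans_le h.le_mult))

theorem IsLocalModel.germMem_pullback (h : IsLocalModel I p l ψ φ k m α) (hx : x ∈ ψ.source)
    (g : B → ℝ) : GermMem (pullbackIdeal p I) x g ↔ ∃ c : SmoothFn n B ℝ, g =ᶠ[𝓝 x] fun y =>
      c y * (Complex.normSq (zCoord α (ψ y)) ^ (m - 1) * ellipticModel k (ψ y)) := by
  have h1 := (h.generated.pullback (p := p)).mono h.mapsTo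
  have h2 : GeneratedOn (pullbackIdeal p I) ψ.source (fun _ : Fin 1 => fun y =>
      Complex.normSq (zCoord α (ψ y)) ^ (m - 1) * ellipticModel k (ψ y)) :=
    h1.congr ψ.open_source fun y hy _ => h.model_eq hy
  exact h2.germMem_iff hx g

/-- The factor |w_α|² divides the model, so m - 1 copies of the model absorb |w_α|^(2(m-1)) and one
more supplies the model itself. Any positive exponent l ≥ m therefore suffices. -/
theorem exists_ellipticModel_pow_eq (hmk : m ≤ k) (hm : m = 0 ∨ α < m) (hml : m ≤ l) (hl : 0 < l) :
    ∃ R : Euc n → ℝ, ContDiff ℝ ∞ R ∧ ∀ v, ellipticModel k v ^ l =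
      R v * (Complex.normSq (zCoord α v) ^ (m - 1) * ellipticModel k v) := by
  have key : ∃ Q : Euc n → ℝ, ContDiff ℝ ∞ Q ∧ ∀ v, ellipticModel k v ^ (m - 1) =
      Complex.normSq (zCoord α v) ^ (m - 1) * Q v := by
    rcases hm with rfl | hm
    · exact ⟨fun _ => 1, contDiff_const, fun v => by simp⟩
    · refine ⟨fun v => (∏ j ∈ (Finset.range k).erase α, Complex.normSq (zCoord j v)) ^ (m - 1),
        (contDiff_erase _).pow _, fun v => ?_⟩
      rw [← mul_pow, ellipticModel,
        Finset.mul_prod_erase _ (fun j => Complex.normSq (zCoord j v))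
          (Finset.mem_range.2 (hm.trans_le hmk))]
  obtain ⟨Q, hQ, h⟩ := key
  refine ⟨fun v => ellipticModel k v ^ (l - 1 - (m - 1)) * Q v,
    ((contDiff_ellipticModel k).pow _).mul hQ, fun v => ?_⟩
  have h1 : l = (l - 1 - (m - 1)) + (m - 1) + 1 := by omega
  conv_lhs => rw [h1, pow_add, pow_add, pow_one, h]
  ring

variable [IsManifold (𝓡 n) ∞ B] [T2Space B]

/-- A power of f is a multiple of the pulled-back generator, hence of the elliptic model, whose
ideal is radical. -/
theorem IsLocalModel.exists_of_mem_radical (h : IsLocalModel I p l ψ φ k m α) (hx : x ∈ ψ.source)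
    {f : SmoothFn n B ℝ} (hf : f ∈ (pullbackIdeal p I).radical) :
    ∃ c : SmoothFn n B ℝ, f =ᶠ[𝓝 x] fun y => c y * ellipticModel k (ψ y) := by
  obtain ⟨N, hN⟩ := hf
  obtain ⟨a, ha⟩ := (h.germMem_pullback hx _).1 (germMem_coe hN)
  obtain ⟨A, hA, haA⟩ := exists_contDiff_rep h.mem_source hx a
  obtain ⟨F, hF, hfF⟩ := exists_contDiff_rep h.mem_source hx f
  obtain ⟨G, hG, hFG⟩ := exists_eq_mul_ellipticModel_of_pow h.two_mul_le (q := ψ x) hF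
    (g := fun v => A v * Complex.normSq (zCoord α v) ^ (m - 1))
    (hA.mul ((contDiff_normSq.comp (contDiff_zCoord α)).pow _)) (N := N)
    (ψ.eventually_of_comp hx (by
      filter_upwards [ha, haA, hfF] with y h1 h2 h3
      rw [← h3, ← SmoothFn.pow_apply, h1, h2]
      ring))
  obtain ⟨c, hc⟩ := exists_smoothFn_chart h.mem_source hx hG
  refine ⟨c, ?_⟩
  filter_upwards [hfF, hc, (ψ.continuousAt hx).eventually hFG] with y h1 h2 h3
  rw [h1, h3, h2]

theorem mem_radical_of_forall (hl : 0 < l) {f : SmoothFn n B ℝ}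
    (h : ∀ x : B, ∃ ψ φ k m α, IsLocalModel I p l ψ φ k m α ∧ x ∈ ψ.source ∧
      ∃ c : SmoothFn n B ℝ, f =ᶠ[𝓝 x] fun y => c y * ellipticModel k (ψ y)) :
    f ∈ (pullbackIdeal p I).radical := by
  -- Membership in the radical of an ideal of global functions requires a single exponent; l works
  -- in every local model at once.
  refine ⟨l, isLocalIdeal_localize _ _ fun x => germMem_localize.1 ?_⟩
  obtain ⟨ψ, φ, k, m, α, h, hx, c, hc⟩ := h x
  obtain ⟨R, hR, hR'⟩ := exists_ellipticModel_pow_eq (n := n) h.le_mult h.index h.le_codim hl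
  obtain ⟨r, hr⟩ := exists_smoothFn_chart h.mem_source hx hR
  refine germMem_localize.2 ((h.germMem_pullback hx _).2 ⟨c ^ l * r, ?_⟩)
  filter_upwards [hc, hr] with y h1 h2
  rw [SmoothFn.pow_apply, h1, mul_pow, hR', SmoothFn.mul_apply, h2, SmoothFn.pow_apply]
  ring

variable (I p l) in
/-- The map `p` is given by the blow-up maps in local coordinates. -/
def HasLocalModels : Prop :=
  ∀ x : B, ∃ ψ φ k m α, IsLocalModel I p l ψ φ k m α ∧ x ∈ ψ.source

theorem HasLocalModels.generatedOn_radical (H : HasLocalModels I p l) (hl : 0 < l)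
    (h : IsLocalModel I p l ψ φ k m α) : GeneratedOn (pullbackIdeal p I).radical ψ.source
      (fun _ : Fin 1 => fun y => ellipticModel k (ψ y)) := by
  refine generatedOn_one_iff.2 fun x hx g => ⟨?_, ?_⟩
  · rintro ⟨f, hf, hgf⟩
    obtain ⟨c, hc⟩ := h.exists_of_mem_radical hx hf
    exact ⟨c, hgf.trans hc⟩
  · rintro ⟨c, hc⟩
    -- The germ has to come from a global member of the radical. After cutting off, the function has
    -- zero germ outside the support of χ, where any other local model serves.
    obtain ⟨χ, h1, h2⟩ := SmoothFn.exists_bump (n := n) (ψ.open_source.mem_nhds hx)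
    obtain ⟨F, hF⟩ := SmoothFn.exists_smul_eq ψ.open_source h2
      (g := fun y => c y * ellipticModel k (ψ y))
      (c.contMDiff.contMDiffOn.mul (contMDiffOn_comp_chart h.mem_source (contDiff_ellipticModel k)))
    refine ⟨F, mem_radical_of_forall hl fun z => ?_, ?_⟩
    · by_cases hz : z ∈ tsupport χ
      · refine ⟨ψ, φ, k, m, α, h, h2 hz, χ * c, .of_forall fun y => ?_⟩
        beta_reduce
        rw [hF, smul_eq_mul, SmoothFn.mul_apply, mul_assoc]
      · obtain ⟨ψ', φ', k', m', α', h', hz'⟩ := H z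
        refine ⟨ψ', φ', k', m', α', h', hz', 0, ?_⟩
        filter_upwards [notMem_tsupport_iff_eventuallyEq.1 hz] with y hy
        rw [hF, hy]
        simp
    · filter_upwards [hc, h1] with y h3 h4
      rw [h3, hF, h4, Pi.one_apply, one_smul]

theorem HasLocalModels.isEllipticDivisor (H : HasLocalModels I p l) (hl : 0 < l) :
    IsEllipticDivisor (pullbackIdeal p I).radical := by
  refine ⟨⟨fun f hf => ?_, fun x => ?_⟩, fun x => ?_⟩
  · refine mem_radical_of_forall hl fun x => ?_
    obtain ⟨ψ, φ, k, m, α, h, hx⟩ := H x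
    exact ⟨ψ, φ, k, m, α, h, hx, ((H.generatedOn_radical hl h).germMem_iff hx _).1 (hf x)⟩
  · obtain ⟨ψ, φ, k, m, α, h, hx⟩ := H x
    have hs := contMDiffOn_comp_chart h.mem_source (contDiff_ellipticModel (n := n) k)
    exact ⟨ψ.source, ψ.open_source, hx, fun y => ellipticModel k (ψ y), hs,
      H.generatedOn_radical hl h, isNowhereDense_zeros ψ.open_source hs.continuousOn
        fun z hz => frequently_ellipticModel_ne_zero hz h.two_mul_le⟩
  · obtain ⟨ψ, φ, k, m, α, h, hx⟩ := H x
    exact exists_centred_chart h.mem_source hx h.two_mul_le (H.generatedOn_radical hl h)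

variable [IsManifold (𝓡 n) ∞ M] [T2Space M]

theorem HasLocalModels.hasRelatedFrames (H : HasLocalModels I p l) (hl : 0 < l)
    (hI : IsLocalIdeal I) (x : B) : HasRelatedFrames (pullbackIdeal p I).radical I p x := by
  obtain ⟨ψ, φ, k, m, α, h, hx⟩ := H x
  have hm2 : 2 * m ≤ n := by have := h.le_mult; have := h.two_mul_le; omega
  obtain ⟨E, hE, hEf⟩ := exists_logFrame (H.isEllipticDivisor hl).isDivisor.isLocal h.mem_source hx
    h.two_mul_le (H.generatedOn_radical hl h) (LinearEquiv.refl ℝ _)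
  -- The matrix by which the blow-up map changes logarithmic coefficients is built into the frame on
  -- M, so that it becomes p-related to the standard frame on B.
  obtain ⟨F, hF, hFf⟩ := exists_logFrame hI h.mem_target (h.mapsTo x hx) h.two_mul_le h.generated
    (blowCoeffEquiv α hm2)
  have hp : Filter.Tendsto p (𝓝 x) (𝓝 (p x)) := p.contMDiff.continuous.continuousAt
  refine ⟨n, E, F, _, _, hEf, hFf, ?_, ?_⟩
  · refine ((frequently_ellipticModel_ne_zero hx h.two_mul_le).and_eventually
      (ψ.open_source.eventually_mem hx)).mono ?_
    rintro z ⟨hz, hzs⟩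
    exact h.model_ne_zero hzs hz
  · filter_upwards [hE, hp.eventually hF, ψ.open_source.eventually_mem hx] with z h1 h2 hz j g
    rw [h1, h2]
    have hps : p z ∈ φ.source := h.mapsTo z hz
    obtain ⟨Γ, hΓ, hgΓ⟩ := exists_contDiff_rep h.mem_target hps g
    have h3 : g.comp p =ᶠ[𝓝 z] fun y => (Γ ∘ blowMap m α) (ψ y) := by
      filter_upwards [p.contMDiff.continuous.continuousAt.eventually hgΓ,
        ψ.open_source.mem_nhds hz] with y hy hy'
      rw [SmoothFn.comp_apply, hy, h.apply_eq y hy']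
      rfl
    rw [fderiv_comp_symm_of_eventuallyEq hz h3, fderiv_comp_symm_of_eventuallyEq hps hgΓ,
      fderiv_comp _ (hΓ.differentiable (by simp) _)
        ((contDiff_blowMap m α).differentiable (by simp) _),
      ContinuousLinearMap.comp_apply, LinearEquiv.refl_apply,
      fderiv_blowMap_logVec h.two_mul_le h.index h.le_mult, h.apply_eq z hz]
    rfl

end LocalModel


/-! ### Points of the blow-up as functionals on the fibres of the ideal. -/

section Functionals

variable {n : ℕ} {M : Type*} [TopologicalSpace M] [ChartedSpace (Euc n) M]
  {J : Ideal (SmoothFn n M ℂ)}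

/-- A nonzero functional on `J` which factors through the fibre of `J` at `y`. -/
structure IsFunctionalAt (J : Ideal (SmoothFn n M ℂ)) (y : M) (lam : J → ℂ) : Prop where
  map_add : ∀ s t, lam (s + t) = lam s + lam t
  map_smul : ∀ (h : SmoothFn n M ℂ) s, lam (h • s) = h y * lam s
  exists_ne_zero : ∃ s, lam s ≠ 0

namespace IsFunctionalAt

variable {y : M} {lam lam' : J → ℂ}

theorem map_zero (h : IsFunctionalAt J y lam) : lam 0 = 0 := by
  have := h.map_smul 0 0
  rwa [zero_smul, SmoothFn.zero_apply, zero_mul] at this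

theorem map_sum (h : IsFunctionalAt J y lam) {ι : Type*} (S : Finset ι) (t : ι → J) :
    lam (∑ i ∈ S, t i) = ∑ i ∈ S, lam (t i) :=
  _root_.map_sum (⟨⟨lam, h.map_zero⟩, h.map_add⟩ : J →+ ℂ) t S

/-- Both sides equal λ(st). For the generators z_i and z_α this gives the equations of the blow-up.
-/
theorem eval_mul_comm (h : IsFunctionalAt J y lam) (s t : J) :
    (s : SmoothFn n M ℂ) y * lam t = (t : SmoothFn n M ℂ) y * lam s := by
  rw [← h.map_smul, ← h.map_smul]
  exact congrArg lam (Subtype.ext (mul_comm (s : SmoothFn n M ℂ) t))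

variable [IsManifold (𝓡 n) ∞ M] [T2Space M]

theorem congr (h : IsFunctionalAt J y lam) {s t : J}
    (hst : (s : SmoothFn n M ℂ) =ᶠ[𝓝 y] (t : SmoothFn n M ℂ)) : lam s = lam t := by
  obtain ⟨χ, h1, h2⟩ := SmoothFn.exists_bump (n := n) (eventually_eventually_nhds.2 hst)
  obtain ⟨F, hF⟩ := SmoothFn.exists_smul_eq isOpen_univ (Set.subset_univ (tsupport χ))
    (g := fun _ : M => (1 : ℂ)) contMDiffOn_const
  have hFy : F y = 1 := by rw [hF, h1.self_of_nhds, Pi.one_apply, one_smul]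
  have key : F • s = F • t := by
    refine Subtype.ext (SmoothFn.ext fun z => ?_)
    change F z * (s : SmoothFn n M ℂ) z = F z * (t : SmoothFn n M ℂ) z
    by_cases hz : z ∈ tsupport χ
    · rw [(h2 hz : ∀ᶠ q in 𝓝 z, (s : SmoothFn n M ℂ) q = (t : SmoothFn n M ℂ) q).self_of_nhds]
    · rw [hF, image_eq_zero_of_notMem_tsupport hz, zero_smul, zero_mul, zero_mul]
  have := congrArg lam key
  rwa [h.map_smul, h.map_smul, hFy, one_mul, one_mul] at this

theorem eq_sum (h : IsFunctionalAt J y lam) {r : ℕ} (s : Fin r → J) (c : Fin r → SmoothFn n M ℂ)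
    {t : J} (ht : (t : SmoothFn n M ℂ) =ᶠ[𝓝 y] fun q => ∑ i, c i q * (s i : SmoothFn n M ℂ) q) :
    lam t = ∑ i, c i y * lam (s i) := by
  rw [h.congr (t := ∑ i, c i • s i), h.map_sum]
  · simp only [h.map_smul]
  · filter_upwards [ht] with q hq
    simp [hq]

/-- A functional is determined by its values on generators. -/
theorem eq_mul_of_generatedOn (h : IsFunctionalAt J y lam) (h' : IsFunctionalAt J y lam')
    {U : Set M} {r : ℕ} {s : Fin r → J}
    (hs : GeneratedOn J U fun i => (s i : SmoothFn n M ℂ)) (hy : y ∈ U)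
    {a : ℂ} (ha : ∀ i, lam' (s i) = a * lam (s i)) (t : J) : lam' t = a * lam t := by
  obtain ⟨c, hc⟩ := (hs y hy _).1 (germMem_coe t.2)
  rw [h.eq_sum s c hc, h'.eq_sum s c hc, Finset.mul_sum]
  exact Finset.sum_congr rfl fun i _ => by rw [ha]; ring

theorem exists_generator_ne_zero (h : IsFunctionalAt J y lam) {U : Set M} {r : ℕ} {s : Fin r → J}
    (hs : GeneratedOn J U fun i => (s i : SmoothFn n M ℂ)) (hy : y ∈ U) :
    ∃ i, lam (s i) ≠ 0 := by
  by_contra! hn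
  obtain ⟨t, ht⟩ := h.exists_ne_zero
  obtain ⟨c, hc⟩ := (hs y hy _).1 (germMem_coe t.2)
  refine ht ?_
  rw [h.eq_sum s c hc]
  simp [hn]

end IsFunctionalAt

/-- A point of the blow-up: a point `pt` of `M` with a functional on the fibre of `J` at `pt` up to
scaling, encoded by the ratios of its values. -/
structure BlowPt (J : Ideal (SmoothFn n M ℂ)) where
  /-- The underlying point. -/
  pt : M
  /-- The ratios of the values of the functional. -/
  ratio : J → J → ℂ
  exists_functional : ∃ lam : J → ℂ, IsFunctionalAt J pt lam ∧ ∀ s t, ratio s t = lam s / lam t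

namespace BlowPt

/-- A functional representing the point. -/
noncomputable def lam (b : BlowPt J) : J → ℂ := b.exists_functional.choose

theorem isFunctionalAt (b : BlowPt J) : IsFunctionalAt J b.pt b.lam :=
  b.exists_functional.choose_spec.1

theorem ratio_eq (b : BlowPt J) (s t : J) : b.ratio s t = b.lam s / b.lam t :=
  b.exists_functional.choose_spec.2 s t

/-- Because division by zero gives 0, the diagonal ratio is 1 or 0. The ratios thus determine the
functional up to scaling, including where it vanishes. -/
theorem ratio_self_ne_zero {b : BlowPt J} {s : J} : b.ratio s s ≠ 0 ↔ b.lam s ≠ 0 := by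
  rw [ratio_eq, Ne, div_eq_zero_iff, or_self]

theorem ext_of_ratio {b b' : BlowPt J} (h1 : b.pt = b'.pt) (h2 : ∀ s t, b.ratio s t = b'.ratio s t) :
    b = b' := by
  cases b
  cases b'
  obtain rfl : _ = _ := h1
  obtain rfl : _ = _ := funext fun s => funext fun t => h2 s t
  rfl

theorem ext_of_mul {b b' : BlowPt J} (h1 : b.pt = b'.pt) {lam lam' : J → ℂ}
    (h : ∀ s t, b.ratio s t = lam s / lam t) (h' : ∀ s t, b'.ratio s t = lam' s / lam' t)
    {a : ℂ} (ha : a ≠ 0) (h2 : ∀ s, lam' s = a * lam s) : b = b' :=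
  ext_of_ratio h1 fun s t => by rw [h, h', h2, h2, mul_div_mul_left _ _ ha]

/-- Where `J` has a nonvanishing member there is only one point. -/
theorem eq_of_apply_ne_zero {b b' : BlowPt J} (h1 : b.pt = b'.pt) {t : J}
    (ht : (t : SmoothFn n M ℂ) b.pt ≠ 0) : b = b' := by
  have key : ∀ (b : BlowPt J) (ht : (t : SmoothFn n M ℂ) b.pt ≠ 0) (s s' : J), b.ratio s s' =
      (s : SmoothFn n M ℂ) b.pt / (s' : SmoothFn n M ℂ) b.pt := by
    intro b ht s s'
    have h := b.isFunctionalAt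
    have h0 : b.lam t ≠ 0 := by
      intro h0
      obtain ⟨s, hs⟩ := h.exists_ne_zero
      have := h.eval_mul_comm t s
      rw [h0, mul_zero] at this
      exact mul_ne_zero ht hs this
    have h3 : ∀ s : J, b.lam s = b.lam t / (t : SmoothFn n M ℂ) b.pt * (s : SmoothFn n M ℂ) b.pt := by
      intro s
      have := h.eval_mul_comm t s
      field_simp
      linear_combination this
    rw [ratio_eq, h3 s, h3 s', mul_div_mul_left _ _ (div_ne_zero h0 ht)]
  refine ext_of_ratio h1 fun s s' => ?_
  rw [key b ht, key b' (h1 ▸ ht), h1]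

/-- Two points over the same point of `M` are separated by a common ratio. -/
theorem exists_ratio_ne {b b' : BlowPt J} (h1 : b.pt = b'.pt) (hne : b ≠ b') :
    ∃ s t, b.ratio t t ≠ 0 ∧ b'.ratio t t ≠ 0 ∧ b.ratio s t ≠ b'.ratio s t := by
  have ht : ∃ t, b.lam t ≠ 0 ∧ b'.lam t ≠ 0 := by
    obtain ⟨t, ht⟩ := b.isFunctionalAt.exists_ne_zero
    obtain ⟨t', ht'⟩ := b'.isFunctionalAt.exists_ne_zero
    by_cases h2 : b'.lam t = 0
    · by_cases h3 : b.lam t' = 0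
      · refine ⟨t + t', ?_, ?_⟩
        · rwa [b.isFunctionalAt.map_add, h3, add_zero]
        · rwa [b'.isFunctionalAt.map_add, h2, zero_add]
      · exact ⟨t', h3, ht'⟩
    · exact ⟨t, ht, h2⟩
  obtain ⟨t, ht, ht'⟩ := ht
  by_contra! hn
  refine hne (ext_of_mul h1 b.ratio_eq b'.ratio_eq (div_ne_zero ht' ht) fun s => ?_)
  have := hn s t (ratio_self_ne_zero.2 ht) (ratio_self_ne_zero.2 ht')
  rw [ratio_eq, ratio_eq, div_eq_div_iff ht ht'] at this
  field_simp
  linear_combination -this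

end BlowPt

section Division

variable {X : Type*} [TopologicalSpace X] {f : X → M} {γ : X → ℂ} {x : X}

/-- The value at `x` of the quotient of `t ∘ f` by `γ`. -/
noncomputable def divVal (f : X → M) (γ : X → ℂ) (x : X) (t : J) : ℂ :=
  Filter.limUnder (𝓝[{z | γ z ≠ 0}] x) fun z => (t : SmoothFn n M ℂ) (f z) / γ z

/-- The factor γ can be cancelled at points accumulating at x, and continuity carries the equality
to x. Hence quotients by γ have well-defined values. -/
theorem eq_of_eventually_mul_eq (hγ : ∃ᶠ z in 𝓝 x, γ z ≠ 0) {τ τ' : X → ℂ}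
    (hτ : ContinuousAt τ x) (hτ' : ContinuousAt τ' x)
    (h : ∀ᶠ z in 𝓝 x, τ z * γ z = τ' z * γ z) : τ x = τ' x := by
  have : Filter.NeBot (𝓝[{z : X | γ z ≠ 0}] x) :=
    mem_closure_iff_nhdsWithin_neBot.1 (mem_closure_iff_frequently.2 hγ)
  refine tendsto_nhds_unique (l := 𝓝[{z : X | γ z ≠ 0}] x) (hτ.tendsto.mono_left nhdsWithin_le_nhds)
    ((hτ'.tendsto.mono_left nhdsWithin_le_nhds).congr' ?_)
  filter_upwards [self_mem_nhdsWithin, h.filter_mono nhdsWithin_le_nhds] with z hz hz'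
  exact (mul_right_cancel₀ hz hz').symm

theorem divVal_eq (hγ : ∃ᶠ z in 𝓝 x, γ z ≠ 0) {t : J} {τ : X → ℂ} (hτ : ContinuousAt τ x)
    (h : ∀ᶠ z in 𝓝 x, (t : SmoothFn n M ℂ) (f z) = τ z * γ z) : divVal f γ x t = τ x := by
  have : Filter.NeBot (𝓝[{z : X | γ z ≠ 0}] x) :=
    mem_closure_iff_nhdsWithin_neBot.1 (mem_closure_iff_frequently.2 hγ)
  refine Filter.Tendsto.limUnder_eq ((hτ.tendsto.mono_left nhdsWithin_le_nhds).congr' ?_)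
  filter_upwards [self_mem_nhdsWithin, h.filter_mono nhdsWithin_le_nhds] with z hz hz'
  rw [hz', mul_div_cancel_right₀ _ hz]

variable {d : ℕ} [ChartedSpace (Euc d) X]

/-- All members of `f^* J` are divisible by `γ` near the points of `O`, and the quotients do not
vanish simultaneously. -/
structure IsDivisibleOn (J : Ideal (SmoothFn n M ℂ)) (O : Set X) (f : X → M) (γ : X → ℂ) :
    Prop where
  isOpen : IsOpen O
  contMDiffOn : ContMDiffOn (𝓡 d) (𝓡 n) ∞ f O
  frequently : ∀ x ∈ O, ∃ᶠ z in 𝓝 x, γ z ≠ 0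
  exists_quotient : ∀ x ∈ O, ∀ t : J, ∃ τ : SmoothFn d X ℂ,
    ∀ᶠ z in 𝓝 x, (t : SmoothFn n M ℂ) (f z) = τ z * γ z
  exists_ne_zero : ∀ x ∈ O, ∃ t : J, divVal f γ x t ≠ 0

namespace IsDivisibleOn

variable {O : Set X}

theorem exists_quotient' (h : IsDivisibleOn (d := d) J O f γ) (hx : x ∈ O) (t : J) :
    ∃ τ : SmoothFn d X ℂ, (∀ᶠ z in 𝓝 x, (t : SmoothFn n M ℂ) (f z) = τ z * γ z) ∧
      ∀ᶠ z in 𝓝 x, divVal f γ z t = τ z := by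
  obtain ⟨τ, hτ⟩ := h.exists_quotient x hx t
  refine ⟨τ, hτ, ?_⟩
  filter_upwards [eventually_eventually_nhds.2 hτ, h.isOpen.mem_nhds hx] with z hz hzO
  exact divVal_eq (h.frequently z hzO) τ.continuous.continuousAt hz

theorem isFunctionalAt (h : IsDivisibleOn (d := d) J O f γ) (hx : x ∈ O) :
    IsFunctionalAt J (f x) (divVal f γ x) where
  map_add s t := by
    obtain ⟨σ, h1, h2⟩ := h.exists_quotient' hx s
    obtain ⟨τ, h3, h4⟩ := h.exists_quotient' hx t
    rw [h2.self_of_nhds, h4.self_of_nhds]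
    refine divVal_eq (h.frequently x hx) (τ := σ + τ) (σ + τ).continuous.continuousAt ?_
    filter_upwards [h1, h3] with z h1 h3
    simp [h1, h3, add_mul]
  map_smul c s := by
    obtain ⟨σ, h1, h2⟩ := h.exists_quotient' hx s
    rw [h2.self_of_nhds]
    refine divVal_eq (h.frequently x hx) (τ := fun z => c (f z) * σ z) ?_ ?_
    · exact (c.continuous.continuousAt.comp
        (h.contMDiffOn.continuousOn.continuousAt (h.isOpen.mem_nhds hx))).mul
          σ.continuous.continuousAt
    filter_upwards [h1] with z h1
    simp [h1, mul_assoc]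
  exists_ne_zero := h.exists_ne_zero x hx

/-- The lift of `f` to the blow-up at a point where the members of `f^* J` are divisible. -/
noncomputable def lift (h : IsDivisibleOn (d := d) J O f γ) (hx : x ∈ O) : BlowPt J where
  pt := f x
  ratio s t := divVal f γ x s / divVal f γ x t
  exists_functional := ⟨divVal f γ x, h.isFunctionalAt hx, fun _ _ => rfl⟩

theorem lift_pt (h : IsDivisibleOn (d := d) J O f γ) (hx : x ∈ O) : (h.lift hx).pt = f x := rfl

theorem lift_ratio (h : IsDivisibleOn (d := d) J O f γ) (hx : x ∈ O) (s t : J) :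
    (h.lift hx).ratio s t = divVal f γ x s / divVal f γ x t := rfl

theorem lam_lift_ne_zero (h : IsDivisibleOn (d := d) J O f γ) (hx : x ∈ O) {s : J} :
    (h.lift hx).lam s ≠ 0 ↔ divVal f γ x s ≠ 0 := by
  rw [← BlowPt.ratio_self_ne_zero, lift_ratio, Ne, div_eq_zero_iff, or_self]

end IsDivisibleOn

end Division

end Functionals


/-! ### Coordinates on the blow-up. -/

section Plots

variable {n : ℕ} {M : Type*} [TopologicalSpace M] [ChartedSpace (Euc n) M]
  {J : Ideal (SmoothFn n M ℂ)}

/-- A chart of `M` together with global generators of `J` over it which are either the single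
function `1` or the first complex coordinates, and the index of one of the generators. -/
structure Plot (J : Ideal (SmoothFn n M ℂ)) where
  /-- The chart of `M`. -/
  chart : OpenPartialHomeomorph M (Euc n)
  /-- The number of generators. -/
  r : ℕ
  /-- The number of complex coordinates that are blown up. -/
  m : ℕ
  /-- The index of the generator by which the others are divided. -/
  α : ℕ
  /-- The generators. -/
  gen : ℕ → J
  mem_atlas : chart ∈ IsManifold.maximalAtlas (𝓡 n) ∞ M
  two_mul_le : 2 * m ≤ n
  lt : α < r
  generated : GeneratedOn J chart.source fun i : Fin r => (gen i : SmoothFn n M ℂ)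
  cases : (m = 0 ∧ r = 1 ∧ ∀ y ∈ chart.source, (gen α : SmoothFn n M ℂ) y = 1) ∨
    (m = r ∧ ∀ y ∈ chart.source, ∀ i < r, (gen i : SmoothFn n M ℂ) y = zCoord i (chart y))

namespace Plot

variable (P : Plot J)

theorem index : P.m = 0 ∨ P.α < P.m := by
  rcases P.cases with ⟨h, -⟩ | ⟨h, -⟩
  · exact Or.inl h
  · exact Or.inr (h ▸ P.lt)

/-- The inverse of the blow-up map, in terms of the ratios `v` of the generators. -/
noncomputable def unblow (z : Euc n) (v : ℕ → ℂ) : Euc n :=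
  replaceZ ((Finset.range P.m).erase P.α) v z

/-- The ratios of the generators in terms of the coordinates of the blow-up. -/
noncomputable def coef (i : ℕ) (x : Euc n) : ℂ := if i = P.α then 1 else zCoord i x

theorem contDiff_coef (i : ℕ) : ContDiff ℝ ∞ (P.coef i) := by
  unfold coef
  split_ifs
  · exact contDiff_const
  · exact contDiff_zCoord i

theorem coef_self (x : Euc n) : P.coef P.α x = 1 := if_pos rfl

/-- The range of the coordinates of the blow-up. -/
def range : Set (Euc n) := {x | blowMap P.m P.α x ∈ P.chart.target}

/-- The blow-down map in coordinates. -/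
noncomputable def down (x : Euc n) : M := P.chart.symm (blowMap P.m P.α x)

theorem isOpen_range : IsOpen P.range :=
  P.chart.open_target.preimage (contDiff_blowMap P.m P.α).continuous

variable {P} in
theorem chart_down {x : Euc n} (hx : x ∈ P.range) :
    P.chart (P.down x) = blowMap P.m P.α x :=
  P.chart.right_inv hx

variable {P} in
theorem down_mem {x : Euc n} (hx : x ∈ P.range) : P.down x ∈ P.chart.source :=
  P.chart.map_target hx

theorem contMDiffOn_down : ContMDiffOn (𝓡 n) (𝓡 n) ∞ P.down P.range :=
  (contMDiffOn_symm_of_mem_maximalAtlas P.mem_atlas).comp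
    (contDiff_blowMap P.m P.α).contMDiff.contMDiffOn fun _ hx => hx

variable {P} in
theorem gen_down {x : Euc n} (hx : x ∈ P.range) {i : ℕ} (hi : i < P.r) :
    (P.gen i : SmoothFn n M ℂ) (P.down x) =
      P.coef i x * (P.gen P.α : SmoothFn n M ℂ) (P.down x) := by
  unfold coef
  split_ifs with h
  · rw [h, one_mul]
  · rcases P.cases with ⟨-, h1, -⟩ | ⟨h1, h2⟩
    · have := P.lt
      omega
    · rw [h2 _ (down_mem hx) i hi, h2 _ (down_mem hx) _ P.lt, chart_down hx,
        zCoord_blowMap P.two_mul_le, zCoord_blowMap P.two_mul_le, if_pos ⟨h, h1 ▸ hi⟩,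
        if_neg fun h => h.1 rfl, mul_comm]

theorem frequently_ne_zero {x : Euc n} (hx : x ∈ P.range) :
    ∃ᶠ z in 𝓝 x, (P.gen P.α : SmoothFn n M ℂ) (P.down z) ≠ 0 := by
  have hev := P.isOpen_range.mem_nhds hx
  rcases P.cases with ⟨-, -, h⟩ | ⟨h1, h2⟩
  · refine Filter.Eventually.frequently ?_
    filter_upwards [hev] with z hz
    rw [h _ (down_mem hz)]
    exact one_ne_zero
  · have h3 := mem_closure_zCoord_ne_zero {P.α} (fun j hj => by
      rw [Finset.mem_singleton.1 hj]
      have := P.lt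
      have := P.two_mul_le
      omega) x
    refine ((mem_closure_iff_frequently.1 h3).and_eventually hev).mono fun z hz => ?_
    rw [h2 _ (down_mem hz.2) _ P.lt, chart_down hz.2, zCoord_blowMap P.two_mul_le,
      if_neg fun h => h.1 rfl]
    exact hz.1.2 _ (Finset.mem_singleton_self _)

/-- The relation z_i = v_i z_α is precisely what puts y in the image of the blow-up map with w_i =
v_i; when m = 0 no coordinate is changed. -/
theorem blowMap_unblow {y : M} (hy : y ∈ P.chart.source) {v : ℕ → ℂ}
    (hv : ∀ i < P.r, (P.gen i : SmoothFn n M ℂ) y = v i * (P.gen P.α : SmoothFn n M ℂ) y) :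
    blowMap P.m P.α (P.unblow (P.chart y) v) = P.chart y := by
  refine euc_ext P.two_mul_le (fun i hi => ?_) fun j hj => ?_
  · have hS : ∀ i ∈ (Finset.range P.m).erase P.α, 2 * i + 1 < n := fun i hi => by
      have := mem_erase_lt le_rfl hi
      have := P.two_mul_le
      omega
    rw [zCoord_blowMap P.two_mul_le, unblow, zCoord_replaceZ hS, zCoord_replaceZ hS]
    simp only [Finset.mem_erase, Finset.mem_range, ne_eq, not_true_eq_false, false_and, if_false]
    rcases P.cases with ⟨h1, -⟩ | ⟨h1, h2⟩
    · omega
    · by_cases h : i = P.α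
      · simp [h]
      · rw [if_pos ⟨h, hi⟩, if_pos ⟨h, hi⟩, ← h2 y hy _ P.lt, ← h2 y hy i (h1 ▸ hi),
          hv i (h1 ▸ hi), mul_comm]
  · rw [blowMap_apply_of_le _ hj, unblow,
      replaceZ_apply_of_le (fun _ hi => mem_erase_lt le_rfl hi) _ _ hj]

theorem zCoord_unblow {z : Euc n} {v : ℕ → ℂ} {i : ℕ} (hi : i < P.r) (hα : v P.α = 1) :
    P.coef i (P.unblow z v) = v i := by
  unfold coef
  split_ifs with h
  · rw [h, hα]
  · rcases P.cases with ⟨-, h1, -⟩ | ⟨h1, -⟩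
    · have := P.lt
      omega
    · rw [unblow, zCoord_replaceZ, if_pos (Finset.mem_erase.2 ⟨h, Finset.mem_range.2 (h1 ▸ hi)⟩)]
      intro i hi
      have := mem_erase_lt le_rfl hi
      have := P.two_mul_le
      omega

theorem unblow_congr {z : Euc n} {v v' : ℕ → ℂ} (h : ∀ i < P.r, v i = v' i) :
    P.unblow z v = P.unblow z v' := by
  unfold unblow replaceZ
  congr 1
  refine Finset.sum_congr rfl fun i hi => ?_
  rw [h i]
  have h1 := mem_erase_lt le_rfl hi
  rcases P.cases with ⟨h2, -⟩ | ⟨h2, -⟩ <;> omega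

theorem unblow_blowMap (x : Euc n) :
    P.unblow (blowMap P.m P.α x) (fun i => P.coef i x) = x := by
  have hS : ∀ i ∈ (Finset.range P.m).erase P.α, 2 * i + 1 < n := fun i hi => by
    have := mem_erase_lt le_rfl hi
    have := P.two_mul_le
    omega
  refine euc_ext P.two_mul_le (fun i hi => ?_) fun j hj => ?_
  · rw [unblow, zCoord_replaceZ hS, zCoord_blowMap P.two_mul_le]
    simp only [Finset.mem_erase, Finset.mem_range]
    by_cases h : i = P.α
    · simp [h]
    · rw [if_pos ⟨h, hi⟩, coef, if_neg h]
  · rw [unblow, replaceZ_apply_of_le (fun _ hi => mem_erase_lt le_rfl hi) _ _ hj,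
      blowMap_apply_of_le _ hj]

theorem divVal_gen {x : Euc n} (hx : x ∈ P.range) {i : ℕ} (hi : i < P.r) :
    divVal P.down (fun z => (P.gen P.α : SmoothFn n M ℂ) (P.down z)) x (P.gen i) = P.coef i x := by
  refine divVal_eq (P.frequently_ne_zero hx) (P.contDiff_coef i).continuous.continuousAt ?_
  filter_upwards [P.isOpen_range.mem_nhds hx] with z hz
  exact gen_down hz hi

theorem gen_eq_ratio_mul {b : BlowPt J} (hb : b.lam (P.gen P.α) ≠ 0) (i : ℕ) :
    (P.gen i : SmoothFn n M ℂ) b.pt =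
      b.ratio (P.gen i) (P.gen P.α) * (P.gen P.α : SmoothFn n M ℂ) b.pt := by
  rw [b.ratio_eq, div_mul_eq_mul_div, eq_div_iff hb, b.isFunctionalAt.eval_mul_comm, mul_comm]

/-- The coordinates of a point of the blow-up. -/
noncomputable def coord (b : BlowPt J) : Euc n :=
  P.unblow (P.chart b.pt) fun i => b.ratio (P.gen i) (P.gen P.α)

variable {P} in
theorem blowMap_coord {b : BlowPt J} (hb : b.pt ∈ P.chart.source) (hb' : b.lam (P.gen P.α) ≠ 0) :
    blowMap P.m P.α (P.coord b) = P.chart b.pt :=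
  P.blowMap_unblow hb fun i _ => P.gen_eq_ratio_mul hb' i

variable {P} in
theorem coord_mem {b : BlowPt J} (hb : b.pt ∈ P.chart.source) (hb' : b.lam (P.gen P.α) ≠ 0) :
    P.coord b ∈ P.range := by
  change blowMap P.m P.α (P.coord b) ∈ P.chart.target
  rw [blowMap_coord hb hb']
  exact P.chart.map_source hb

theorem exists_quotient_down {x : Euc n} (hx : x ∈ P.range) {t : J}
    {c : Fin P.r → SmoothFn n M ℂ}
    (hc : (t : SmoothFn n M ℂ) =ᶠ[𝓝 (P.down x)] fun y => ∑ i, c i y * (P.gen i : SmoothFn n M ℂ) y) :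
    ∃ τ : SmoothFn n (Euc n) ℂ, τ x = ∑ i, c i (P.down x) * P.coef i x ∧
      ∀ᶠ z in 𝓝 x, (t : SmoothFn n M ℂ) (P.down z) =
        τ z * (P.gen P.α : SmoothFn n M ℂ) (P.down z) := by
  choose C hC using fun i => SmoothFn.exists_eventuallyEq P.isOpen_range hx
    ((c i).contMDiff.comp_contMDiffOn P.contMDiffOn_down)
  refine ⟨∑ i : Fin P.r, C i * .of (P.coef i) (P.contDiff_coef i).contMDiff, ?_, ?_⟩
  · simp only [SmoothFn.sum_apply, SmoothFn.mul_apply, SmoothFn.coe_of, (hC _).self_of_nhds,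
      Function.comp_apply]
  have hcont := P.contMDiffOn_down.continuousOn.continuousAt (P.isOpen_range.mem_nhds hx)
  filter_upwards [Filter.eventually_all.2 hC, hcont.eventually hc, P.isOpen_range.mem_nhds hx]
    with z h1 h2 h3
  rw [h2, SmoothFn.sum_apply, Finset.sum_mul]
  exact Finset.sum_congr rfl fun i _ => by
    rw [gen_down h3 i.2, SmoothFn.mul_apply, h1, SmoothFn.coe_of, Function.comp_apply, mul_assoc]

/-- All generators pull back to multiples of the one with index α, whose own quotient is 1. This
presents the inverse chart as a lift of `down`, so that results on lifts apply to it. -/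
theorem isDivisibleOn : IsDivisibleOn (d := n) J P.range P.down
    (fun z => (P.gen P.α : SmoothFn n M ℂ) (P.down z)) where
  isOpen := P.isOpen_range
  contMDiffOn := P.contMDiffOn_down
  frequently _ hx := P.frequently_ne_zero hx
  exists_quotient x hx t := by
    obtain ⟨c, hc⟩ := (P.generated _ (down_mem hx) _).1 (germMem_coe t.2)
    obtain ⟨τ, -, hτ⟩ := P.exists_quotient_down hx hc
    exact ⟨τ, hτ⟩
  exists_ne_zero x hx := ⟨P.gen P.α, by
    rw [P.divVal_gen hx P.lt, coef_self]
    exact one_ne_zero⟩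

theorem coord_lift {x : Euc n} (hx : x ∈ P.range) : P.coord (P.isDivisibleOn.lift hx) = x := by
  refine Eq.trans ?_ (P.unblow_blowMap x)
  rw [coord, IsDivisibleOn.lift_pt, chart_down hx]
  refine P.unblow_congr fun i hi => ?_
  rw [IsDivisibleOn.lift_ratio, P.divVal_gen hx P.lt, P.divVal_gen hx hi, coef_self, div_one]

variable [IsManifold (𝓡 n) ∞ M] [T2Space M]

-- On each generator the functional of the lift takes the value λ(gen i)/λ(gen α), so it is λ
-- multiplied by λ(gen α)⁻¹.
variable {P} in
theorem lift_coord {b : BlowPt J} (hb : b.pt ∈ P.chart.source) (hb' : b.lam (P.gen P.α) ≠ 0) :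
    P.isDivisibleOn.lift (coord_mem hb hb') = b := by
  have hpt : P.down (P.coord b) = b.pt := by rw [down, blowMap_coord hb hb', P.chart.left_inv hb]
  have hl := P.isDivisibleOn.isFunctionalAt (coord_mem hb hb')
  rw [hpt] at hl
  refine (BlowPt.ext_of_mul (Eq.symm hpt) b.ratio_eq (P.isDivisibleOn.lift_ratio _)
    (inv_ne_zero hb') ?_).symm
  refine b.isFunctionalAt.eq_mul_of_generatedOn hl P.generated hb fun i => ?_
  rw [P.divVal_gen (coord_mem hb hb') i.2, coord, P.zCoord_unblow i.2, b.ratio_eq]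
  · field_simp
  · rw [b.ratio_eq, div_self hb']

open Classical in
/-- The coordinates of the blow-up over a plot. -/
noncomputable def toPartialEquiv (d : BlowPt J) : PartialEquiv (BlowPt J) (Euc n) where
  toFun := P.coord
  -- The point d is merely a default value outside the range.
  invFun x := if hx : x ∈ P.range then P.isDivisibleOn.lift hx else d
  source := {b | b.pt ∈ P.chart.source ∧ b.lam (P.gen P.α) ≠ 0}
  target := P.range
  map_source' _ hb := coord_mem hb.1 hb.2
  map_target' x hx := by
    rw [dif_pos hx]
    refine ⟨down_mem hx, (P.isDivisibleOn.lam_lift_ne_zero hx).2 ?_⟩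
    rw [P.divVal_gen hx P.lt, coef_self]
    exact one_ne_zero
  left_inv' b hb := by
    rw [dif_pos (coord_mem hb.1 hb.2)]
    exact lift_coord hb.1 hb.2
  right_inv' x hx := by
    rw [dif_pos hx]
    exact P.coord_lift hx

variable {P} {d : BlowPt J}

theorem blowMap_toPartialEquiv {b : BlowPt J} (hb : b ∈ (P.toPartialEquiv d).source) :
    blowMap P.m P.α (P.toPartialEquiv d b) = P.chart b.pt :=
  blowMap_coord hb.1 hb.2

theorem toPartialEquiv_symm {x : Euc n} (hx : x ∈ P.range) :
    (P.toPartialEquiv d).symm x = P.isDivisibleOn.lift hx :=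
  dif_pos hx

end Plot

section Smoothness

theorem contDiff_unblow (P : Plot J) : ContDiff ℝ ∞ fun w : (Fin P.r → ℂ) × Euc n =>
    P.unblow w.2 fun i => if h : i < P.r then w.1 ⟨i, h⟩ else 0 := by
  refine contDiff_replaceZ (fun i _ => ?_) contDiff_snd
  split_ifs with h
  · exact (contDiff_apply ℝ ℂ (⟨i, h⟩ : Fin P.r)).comp contDiff_fst
  · exact contDiff_const

variable {d : ℕ} {X : Type*} [TopologicalSpace X]
  [ChartedSpace (Euc d) X] {O : Set X} {f : X → M} {γ : X → ℂ}

/-- The ratios are continuous functions along lifts to the blow-up. -/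
theorem IsDivisibleOn.continuousAt_ratio (h : IsDivisibleOn (d := d) J O f γ)
    {g : X → BlowPt J} (hg : ∀ z (hz : z ∈ O), g z = h.lift hz) {x : X} (hx : x ∈ O) {s t : J}
    (ht : (g x).ratio t t ≠ 0) : ContinuousAt (fun z => (g z).ratio s t) x := by
  obtain ⟨σ, -, hσ⟩ := h.exists_quotient' hx s
  obtain ⟨τ, -, hτ⟩ := h.exists_quotient' hx t
  have h0 : τ x ≠ 0 := by
    rw [← hτ.self_of_nhds]
    intro h0
    rw [hg x hx, lift_ratio, h0, div_zero] at ht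
    exact ht rfl
  refine (σ.continuous.continuousAt.div τ.continuous.continuousAt h0).congr ?_
  filter_upwards [h.isOpen.mem_nhds hx, hσ, hτ] with z h1 h2 h3
  rw [hg z h1, lift_ratio, h2, h3, Pi.div_apply]

variable [IsManifold (𝓡 n) ∞ M] [T2Space M]

/-- Lifts to the blow-up are smooth in the coordinates of a plot, with open domain. -/
theorem IsDivisibleOn.eventually_contMDiffAt (h : IsDivisibleOn (d := d) J O f γ)
    {g : X → BlowPt J} (hg : ∀ z (hz : z ∈ O), g z = h.lift hz) (P : Plot J) {b₀ : BlowPt J} {x : X}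
    (hx : x ∈ O) (hgx : g x ∈ (P.toPartialEquiv b₀).source) :
    (∀ᶠ z in 𝓝 x, g z ∈ (P.toPartialEquiv b₀).source) ∧
      ContMDiffAt (𝓡 d) (𝓡 n) ∞ (P.toPartialEquiv b₀ ∘ g) x := by
  have hmem : ∀ z (hz : z ∈ O), g z ∈ (P.toPartialEquiv b₀).source ↔
      f z ∈ P.chart.source ∧ divVal f γ z (P.gen P.α) ≠ 0 := by
    intro z hz
    rw [hg z hz]
    exact and_congr Iff.rfl (h.lam_lift_ne_zero hz)
  choose τ hτ1 hτ2 using fun i : Fin P.r => h.exists_quotient' hx (P.gen i)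
  have hτ : ∀ᶠ z in 𝓝 x, ∀ i : Fin P.r, divVal f γ z (P.gen i) = τ i z :=
    Filter.eventually_all.2 hτ2
  have hx' := (hmem x hx).1 hgx
  have hO := h.isOpen.mem_nhds hx
  have hf : ContMDiffAt (𝓡 d) (𝓡 n) ∞ f x := h.contMDiffOn.contMDiffAt hO
  have hα : τ ⟨P.α, P.lt⟩ x ≠ 0 := by
    rw [← hτ.self_of_nhds]
    exact hx'.2
  constructor
  · filter_upwards [hO, hτ, hf.continuousAt.eventually (P.chart.open_source.mem_nhds hx'.1),
      (τ ⟨P.α, P.lt⟩).continuous.continuousAt.eventually_ne hα] with z h1 h2 h3 h4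
    exact (hmem z h1).2 ⟨h3, by rw [h2 ⟨P.α, P.lt⟩]; exact h4⟩
  -- In the plot the lift has coordinates `unblow` of the chart of f and the ratios τ_i/τ_α, which
  -- are smooth since τ_α(x) ≠ 0.
  · have hchart : ContMDiffAt (𝓡 d) (𝓡 n) ∞ (fun z => P.chart (f z)) x :=
      (contMDiffAt_of_mem_maximalAtlas P.mem_atlas hx'.1).comp x hf
    have hrat : ContMDiffAt (𝓡 d) 𝓘(ℝ, Fin P.r → ℂ) ∞
        (fun z i => τ i z * (τ ⟨P.α, P.lt⟩ z)⁻¹) x := by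
      refine contMDiffAt_pi_space.2 fun i =>
        contDiff_mul.contMDiff.contMDiffAt.comp x (((τ i).contMDiff x).prodMk_space ?_)
      exact (contDiffAt_inv ℝ hα).contMDiffAt.comp x ((τ ⟨P.α, P.lt⟩).contMDiff x)
    refine ((contDiff_unblow P).contMDiff.contMDiffAt.comp x
      (hrat.prodMk_space hchart)).congr_of_eventuallyEq ?_
    filter_upwards [hO, hτ] with z h1 h2
    change P.coord (g z) = P.unblow (P.chart (f z)) _
    rw [hg z h1, Plot.coord, lift_pt]
    refine P.unblow_congr fun i hi => ?_
    rw [dif_pos hi, lift_ratio, h2 ⟨i, hi⟩, h2 ⟨P.α, P.lt⟩, div_eq_mul_inv]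

end Smoothness

end Plots


/-! ### The blow-up as a manifold. -/

section BlowUpSpace

variable {n : ℕ} {M : Type u} [TopologicalSpace M] [ChartedSpace (Euc n) M]
  [IsManifold (𝓡 n) ∞ M] [T2Space M] {J : Ideal (SmoothFn n M ℂ)}

variable (J) in
/-- Locally on `M`, finitely many plots cover all points of the blow-up. -/
def HasPlots : Prop :=
  ∀ y : M, ∃ (N : ℕ) (P : Fin N → Plot J), ∃ U ∈ 𝓝 y, ∀ b : BlowPt J, b.pt ∈ U →
    ∃ i, b.pt ∈ (P i).chart.source ∧ b.lam ((P i).gen (P i).α) ≠ 0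

theorem HasPlots.exists_plot (h : HasPlots J) (b : BlowPt J) :
    ∃ P : Plot J, b ∈ (P.toPartialEquiv b).source := by
  obtain ⟨N, P, U, hU, hP⟩ := h b.pt
  obtain ⟨i, hi⟩ := hP b (mem_of_mem_nhds hU)
  exact ⟨P i, hi⟩

/-- The inverse of one chart is a lift to the blow-up, and every lift is smooth, with open domain,
when read in another plot. -/
theorem Plot.transition (P P' : Plot J) (d d' : BlowPt J) :
    IsOpen ((P.toPartialEquiv d).symm.trans (P'.toPartialEquiv d')).source ∧
      ContDiffOn ℝ ∞ ((P.toPartialEquiv d).symm.trans (P'.toPartialEquiv d'))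
        ((P.toPartialEquiv d).symm.trans (P'.toPartialEquiv d')).source := by
  have key : ∀ x ∈ ((P.toPartialEquiv d).symm.trans (P'.toPartialEquiv d')).source, _ := fun x hx =>
    P.isDivisibleOn.eventually_contMDiffAt (g := (P.toPartialEquiv d).symm)
      (fun z hz => toPartialEquiv_symm hz) P' (b₀ := d') (x := x) hx.1 hx.2
  constructor
  · refine isOpen_iff_mem_nhds.2 fun x hx => ?_
    filter_upwards [P.isOpen_range.mem_nhds hx.1, (key x hx).1] with z h1 h2
    exact ⟨h1, h2⟩
  · exact fun x hx => (key x hx).2.contDiffAt.contDiffWithinAt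

/-- The atlas of the blow-up. -/
noncomputable def blowUpCore (h : HasPlots J) : ChartedSpaceCore (Euc n) (BlowPt J) where
  atlas := {e | ∃ (P : Plot J) (d : BlowPt J), e = P.toPartialEquiv d}
  chartAt b := (h.exists_plot b).choose.toPartialEquiv b
  mem_chart_source b := (h.exists_plot b).choose_spec
  chart_mem_atlas b := ⟨_, b, rfl⟩
  open_source := by
    rintro _ _ ⟨P, d, rfl⟩ ⟨P', d', rfl⟩
    exact (P.transition P' d d').1
  continuousOn_toFun := by
    rintro _ _ ⟨P, d, rfl⟩ ⟨P', d', rfl⟩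
    exact (P.transition P' d d').2.continuousOn

/-- The blow-up of `J` as a manifold. -/
def BlowUpSpace (_ : HasPlots J) : Type u := BlowPt J

namespace BlowUpSpace

variable (h : HasPlots J)

noncomputable instance : TopologicalSpace (BlowUpSpace h) := (blowUpCore h).toTopologicalSpace

noncomputable instance : ChartedSpace (Euc n) (BlowUpSpace h) := (blowUpCore h).toChartedSpace

/-- The chart of the blow-up given by a plot. -/
noncomputable def chart (P : Plot J) (d : BlowPt J) :
    OpenPartialHomeomorph (BlowUpSpace h) (Euc n) :=
  (blowUpCore h).openPartialHomeomorph (P.toPartialEquiv d) ⟨P, d, rfl⟩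

variable {h}

theorem chart_symm_apply {P : Plot J} {d : BlowPt J} {x : Euc n} (hx : x ∈ P.range) :
    (chart h P d).symm x = P.isDivisibleOn.lift hx := Plot.toPartialEquiv_symm hx

theorem blowMap_chart {P : Plot J} {d : BlowPt J} {b : BlowUpSpace h}
    (hb : b ∈ (chart h P d).source) :
    blowMap P.m P.α (chart h P d b) = P.chart (BlowPt.pt b) :=
  Plot.blowMap_toPartialEquiv hb

theorem mem_atlas_iff {e : OpenPartialHomeomorph (BlowUpSpace h) (Euc n)} :
    e ∈ atlas (Euc n) (BlowUpSpace h) ↔ ∃ P d, e = chart h P d := by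
  constructor
  · intro he
    obtain ⟨_, ⟨e', rfl⟩, _, ⟨⟨P, d, rfl⟩, rfl⟩, he⟩ := he
    exact ⟨P, d, he⟩
  · rintro ⟨P, d, rfl⟩
    exact Set.mem_iUnion₂.2 ⟨_, ⟨P, d, rfl⟩, rfl⟩

variable (h) in
theorem exists_chart (b : BlowUpSpace h) : ∃ P d, b ∈ (chart h P d).source := by
  obtain ⟨P, hP⟩ := h.exists_plot b
  exact ⟨P, b, hP⟩

instance : IsManifold (𝓡 n) ∞ (BlowUpSpace h) := by
  refine isManifold_of_contDiffOn _ _ _ fun e e' he he' => ?_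
  obtain ⟨P, d, rfl⟩ := mem_atlas_iff.1 he
  obtain ⟨P', d', rfl⟩ := mem_atlas_iff.1 he'
  have := (P.transition P' d d').2
  refine this.mono ?_
  rintro x ⟨hx, -⟩
  exact hx

variable (h) in
theorem chart_mem_maximalAtlas (P : Plot J) (d : BlowPt J) :
    chart h P d ∈ IsManifold.maximalAtlas (𝓡 n) ∞ (BlowUpSpace h) :=
  IsManifold.subset_maximalAtlas (mem_atlas_iff.2 ⟨P, d, rfl⟩)

theorem continuousAt_ratio {s t : J} {b : BlowUpSpace h} (hb : BlowPt.ratio b t t ≠ 0) :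
    ContinuousAt (fun b : BlowUpSpace h => BlowPt.ratio b s t) b := by
  obtain ⟨P, d, hP⟩ := exists_chart h b
  rw [← (chart h P d).left_inv hP] at hb
  exact ((chart h P d).symm.continuousAt_iff_continuousAt_comp_right hP).2
    (P.isDivisibleOn.continuousAt_ratio (fun z hz => chart_symm_apply hz)
      ((chart h P d).map_source hP) hb)

variable (h) in
theorem contMDiff_pt : ContMDiff (𝓡 n) (𝓡 n) ∞ (fun b : BlowUpSpace h => BlowPt.pt b) := by
  intro b
  obtain ⟨P, d, hP⟩ := exists_chart h b
  have hx := (chart h P d).map_source hP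
  refine ((P.contMDiffOn_down.contMDiffAt (P.isOpen_range.mem_nhds hx)).comp b
    (contMDiffAt_of_mem_maximalAtlas (chart_mem_maximalAtlas h P d) hP)).congr_of_eventuallyEq ?_
  filter_upwards [(chart h P d).open_source.mem_nhds hP] with z hz
  rw [Function.comp_apply, Plot.down, blowMap_chart hz, P.chart.left_inv hz.1]

/-- Points over different points of M are separated by the blow-down map; two points over the same
point are separated by a ratio that is continuous at both. -/
instance : T2Space (BlowUpSpace h) := by
  refine t2Space_iff_disjoint_nhds.2 fun b b' hne => ?_
  by_cases hpt : BlowPt.pt b = BlowPt.pt b'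
  · obtain ⟨s, t, h1, h2, h3⟩ := BlowPt.exists_ratio_ne hpt hne
    exact (continuousAt_ratio (s := s) h1).tendsto.disjoint (disjoint_nhds_nhds.2 h3)
      (continuousAt_ratio (s := s) h2).tendsto
  · exact (contMDiff_pt h).continuous.continuousAt.tendsto.disjoint (disjoint_nhds_nhds.2 hpt)
      (contMDiff_pt h).continuous.continuousAt.tendsto

/-- Countably many of the neighbourhoods in `HasPlots` cover M, and finitely many charts lie over
each; this is where the finiteness of the families of plots enters. -/
instance [SecondCountableTopology M] : SecondCountableTopology (BlowUpSpace h) := by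
  rcases isEmpty_or_nonempty (BlowUpSpace h) with hE | ⟨⟨d⟩⟩
  · exact TopologicalSpace.secondCountableTopology_of_countable_cover
      (U := fun i : Empty => i.elim) (fun i => i.elim) (Subsingleton.elim _ _)
  have h' := h
  choose N P U hU hP using h'
  obtain ⟨S, hS, hSU⟩ := TopologicalSpace.countable_cover_nhds hU
  have := hS.to_subtype
  have hsc : ∀ i : Σ y : S, Fin (N y), SecondCountableTopology (chart h (P i.1 i.2) d).source :=
    fun i => (chart h (P i.1 i.2) d).secondCountableTopology_source
  refine TopologicalSpace.secondCountableTopology_of_countable_cover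
    (U := fun i : Σ y : S, Fin (N y) => (chart h (P i.1 i.2) d).source)
    (fun i => (chart h (P i.1 i.2) d).open_source) (Set.eq_univ_of_forall fun b => ?_)
  obtain ⟨y, hy, hb⟩ := Set.mem_iUnion₂.1 (hSU.symm ▸ Set.mem_univ (BlowPt.pt b))
  obtain ⟨i, hi⟩ := hP y b hb
  exact Set.mem_iUnion.2 ⟨⟨⟨y, hy⟩, i⟩, hi⟩

variable (h) in
/-- The blow-down map. -/
noncomputable def proj : C^∞⟮𝓡 n, BlowUpSpace h; 𝓡 n, M⟯ := ⟨fun b => BlowPt.pt b, contMDiff_pt h⟩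

theorem proj_apply (b : BlowUpSpace h) : proj h b = BlowPt.pt b := rfl

theorem generatedOn_pullback (P : Plot J) (d : BlowPt J) :
    GeneratedOn (pullbackIdeal (proj h) J) (chart h P d).source
      (fun _ : Fin 1 => fun b => (P.gen P.α : SmoothFn n M ℂ) (proj h b)) := by
  refine generatedOn_one_iff.2 fun b hb g => ?_
  have h1 := P.generated.pullback (p := proj h)
  have hev := (chart h P d).open_source.mem_nhds hb
  rw [h1 b hb.1 g]
  choose u hu using fun i : Fin P.r => exists_smoothFn_chart (chart_mem_maximalAtlas h P d) hb
    (P.contDiff_coef i)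
  constructor
  · rintro ⟨c, hc⟩
    refine ⟨∑ i, c i * u i, ?_⟩
    filter_upwards [hc, hev, Filter.eventually_all.2 hu] with z h1 h2 h3
    rw [h1, SmoothFn.sum_apply, Finset.sum_mul]
    refine Finset.sum_congr rfl fun i _ => ?_
    have h4 := (chart h P d).map_source h2
    have h5 : P.down (chart h P d z) = proj h z := by
      rw [Plot.down, blowMap_chart h2, P.chart.left_inv h2.1, proj_apply]
    rw [Function.comp_apply, ← h5, Plot.gen_down h4 i.2, SmoothFn.mul_apply, h3 i, mul_assoc]
  · rintro ⟨c, hc⟩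
    exact (h1 b hb.1 g).1 ⟨c * (P.gen P.α : SmoothFn n M ℂ).comp (proj h),
      Ideal.mul_mem_left _ _ (comp_mem_pullbackIdeal (P.gen P.α).2), hc⟩

variable (h) in
theorem isDivisor_pullback : IsDivisor (pullbackIdeal (proj h) J) where
  isLocal := isLocalIdeal_localize _
  locally_principal b := by
    obtain ⟨P, d, hb⟩ := exists_chart h b
    have hsm : ContMDiff (𝓡 n) 𝓘(ℝ, ℂ) ∞ fun b => (P.gen P.α : SmoothFn n M ℂ) (proj h b) :=
      ((P.gen P.α : SmoothFn n M ℂ).comp (proj h)).contMDiff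
    refine ⟨(chart h P d).source, (chart h P d).open_source, hb, _, hsm.contMDiffOn,
      generatedOn_pullback P d, isNowhereDense_zeros (chart h P d).open_source
        hsm.continuous.continuousOn fun z hz hn => ?_⟩
    have hx := (chart h P d).map_source hz
    refine P.frequently_ne_zero hx (((chart h P d).eventually_of_comp hz (P := fun x =>
      ¬ (P.gen P.α : SmoothFn n M ℂ) (P.down x) ≠ 0)) ?_)
    filter_upwards [hn, (chart h P d).open_source.mem_nhds hz] with w hw hw'
    rwa [Plot.down, blowMap_chart hw', P.chart.left_inv hw'.1]

end BlowUpSpace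

end BlowUpSpace


/-! ### The universal property of the blow-up. -/

section UniversalProperty

variable {n : ℕ} {M : Type u} [TopologicalSpace M] [ChartedSpace (Euc n) M]
  {J : Ideal (SmoothFn n M ℂ)} {d : ℕ} {X : Type*} [TopologicalSpace X] [ChartedSpace (Euc d) X]
  {f : C^∞⟮𝓡 d, X; 𝓡 n, M⟯}

theorem IsDivisibleOn.of_generatedOn {U : Set X} (hU : IsOpen U) {γ : X → ℂ}
    (hγ : ∀ x ∈ U, ∃ᶠ z in 𝓝 x, γ z ≠ 0)
    (h : GeneratedOn (pullbackIdeal f J) U (fun _ : Fin 1 => γ)) :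
    IsDivisibleOn (d := d) J U f γ := by
  have hq : ∀ x ∈ U, ∀ t : J, ∃ τ : SmoothFn d X ℂ,
      ∀ᶠ z in 𝓝 x, (t : SmoothFn n M ℂ) (f z) = τ z * γ z := fun x hx t =>
    (h.germMem_iff hx _).1 (germMem_coe (comp_mem_pullbackIdeal t.2))
  refine ⟨hU, f.contMDiff.contMDiffOn, hγ, hq, fun x hx => ?_⟩
  by_contra! hn
  -- If all quotients vanished at x, every germ of f^*J at x would be τ γ with τ(x) = 0. Applied to
  -- γ itself this contradicts τ = 1 wherever γ ≠ 0.
  have key : ∃ τ : SmoothFn d X ℂ, γ =ᶠ[𝓝 x] (fun z => τ z * γ z) ∧ τ x = 0 := by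
    refine germMem_pullbackIdeal_induction (p := f) (I := J) (P := fun g : X → ℂ =>
      ∃ τ : SmoothFn d X ℂ, g =ᶠ[𝓝 x] (fun z => τ z * γ z) ∧ τ x = 0) ?_ ?_ ?_ ?_ ?_
      (h.germMem hx 0)
    · rintro g g' hg ⟨τ, h1, h2⟩
      exact ⟨τ, hg.symm.trans h1, h2⟩
    · intro t ht
      obtain ⟨τ, hτ⟩ := hq x hx ⟨t, ht⟩
      refine ⟨τ, hτ, ?_⟩
      rw [← divVal_eq (hγ x hx) (t := ⟨t, ht⟩) τ.continuous.continuousAt hτ]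
      exact hn _
    · exact ⟨0, .of_forall fun z => by simp, rfl⟩
    · rintro g g' ⟨τ, h1, h2⟩ ⟨τ', h1', h2'⟩
      refine ⟨τ + τ', ?_, by simp [h2, h2']⟩
      filter_upwards [h1, h1'] with z hz hz'
      simp [hz, hz', add_mul]
    · rintro c g ⟨τ, h1, h2⟩
      refine ⟨c * τ, ?_, by simp [h2]⟩
      filter_upwards [h1] with z hz
      simp [hz, mul_assoc]
  obtain ⟨τ, h1, h2⟩ := key
  refine one_ne_zero (α := ℂ) (Eq.trans ?_ h2)
  refine eq_of_eventually_mul_eq (hγ x hx) (τ := fun _ => 1) continuousAt_const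
    τ.continuous.continuousAt ?_
  filter_upwards [h1] with z hz
  rw [one_mul, ← hz]

theorem exists_mem_ne_zero_of_generatedOn {U : Set X} {γ : X → ℂ}
    (h : GeneratedOn (pullbackIdeal f J) U (fun _ : Fin 1 => γ)) {x : X} (hx : x ∈ U)
    (h0 : γ x ≠ 0) : ∃ t : J, (t : SmoothFn n M ℂ) (f x) ≠ 0 := by
  by_contra! hn
  refine h0 (germMem_pullbackIdeal_induction (p := f) (I := J) (x := x)
    (P := fun g : X → ℂ => g x = 0) ?_ (fun t ht => hn ⟨t, ht⟩) rfl ?_ ?_ (h.germMem hx 0))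
  · intro g g' hg h1
    rw [← hg.self_of_nhds, h1]
  · intro g g' h1 h2
    rw [Pi.add_apply, h1, h2, add_zero]
  · intro c g h1
    rw [Pi.mul_apply, h1, mul_zero]

/-- The lifts defined by two local generators coincide. -/
theorem IsDivisibleOn.lift_eq_lift {U U' : Set X} {γ γ' : X → ℂ}
    (h : GeneratedOn (pullbackIdeal f J) U (fun _ : Fin 1 => γ))
    (h' : GeneratedOn (pullbackIdeal f J) U' (fun _ : Fin 1 => γ'))
    (hγ : IsDivisibleOn (d := d) J U f γ) (hγ' : IsDivisibleOn (d := d) J U' f γ') {x : X}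
    (hx : x ∈ U) (hx' : x ∈ U') : hγ.lift hx = hγ'.lift hx' := by
  -- With γ' = a γ, quotients by γ are a times quotients by γ', and a(x) ≠ 0 since the quotients by
  -- γ do not all vanish. The functionals differ only by scaling.
  obtain ⟨a, ha⟩ := (h.germMem_iff hx _).1 (h'.germMem hx' 0)
  have key : ∀ t : J, divVal f γ x t = a x * divVal f γ' x t := by
    intro t
    obtain ⟨τ, h1, h2⟩ := hγ'.exists_quotient' hx' t
    rw [h2.self_of_nhds]
    refine divVal_eq (hγ.frequently x hx) (τ := a * τ) (a * τ).continuous.continuousAt ?_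
    filter_upwards [h1, ha] with z h1 h2
    rw [h1, h2, Pi.mul_apply]
    ring
  have ha0 : a x ≠ 0 := by
    obtain ⟨t, ht⟩ := hγ.exists_ne_zero x hx
    intro h0
    rw [key, h0, zero_mul] at ht
    exact ht rfl
  refine BlowPt.ext_of_mul (b := hγ.lift hx) (b' := hγ'.lift hx') rfl (hγ.lift_ratio hx)
    (hγ'.lift_ratio hx') (inv_ne_zero ha0) fun s => ?_
  rw [key, inv_mul_cancel_left₀ ha0]

variable [IsManifold (𝓡 n) ∞ M] [T2Space M] (h : HasPlots J)

theorem BlowUpSpace.contMDiffAt_of_isDivisibleOn {O : Set X} {f : X → M} {γ : X → ℂ}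
    (hO : IsDivisibleOn (d := d) J O f γ) {g : X → BlowUpSpace h}
    (hg : ∀ z (hz : z ∈ O), g z = hO.lift hz) {x : X} (hx : x ∈ O) :
    ContMDiffAt (𝓡 d) (𝓡 n) ∞ g x := by
  obtain ⟨P, b₀, hP⟩ := exists_chart h (g x)
  obtain ⟨h1, h2⟩ := hO.eventually_contMDiffAt hg P hx (b₀ := b₀) hP
  have h3 := contMDiffOn_symm_of_mem_maximalAtlas (chart_mem_maximalAtlas h P b₀)
  have h4 := h3.contMDiffAt ((chart h P b₀).open_target.mem_nhds ((chart h P b₀).map_source hP))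
  refine (ContMDiffAt.comp x h4 h2).congr_of_eventuallyEq ?_
  filter_upwards [h1] with z hz
  exact ((chart h P b₀).left_inv hz).symm

theorem BlowUpSpace.existsUnique_lift (hf : IsDivisor (pullbackIdeal f J)) :
    ∃! g : C^∞⟮𝓡 d, X; 𝓡 n, BlowUpSpace h⟯, (proj h).comp g = f := by
  choose U hU hxU γ hγ hgen hnd using hf.locally_principal
  have hfr : ∀ x, ∀ z ∈ U x, ∃ᶠ w in 𝓝 z, γ x w ≠ 0 := fun x z hz =>
    frequently_ne_zero_of_isNowhereDense (hU x) (hnd x) hz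
  have hdiv := fun x => IsDivisibleOn.of_generatedOn (hU x) (hfr x) (hgen x)
  let g₀ : X → BlowUpSpace h := fun x => (hdiv x).lift (hxU x)
  have hsm : ContMDiff (𝓡 d) (𝓡 n) ∞ g₀ := fun x =>
    contMDiffAt_of_isDivisibleOn h (hdiv x)
      (fun z hz => IsDivisibleOn.lift_eq_lift (hgen z) (hgen x) (hdiv z) (hdiv x) (hxU z) hz) (hxU x)
  refine ⟨⟨g₀, hsm⟩, DFunLike.ext _ _ fun x => rfl, fun g hg => DFunLike.ext _ _ ?_⟩
  have hg' : ∀ x, BlowPt.pt (g x) = f x := fun x => DFunLike.congr_fun hg x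
  -- Wherever the local generator is nonzero, J has a member that does not vanish at the image
  -- point, so there is only one point of the blow-up above it. Such points are dense and the
  -- equaliser is closed.
  have hclosed : IsClosed {x | g x = g₀ x} :=
    isClosed_eq g.contMDiff.continuous hsm.continuous
  intro x
  refine hclosed.closure_subset (mem_closure_iff_frequently.2 ?_)
  refine ((hfr x x (hxU x)).and_eventually ((hU x).mem_nhds (hxU x))).mono fun z hz => ?_
  obtain ⟨t, ht⟩ := exists_mem_ne_zero_of_generatedOn (hgen x) hz.2 hz.1
  exact BlowPt.eq_of_apply_ne_zero (hg' z) (t := t) ((hg' z).symm ▸ ht)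

theorem BlowUpSpace.isBlowUp [SecondCountableTopology M] : IsBlowUp J (proj h) where
  isManifold := inferInstance
  t2 := inferInstance
  secondCountable := inferInstance
  isDivisor := isDivisor_pullback h
  existsUnique_lift _ _ _ _ _ _ _ _ hf := existsUnique_lift h hf

end UniversalProperty


/-! ### Uniqueness of the blow-up and assembly of the theorem. -/

section Main

variable {n : ℕ} {M : Type u} [TopologicalSpace M] [ChartedSpace (Euc n) M]

section Uniqueness

variable {J : Ideal (SmoothFn n M ℂ)} {B B' : Type u} [TopologicalSpace B] [ChartedSpace (Euc n) B]
  [TopologicalSpace B'] [ChartedSpace (Euc n) B'] {p : C^∞⟮𝓡 n, B; 𝓡 n, M⟯}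
  {p' : C^∞⟮𝓡 n, B'; 𝓡 n, M⟯}

/-- The blow-up is unique up to diffeomorphism. -/
theorem IsBlowUp.exists_diffeomorph (h : IsBlowUp J p) (h' : IsBlowUp J p') :
    ∃ g : B ≃ₘ⟮𝓡 n, 𝓡 n⟯ B', ∀ x, p' (g x) = p x := by
  have := h.isManifold
  have := h.t2
  have := h.secondCountable
  have := h'.isManifold
  have := h'.t2
  have := h'.secondCountable
  obtain ⟨g, hg, -⟩ := h'.existsUnique_lift n B p h.isDivisor
  obtain ⟨g', hg', -⟩ := h.existsUnique_lift n B' p' h'.isDivisor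
  have hx : ∀ x, p' (g x) = p x := fun x => DFunLike.congr_fun hg x
  have hx' : ∀ x, p (g' x) = p' x := fun x => DFunLike.congr_fun hg' x
  have h1 : g'.comp g = ContMDiffMap.id :=
    (h.existsUnique_lift n B p h.isDivisor).unique
      (DFunLike.ext _ _ fun x => (hx' (g x)).trans (hx x)) (DFunLike.ext _ _ fun x => rfl)
  have h2 : g.comp g' = ContMDiffMap.id :=
    (h'.existsUnique_lift n B' p' h'.isDivisor).unique
      (DFunLike.ext _ _ fun x => (hx (g' x)).trans (hx' x)) (DFunLike.ext _ _ fun x => rfl)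
  exact ⟨⟨⟨g, g', DFunLike.congr_fun h1, DFunLike.congr_fun h2⟩, g.contMDiff, g'.contMDiff⟩, hx⟩

theorem HasLocalModels.of_diffeomorph {I : Ideal (SmoothFn n M ℝ)} {l : ℕ} [IsManifold (𝓡 n) ∞ B]
    [IsManifold (𝓡 n) ∞ B'] (H : HasLocalModels I p' l) (g : B ≃ₘ⟮𝓡 n, 𝓡 n⟯ B')
    (hg : ∀ x, p' (g x) = p x) : HasLocalModels I p l := by
  intro x
  obtain ⟨ψ, φ, k, m, α, h, hx⟩ := H (g x)
  refine ⟨g.toHomeomorph.toOpenPartialHomeomorph.trans ψ, φ, k, m, α, ?_, by simpa using hx⟩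
  have hsrc : ∀ {z : B}, z ∈ (g.toHomeomorph.toOpenPartialHomeomorph.trans ψ).source →
      g z ∈ ψ.source := fun hz => by simpa using hz
  exact
    { mem_source := OpenPartialHomeomorph.mem_maximalAtlas_of_contMDiffOn _
        ((contMDiffOn_of_mem_maximalAtlas h.mem_source).comp g.contMDiff.contMDiffOn
          fun z hz => hsrc hz)
        (g.symm.contMDiff.comp_contMDiffOn ((contMDiffOn_symm_of_mem_maximalAtlas h.mem_source).mono
          fun z hz => by simpa using hz))
      mem_target := h.mem_target
      mapsTo := fun z hz => hg z ▸ h.mapsTo _ (hsrc hz)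
      two_mul_le := h.two_mul_le
      index := h.index
      le_mult := h.le_mult
      le_codim := h.le_codim
      apply_eq := fun z hz => hg z ▸ h.apply_eq _ (hsrc hz)
      generated := h.generated }

end Uniqueness

variable [IsManifold (𝓡 n) ∞ M] [T2Space M]

/-- Near every point there are plots which cover the blow-up and in which the elliptic divisor has
its normal form. -/
theorem exists_plots {I : Ideal (SmoothFn n M ℝ)} (hI : IsEllipticDivisor I) {l : ℕ} {Y : Set M}
    {J : Ideal (SmoothFn n M ℂ)} (hJ : IsHolomorphicIdeal l Y J) (hIJ : IsAdapted I l Y J) (y : M) :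
    ∃ (N : ℕ) (P : Fin N → Plot J), ∃ U ∈ 𝓝 y,
      (∀ b : BlowPt J, b.pt ∈ U →
        ∃ i, b.pt ∈ (P i).chart.source ∧ b.lam ((P i).gen (P i).α) ≠ 0) ∧
      ∀ i, (P i).m ≤ l ∧ ∃ k, (P i).m ≤ k ∧ 2 * k ≤ n ∧ GeneratedOn I (P i).chart.source
        (fun _ : Fin 1 => fun y => ellipticModel k ((P i).chart y)) := by
  by_cases hy : y ∈ Y
  · obtain ⟨φ, hyφ, hφ, k, hlk, hk, hgen⟩ := hIJ y hy
    choose s hs hsz using fun i => hφ.generated.germMem hyφ i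
    obtain ⟨V, hV, hVo, hyV⟩ := mem_nhds_iff.1 (Filter.eventually_all.2 hsz)
    -- Only the indices below l matter; 0 is a default value.
    let gen : ℕ → J := fun i => if h : i < l then ⟨s ⟨i, h⟩, hs _⟩ else 0
    have hgen' : ∀ z ∈ (φ.restr V).source, ∀ i < l,
        (gen i : SmoothFn n M ℂ) z = zCoord i (φ z) := by
      intro z hz i hi
      rw [φ.restr_source' V hVo] at hz
      simp only [gen, dif_pos hi]
      exact (hV hz.2 ⟨i, hi⟩).symm
    have hsub : (φ.restr V).source ⊆ φ.source := by
      rw [φ.restr_source' V hVo]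
      exact Set.inter_subset_left
    have hJgen : GeneratedOn J (φ.restr V).source fun i : Fin l => (gen i : SmoothFn n M ℂ) :=
      (hφ.generated.mono hsub).congr (φ.restr V).open_source fun z hz i => (hgen' z hz i i.2).symm
    -- There is one plot for each index α < l, all over the same domain; a nonzero functional is
    -- nonzero on some generator, so they cover.
    refine ⟨l, fun i => ⟨φ.restr V, l, l, i, gen, restr_mem_maximalAtlas _ hφ.mem_atlas hVo,
      hφ.two_mul_le, i.2, hJgen, Or.inr ⟨rfl, hgen'⟩⟩, (φ.restr V).source,
      (φ.restr V).open_source.mem_nhds ?_, fun b hb => ?_, fun i => ⟨le_rfl, k, hlk, hk,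
        hgen.mono hsub⟩⟩
    · rw [φ.restr_source' V hVo]
      exact ⟨hyφ, hyV⟩
    · obtain ⟨i, hi⟩ := b.isFunctionalAt.exists_generator_ne_zero hJgen hb
      exact ⟨i, hb, hi⟩
  · obtain ⟨φ, hφ, hyφ, -, k, hk, hgen⟩ := hI.exists_chart y
    obtain ⟨σ, hσ, h1⟩ := hJ.generated_compl.germMem hy 0
    obtain ⟨V, hV, hVo, hyV⟩ := mem_nhds_iff.1
      (Filter.inter_mem h1 (hJ.isClosed.isOpen_compl.mem_nhds hy))
    have hsrc := φ.restr_source' V hVo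
    have hJgen : GeneratedOn J (φ.restr V).source fun _ : Fin 1 => σ := by
      refine (hJ.generated_compl.mono fun z hz => ?_).congr (φ.restr V).open_source
        fun z hz _ => ?_
      · rw [hsrc] at hz
        exact (hV hz.2).2
      · rw [hsrc] at hz
        exact (hV hz.2).1
    -- Away from Y a single plot suffices: the generator σ equals 1 on the domain and m = 0, so the
    -- blow-down map is the identity in coordinates.
    refine ⟨1, fun _ => ⟨φ.restr V, 1, 0, 0, fun _ => ⟨σ, hσ⟩, restr_mem_maximalAtlas _ hφ hVo,
      by omega, one_pos, hJgen, Or.inl ⟨rfl, rfl, fun z hz => ?_⟩⟩, (φ.restr V).source,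
      (φ.restr V).open_source.mem_nhds ?_, fun b hb => ?_, fun i => ⟨Nat.zero_le _, k,
        Nat.zero_le _, hk, hgen.mono ?_⟩⟩
    · rw [hsrc] at hz
      exact ((hV hz.2).1).symm
    · rw [hsrc]
      exact ⟨hyφ, hyV⟩
    · obtain ⟨i, hi⟩ := b.isFunctionalAt.exists_generator_ne_zero (s := fun _ : Fin 1 => ⟨σ, hσ⟩)
        hJgen hb
      exact ⟨i, hb, hi⟩
    · rw [hsrc]
      exact Set.inter_subset_left

theorem IsHolomorphicIdeal.hasPlots {I : Ideal (SmoothFn n M ℝ)} (hI : IsEllipticDivisor I) {l : ℕ}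
    {Y : Set M} {J : Ideal (SmoothFn n M ℂ)} (hJ : IsHolomorphicIdeal l Y J)
    (hIJ : IsAdapted I l Y J) : HasPlots J := fun y => by
  obtain ⟨N, P, U, hU, hP, -⟩ := exists_plots hI hJ hIJ y
  exact ⟨N, P, U, hU, hP⟩

theorem BlowUpSpace.hasLocalModels {I : Ideal (SmoothFn n M ℝ)} (hI : IsEllipticDivisor I) {l : ℕ}
    {Y : Set M} {J : Ideal (SmoothFn n M ℂ)} (hJ : IsHolomorphicIdeal l Y J)
    (hIJ : IsAdapted I l Y J) (h : HasPlots J) : HasLocalModels I (proj h) l := by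
  intro b
  obtain ⟨N, P, U, hU, hP, hPI⟩ := exists_plots hI hJ hIJ (BlowPt.pt b)
  obtain ⟨i, hi⟩ := hP b (mem_of_mem_nhds hU)
  obtain ⟨hml, k, hmk, hk, hgen⟩ := hPI i
  exact ⟨chart h (P i) b, (P i).chart, k, (P i).m, (P i).α,
    { mem_source := chart_mem_maximalAtlas h _ _
      mem_target := (P i).mem_atlas
      mapsTo := fun x hx => hx.1
      two_mul_le := hk
      index := (P i).index
      le_mult := hmk
      le_codim := hml
      apply_eq := fun x hx => (blowMap_chart hx).symm
      generated := hgen }, hi⟩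

end Main

theorem mainTheorem4 {n : ℕ} {M : Type u} [TopologicalSpace M]
    [ChartedSpace (EuclideanSpace ℝ (Fin n)) M] [IsManifold (𝓡 n) ∞ M] [T2Space M]
    [SecondCountableTopology M]
    (I : Ideal (SmoothFn n M ℝ)) (hI : IsEllipticDivisor I)
    (l : ℕ) (hl : 0 < l) (Y : Set M)
    (J : Ideal (SmoothFn n M ℂ)) (hJ : IsHolomorphicIdeal l Y J) (hIJ : IsAdapted I l Y J) :
    (∃ (B : Type u) (_ : TopologicalSpace B) (_ : ChartedSpace (EuclideanSpace ℝ (Fin n)) B)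
      (p : C^∞⟮𝓡 n, B; 𝓡 n, M⟯), IsBlowUp J p) ∧
    ∀ (B : Type u) [TopologicalSpace B] [ChartedSpace (EuclideanSpace ℝ (Fin n)) B]
      (p : C^∞⟮𝓡 n, B; 𝓡 n, M⟯), IsBlowUp J p →
      IsEllipticDivisor (pullbackIdeal p I).radical ∧
      ∃ Φ : ∀ x : B, EllipticFibre (pullbackIdeal p I).radical x →ₗ[ℝ] EllipticFibre I (p x),
        IsLieAlgebroidMap (pullbackIdeal p I).radical I p Φ ∧
        ∀ x : B, Function.Bijective (Φ x) := by
  have h := hJ.hasPlots hI hIJ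
  refine ⟨⟨BlowUpSpace h, _, _, BlowUpSpace.proj h, BlowUpSpace.isBlowUp h⟩, ?_⟩
  intro B _ _ p hp
  have := hp.isManifold
  have := hp.t2
  -- An arbitrary blow-up inherits the local models through its diffeomorphism over M with the
  -- constructed one.
  obtain ⟨g, hg⟩ := hp.exists_diffeomorph (BlowUpSpace.isBlowUp h)
  have H := (BlowUpSpace.hasLocalModels hI hJ hIJ h).of_diffeomorph g hg
  exact ⟨H.isEllipticDivisor hl, exists_lieAlgebroidMap (H.hasRelatedFrames hl hI.isDivisor.isLocal)⟩
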